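/- Let $\Omega=[-\pi,\pi]^2$ be the two-dimensional torus (periodic boundary conditions). All solutions and data are real-valued. Write $(f,g)=\int_\Omega f\bar g\,d\mathbf x$, $\|f\|=(f,f)^{1/2}$, $\hat f(\mathbf k)=(2\pi)^{-2}\int_\Omega f(\mathbf x)e^{-i\mathbf k\cdot\mathbf x}\,d\mathbf x$, $\|f\|_s^2=\sum_{\mathbf k\in\mathbb Z^2}(1+|\mathbf k|^2)^s|\hat f(\mathbf k)|^2$, let $H^s_{\mathrm{per}}(\Omega)$ be the space of $f\in L^2(\Omega)$ with $\|f\|_s<\infty$, let $(-\Delta)^{\alpha/2}$ be the Fourier multiplier $|\mathbf k|^\alpha$, and $\mathbb X_N=\mathrm{span}\{e^{i\mathbf k\cdot\mathbf x}:\max(|k_1|,|k_2|)\le N\}$. Let $\alpha\in[1,2]$ and consider the fractional Zakharov--Kuznetsov equation $$\partial_t u-\partial_{x_1}(-\Delta)^{\alpha/2}u+u\,\partial_{x_1}u=0,\qquad u(0)=u_0,\qquad u_0\in H^{1+\alpha}_{\mathrm{per}}(\Omega).\tag{1}$$ A Galerkin solution $u_N$ on $[0,T]$ is a differentiable $L^2$-valued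 function with values in $\mathbb X_N$ such that, for all $v\in\mathbb X_N$ and $t\in[0,T]$, $$(\partial_t u_N,v)+((-\Delta)^{\alpha/2}u_N,\partial_{x_1}v)-\tfrac12(u_N^2,\partial_{x_1}v)=0,\qquad (u_N(0),v)=(u_0,v).$$ A weak solution of (1) on $[0,T]$ is a $u\in L^\infty(0,T;L^2(\Omega))$ such that, for all smooth $\varphi$ on $[0,T)\times\Omega$ that are periodic in $\mathbf x$ and compactly supported in $[0,T)$ in time, $$\int_0^T\Big[(u,\partial_t\varphi)-(u,(-\Delta)^{\alpha/2}\partial_{x_1}\varphi)+\tfrac12(u^2,\partial_{x_1}\varphi)\Big]dt+(u_0,\varphi(0))=0 .$$ A strong solution is a weak solution with $u\in L^\infty(0,T;H^{1+\alpha}_{\mathrm{per}}(\Omega))$, $\partial_t u\in L^\infty(0,T;L^2(\Omega))$ and $u(0)=u_0$ (for its representative continuous in time). **Lemma.** Let $\alpha\in[1,2]$. For every $R\ge 0$ there are a time $\bar T>0$ and a constant $C$, depending only on $\alpha$ and $R$, such that for every $u_0\in H^{1+\alpha}_{\mathrm{per}}(\Omega)$ with $\|u_0\|_{1+\alpha}\le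 R$ the following hold. 1. For every $N\in\mathbb N$ there is a Galerkin solution $u_N$ on $[0,\bar T]$, and every Galerkin solution $u_N$ on $[0,\bar T]$ satisfies, for all $t\in[0,\bar T]$, $$\|u_N(t)\|\le C,\qquad \|\partial_t u_N(t)\|\le C,\qquad \|u_N(t)\|_{1+\alpha}\le C .$$ 2. There is exactly one strong solution $u$ of (1) on $[0,\bar T]$; it belongs to $C([0,\bar T];L^2(\Omega))$ and satisfies the equation in (1) in $L^2(\Omega)$ for almost every $t\in[0,\bar T]$. 3. The Galerkin solutions converge to it uniformly: $\sup_{t\in[0,\bar T]}\|u_N(t)-u(t)\|\to0$ as $N\to\infty$. -/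

import Mathlib

open MeasureTheory Filter Topology

noncomputable section

namespace FZK

/-- The plane; functions on the torus are described on the period cell `Ω`. -/
abbrev Plane : Type := Fin 2 → ℝ

/-- The period cell `Ω = [-π, π]²`. -/
def Ω : Set Plane := Set.Icc (fun _ => -Real.pi) (fun _ => Real.pi)

/-- Real-valued `L²(Ω)`, with norm `‖u‖ = (∫_Ω |u|²)^{1/2}`. -/
abbrev L2 : Type := Lp ℝ 2 (volume.restrict Ω)

/-- A real `L²` function, viewed as a complex-valued function. -/
def toC (u : L2) : Plane → ℂ := fun x => ((u x : ℝ) : ℂ)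

/-- The inner product `(f, g) = ∫_Ω f \bar g dx`. -/
def ip (f g : Plane → ℂ) : ℂ := ∫ x in Ω, f x * (starRingEnd ℂ) (g x)

/-- The exponential `e^{i k·x}`. -/
def expMode (k : Fin 2 → ℤ) (x : Plane) : ℂ :=
  Complex.exp (Complex.I * ((k 0 : ℂ) * (x 0 : ℂ) + (k 1 : ℂ) * (x 1 : ℂ)))

/-- The Fourier coefficient `(2π)⁻² ∫_Ω f(x) e^{-i k·x} dx`. -/
def coeff (f : Plane → ℂ) (k : Fin 2 → ℤ) : ℂ :=
  ((2 * (Real.pi : ℂ)) ^ 2)⁻¹ * ip f (expMode k)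

/-- `|k|² = k₁² + k₂²`. -/
def normSq (k : Fin 2 → ℤ) : ℝ := (k 0 : ℝ) ^ 2 + (k 1 : ℝ) ^ 2

/-- `|k|^s`. -/
def absPow (s : ℝ) (k : Fin 2 → ℤ) : ℝ := Real.sqrt (normSq k) ^ s

/-- The spectral fractional Laplacian
`(-Δ)^{s/2} f(x) = ∑ₖ |k|^s \hat f(k) e^{i k·x}`. -/
def fracLap (s : ℝ) (f : Plane → ℂ) (x : Plane) : ℂ :=
  ∑' k : Fin 2 → ℤ, ((absPow s k : ℝ) : ℂ) * coeff f k * expMode k x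

/-- The classical partial derivative `∂f/∂x₁`. -/
def pderiv (f : Plane → ℂ) (x : Plane) : ℂ := fderiv ℝ f x (Pi.single 0 1)

/-- Membership in the periodic Sobolev space `H^s_per(Ω)`. -/
def MemSobolev (s : ℝ) (u : L2) : Prop :=
  Summable fun k : Fin 2 → ℤ => (1 + normSq k) ^ s * ‖coeff (toC u) k‖ ^ 2

/-- The norm `‖u‖_s` of `H^s_per(Ω)` (meaningful when `MemSobolev s u`). -/
def sobolevNorm (s : ℝ) (u : L2) : ℝ :=
  Real.sqrt (∑' k : Fin 2 → ℤ, (1 + normSq k) ^ s * ‖coeff (toC u) k‖ ^ 2)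

/-- Trigonometric polynomials: the span of the `e^{i k·x}` with `max(|k₁|, |k₂|) ≤ N`. -/
def trigPoly (N : ℕ) : Submodule ℂ (Plane → ℂ) :=
  Submodule.span ℂ {f | ∃ k : Fin 2 → ℤ, (∀ j, |k j| ≤ (N : ℤ)) ∧ f = expMode k}

/-- `w` solves the Fourier-Galerkin scheme with `N` modes on `[0, T]`:
`(∂ₜw, v) + ((-Δ)^{α/2} w, ∂₁v) - ½ (w², ∂₁v) = 0` and `(w(0), v) = (u₀, v)` for all
trigonometric polynomials `v`. -/
structure IsGalerkinSolution (α T : ℝ) (u₀ : L2) (N : ℕ) (w : ℝ → L2) : Prop where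
  mem : ∀ t ∈ Set.Icc 0 T, ∃ f ∈ trigPoly N, toC (w t) =ᵐ[volume.restrict Ω] f
  diff : DifferentiableOn ℝ w (Set.Icc 0 T)
  scheme : ∀ t ∈ Set.Icc 0 T, ∀ v ∈ trigPoly N,
    ip (toC (derivWithin w (Set.Icc 0 T) t)) v
      + ip (fracLap α (toC (w t))) (pderiv v)
      - (1 / 2) * ip (fun x => toC (w t) x ^ 2) (pderiv v) = 0
  init : ∀ v ∈ trigPoly N, ip (toC (w 0)) v = ip (toC u₀) v

/-- Smooth test functions on `[0, T) × torus`, compactly supported in `[0, T)`. -/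
structure IsTestFunction (T : ℝ) (φ : ℝ → Plane → ℂ) : Prop where
  smooth : ContDiff ℝ ((⊤ : ℕ∞) : WithTop ℕ∞) (fun p : ℝ × Plane => φ p.1 p.2)
  periodic : ∀ (t : ℝ) (x : Plane) (j : Fin 2), φ t (x + Pi.single j (2 * Real.pi)) = φ t x
  support : ∃ T' < T, ∀ t, T' ≤ t → ∀ x, φ t x = 0

/-- Weak solutions on `[0, T]` of `∂ₜu - ∂₁(-Δ)^{α/2}u + u ∂₁u = 0` with data `u₀`. -/
structure IsWeakSolution (α T : ℝ) (u₀ : L2) (u : ℝ → L2) : Prop where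
  bounded : MemLp u ⊤ (volume.restrict (Set.Icc 0 T))
  weak : ∀ φ : ℝ → Plane → ℂ, IsTestFunction T φ →
    (∫ t in (0 : ℝ)..T,
        (ip (toC (u t)) (fun x => deriv (fun s => φ s x) t)
          - ip (toC (u t)) (fracLap α (pderiv (φ t)))
          + (1 / 2) * ip (fun x => toC (u t) x ^ 2) (pderiv (φ t))))
      + ip (toC u₀) (φ 0) = 0

/-- `g ∈ L^∞(0, T; L²)` is the time derivative of `u` on `[0, T]`. -/
structure IsTimeDerivative (T : ℝ) (u g : ℝ → L2) : Prop where
  bounded : MemLp g ⊤ (volume.restrict (Set.Icc 0 T))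
  integral_eq : ∀ t ∈ Set.Icc 0 T, u t = u 0 + ∫ s in (0 : ℝ)..t, g s

/-- Strong solutions: weak solutions with `u ∈ L^∞(0, T; H^{1+α})` and
`∂ₜu ∈ L^∞(0, T; L²)`; `u` is its representative continuous in time. -/
structure IsStrongSolution (α T : ℝ) (u₀ : L2) (u : ℝ → L2) : Prop where
  weak : IsWeakSolution α T u₀ u
  init : u 0 = u₀
  sobolev : ∃ M : ℝ, ∀ᵐ t ∂(volume.restrict (Set.Icc 0 T)),
    MemSobolev (1 + α) (u t) ∧ sobolevNorm (1 + α) (u t) ≤ M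
  timeDeriv : ∃ g : ℝ → L2, IsTimeDerivative T u g

/-- The equation `∂ₜu - ∂₁(-Δ)^{α/2}u + u ∂₁u = 0` holds at almost every time, almost
everywhere in `Ω`; here `p = ∂₁u(t)` and `q = ∂₁(-Δ)^{α/2}u(t)` are the `L²` functions
with Fourier coefficients `i k₁ \hat u(k)` and `i k₁ |k|^α \hat u(k)`. -/
def SatisfiesEquation (α T : ℝ) (u : ℝ → L2) : Prop :=
  ∃ g : ℝ → L2, IsTimeDerivative T u g ∧
    ∀ᵐ t ∂(volume.restrict (Set.Icc 0 T)), ∃ p q : L2,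
      (∀ k, coeff (toC p) k = Complex.I * (k 0 : ℂ) * coeff (toC (u t)) k) ∧
      (∀ k, coeff (toC q) k =
        Complex.I * (k 0 : ℂ) * ((absPow α k : ℝ) : ℂ) * coeff (toC (u t)) k) ∧
      ∀ᵐ x ∂(volume.restrict Ω), g t x - q x + u t x * p x = 0

end FZK

end

/-! In Fourier coefficients the equation reads `a_k' = i ω(k) a_k - (i k₁/2) Σ_l a_l a_{k-l}` with
`ω(k) = k₁|k|^α`. The derivative of the `H^s` energy, `s = 1 + α`, is a cubic form over triples `k +
l + m = 0`. Its symmetrized multiplier is at most a constant times `⟨l⟩⁻¹ ⟨k⟩^s ⟨l⟩^s ⟨m⟩^s` when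
`l` is the shortest frequency (`energyMult_le`). In two dimensions `⟨l⟩⁻¹` just fails to be square
summable, so at the endpoint `α = 1`, `s = 2`, the plain energy estimate misses by a logarithm: `H²`
does not embed into the Lipschitz functions.

Dispersion repairs this. If `8|l| ≤ |k|`, the resonance function `ω(k) + ω(l) + ω(m)` is strictly
monotone in `l₁` with slope at least `|k|^α / 4` (`reson_increment`). For fixed `l₂` only
`O(⟨l₂⟩^{1/2})` values of `l₁` therefore keep it below `K |k|^α ⟨l₂⟩^{1/2}`, and over these the sum
of `⟨l⟩⁻²` converges (`exists_tsum_resMult_sq_le`). On the other triples a cubic correction of the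
energy, with the multiplier divided by the resonance function, cancels the form. The division gains
a full derivative, because `α ≥ 1`, and a factor `⟨l₂⟩^{-1/2}` (`Nonres.energyMult_div_le`): the
first pays for the derivative in the nonlinearity, the second makes the lattice sum converge. Any
exponent strictly between 0 and 1 could replace `1/2`. For `K` large compared with the data the
correction is a small part of the energy, and a continuity argument bounds all Galerkin solutions on
a common time interval (`exists_apriori_bound`).

Convergence and uniqueness rest on one stability estimate (`exists_stability`). On the frequencies
of `box J` the squared `L²` difference of two solutions obeys a Gronwall inequality with rate
`O(√log J)` and error `O(1/J)`, and `e^{C√log J}/J` tends to 0. Only the modes in `box J` have to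
satisfy the equation, so the estimate compares Galerkin solutions of different orders, their limit,
and any strong solution.

Galerkin solutions exist on any time interval by Picard–Lindelöf and conservation of the `L²` norm.
Their limit solves the equation integrated in time, mode by mode (`IsMildSolution`). Parseval's
identity turns this into the weak form, and testing with `η(t) e^{i k·x}` leads back from a strong
solution to the mild form (`mild_of_weak`). Sums of absolute values are taken in `ENNReal`, so most
estimates carry no summability conditions. -/

noncomputable section
namespace FZK

/-! ### Frequencies, the energy multiplier and the resonance function. -/

/-- The Euclidean length `|k|` of a frequency. -/
def nrm (k : Fin 2 → ℤ) : ℝ := Real.sqrt (normSq k)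

/-- The Japanese bracket `⟨k⟩ = (1 + |k|²)^{1/2}`. -/
def jb (k : Fin 2 → ℤ) : ℝ := Real.sqrt (1 + normSq k)

/-- The one-dimensional Japanese bracket. -/
def jbi (n : ℤ) : ℝ := Real.sqrt (1 + (n : ℝ) ^ 2)

/-- The dispersion relation `ω(k) = k₁ |k|^α`. -/
def omega (α : ℝ) (k : Fin 2 → ℤ) : ℝ := (k 0 : ℝ) * absPow α k

/-- The resonance function on triples `(k, l, -k-l)`. -/
def reson (α : ℝ) (k l : Fin 2 → ℤ) : ℝ := omega α k + omega α l + omega α (-k - l)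

/-- The multiplier `k₁ ⟨k⟩^{2s} + l₁ ⟨l⟩^{2s} + m₁ ⟨m⟩^{2s}` with `m = -k-l`. -/
def energyMult (s : ℝ) (k l : Fin 2 → ℤ) : ℝ :=
  (k 0 : ℝ) * (1 + normSq k) ^ s + (l 0 : ℝ) * (1 + normSq l) ^ s
    + ((-k - l) 0 : ℝ) * (1 + normSq (-k - l)) ^ s

/-- The product of the Sobolev weights of a triple `(k, l, -k-l)`. -/
def tripleWeight (s : ℝ) (k l : Fin 2 → ℤ) : ℝ := jb k ^ s * jb l ^ s * jb (-k - l) ^ s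

/-- The pair `(k, l)` is nonresonant: `l` is much shorter than `k` and the resonance function
is large. -/
def Nonres (α K : ℝ) (k l : Fin 2 → ℤ) : Prop :=
  8 * nrm l ≤ nrm k ∧ K * absPow α k * Real.sqrt (jbi (l 1)) < |reson α k l|

theorem normSq_nonneg (k : Fin 2 → ℤ) : 0 ≤ normSq k := by unfold normSq; positivity

theorem nrm_nonneg (k : Fin 2 → ℤ) : 0 ≤ nrm k := Real.sqrt_nonneg _

theorem nrm_sq (k : Fin 2 → ℤ) : nrm k ^ 2 = normSq k := Real.sq_sqrt (normSq_nonneg k)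

theorem jb_sq (k : Fin 2 → ℤ) : jb k ^ 2 = 1 + normSq k :=
  Real.sq_sqrt (by linarith [normSq_nonneg k])

theorem one_le_jb (k : Fin 2 → ℤ) : 1 ≤ jb k :=
  Real.one_le_sqrt.2 (by linarith [normSq_nonneg k])

theorem jb_pos (k : Fin 2 → ℤ) : 0 < jb k := by linarith [one_le_jb k]

theorem nrm_le_jb (k : Fin 2 → ℤ) : nrm k ≤ jb k := Real.sqrt_le_sqrt (by linarith)

theorem jbi_sq (n : ℤ) : jbi n ^ 2 = 1 + (n : ℝ) ^ 2 := Real.sq_sqrt (by positivity)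

theorem one_le_jbi (n : ℤ) : 1 ≤ jbi n :=
  Real.one_le_sqrt.2 (by linarith [sq_nonneg (n : ℝ)])

theorem jbi_pos (n : ℤ) : 0 < jbi n := by linarith [one_le_jbi n]

theorem jbi_le_jb (k : Fin 2 → ℤ) : jbi (k 1) ≤ jb k :=
  Real.sqrt_le_sqrt (by unfold normSq; nlinarith [sq_nonneg (k 0 : ℝ)])

theorem abs_fst_le (k : Fin 2 → ℤ) : |(k 0 : ℝ)| ≤ nrm k :=
  Real.abs_le_sqrt (by unfold normSq; nlinarith [sq_nonneg (k 1 : ℝ)])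

theorem abs_snd_le (k : Fin 2 → ℤ) : |(k 1 : ℝ)| ≤ nrm k :=
  Real.abs_le_sqrt (by unfold normSq; nlinarith [sq_nonneg (k 0 : ℝ)])

theorem normSq_neg (k : Fin 2 → ℤ) : normSq (-k) = normSq k := by simp [normSq]

theorem nrm_neg (k : Fin 2 → ℤ) : nrm (-k) = nrm k := by simp [nrm, normSq_neg]

theorem nrm_eq_norm (k : Fin 2 → ℤ) : nrm k = ‖(⟨k 0, k 1⟩ : ℂ)‖ := by
  rw [Complex.norm_eq_sqrt_sq_add_sq]; rfl

theorem nrm_add_le (k l : Fin 2 → ℤ) : nrm (k + l) ≤ nrm k + nrm l := by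
  rw [nrm_eq_norm, nrm_eq_norm, nrm_eq_norm]
  refine le_trans (le_of_eq ?_) (norm_add_le _ _)
  congr 1
  apply Complex.ext <;> simp

theorem nrm_third_le (k l : Fin 2 → ℤ) : nrm (-k - l) ≤ nrm k + nrm l := by
  have := nrm_add_le (-k) (-l)
  rwa [nrm_neg, nrm_neg, ← sub_eq_add_neg] at this

theorem nrm_le_third_add (k l : Fin 2 → ℤ) : nrm k ≤ nrm (-k - l) + nrm l := by
  have := nrm_third_le (-k - l) l
  rwa [show -(-k - l) - l = k by abel] at this

theorem one_le_nrm {k : Fin 2 → ℤ} (hk : k ≠ 0) : 1 ≤ nrm k := by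
  refine Real.one_le_sqrt.2 ?_
  have h : 1 ≤ (k 0) ^ 2 + (k 1) ^ 2 := by
    by_contra! h
    have h0 : k 0 = 0 := by nlinarith [sq_nonneg (k 0), sq_nonneg (k 1)]
    have h1 : k 1 = 0 := by nlinarith [sq_nonneg (k 0), sq_nonneg (k 1)]
    exact hk (by ext j; fin_cases j <;> simpa)
  unfold normSq
  exact_mod_cast h

theorem nrm_zero : nrm 0 = 0 := by simp [nrm, normSq]

theorem absPow_nonneg (α : ℝ) (k : Fin 2 → ℤ) : 0 ≤ absPow α k :=
  Real.rpow_nonneg (nrm_nonneg k) α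

theorem absPow_eq (α : ℝ) (k : Fin 2 → ℤ) : absPow α k = nrm k ^ α := rfl

theorem omega_neg (α : ℝ) (k : Fin 2 → ℤ) : omega α (-k) = -omega α k := by
  simp [omega, absPow_eq, nrm_neg]

theorem jb_le_two_mul {k m : Fin 2 → ℤ} (h : nrm k ≤ 2 * nrm m) : jb k ≤ 2 * jb m := by
  refine Real.sqrt_le_iff.2 ⟨by linarith [jb_pos m], ?_⟩
  rw [mul_pow, jb_sq, ← nrm_sq, ← nrm_sq]
  nlinarith [nrm_nonneg k, nrm_nonneg m]

theorem jb_rpow_mul_self (s : ℝ) (k : Fin 2 → ℤ) : jb k ^ s * jb k ^ s = (1 + normSq k) ^ s := by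
  rw [← Real.mul_rpow (jb_pos k).le (jb_pos k).le, ← sq, jb_sq]

/-- Tangent-line inequality for a convex power, from Bernoulli's inequality at `y / x`. No order
between `x` and `y` is assumed, so using it twice gives the two-sided bound below. -/
theorem rpow_sub_rpow_le {x y p : ℝ} (hx : 0 ≤ x) (hy : 0 ≤ y) (hp : 1 ≤ p) :
    x ^ p - y ^ p ≤ p * (x - y) * x ^ (p - 1) := by
  rcases hx.eq_or_lt with rfl | hx
  · rw [Real.zero_rpow (by linarith)]
    rcases hp.eq_or_lt with rfl | hp
    · simp
    · rw [Real.zero_rpow (by linarith)]; simp [Real.rpow_nonneg hy]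
  · have h := one_add_mul_self_le_rpow_one_add (s := y / x - 1)
      (by linarith [div_nonneg hy hx.le]) hp
    rw [show 1 + (y / x - 1) = y / x by ring, Real.div_rpow hy hx.le] at h
    have hxp : 0 < x ^ p := Real.rpow_pos_of_pos hx p
    rw [le_div_iff₀ hxp] at h
    have e : x ^ p = x * x ^ (p - 1) := by
      rw [← Real.rpow_one_add' hx.le (by linarith)]; ring_nf
    have e2 : (1 + p * (y / x - 1)) * x ^ p = x ^ p - p * (x - y) * x ^ (p - 1) := by
      rw [e]; field_simp; ring
    linarith

theorem abs_rpow_sub_rpow_le {x y z p : ℝ} (hx : 0 ≤ x) (hy : 0 ≤ y) (hxz : x ≤ z) (hyz : y ≤ z)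
    (hp : 1 ≤ p) : |x ^ p - y ^ p| ≤ p * |x - y| * z ^ (p - 1) := by
  have h1 := rpow_sub_rpow_le hx hy hp
  have h2 := rpow_sub_rpow_le hy hx hp
  have hx1 : x ^ (p - 1) ≤ z ^ (p - 1) := Real.rpow_le_rpow hx hxz (by linarith)
  have hy1 : y ^ (p - 1) ≤ z ^ (p - 1) := Real.rpow_le_rpow hy hyz (by linarith)
  have hx0 : 0 ≤ x ^ (p - 1) := Real.rpow_nonneg hx _
  have hy0 : 0 ≤ y ^ (p - 1) := Real.rpow_nonneg hy _
  have hp0 : 0 ≤ p := by linarith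
  rw [abs_le]
  constructor
  · have : p * (y - x) * y ^ (p - 1) ≤ p * |x - y| * z ^ (p - 1) := by
      apply mul_le_mul _ hy1 hy0 (by positivity)
      exact mul_le_mul_of_nonneg_left (by rw [abs_sub_comm]; exact le_abs_self _) hp0
    linarith
  · have : p * (x - y) * x ^ (p - 1) ≤ p * |x - y| * z ^ (p - 1) := by
      apply mul_le_mul _ hx1 hx0 (by positivity)
      exact mul_le_mul_of_nonneg_left (le_abs_self _) hp0
    linarith

/-- Since `m₁ = -k₁ - l₁`, the multiplier regroups into `k₁(⟨k⟩^{2s} - ⟨m⟩^{2s}) + l₁(⟨l⟩^{2s} -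
⟨m⟩^{2s})`. The two long frequencies differ by at most `|l|`, so the derivative moves to the short
frequency: both terms are `O(|l| Y^{2s})` with `Y` comparable to `⟨k⟩` and to `⟨m⟩`. -/
theorem energyMult_le {s : ℝ} (hs : s ∈ Set.Icc (2 : ℝ) 3) {k l : Fin 2 → ℤ}
    (hk : nrm l ≤ nrm k) (hm : nrm l ≤ nrm (-k - l)) :
    |energyMult s k l| ≤ 448 * (jb l)⁻¹ * tripleWeight s k l := by
  obtain ⟨hs2, hs3⟩ := hs
  set m : Fin 2 → ℤ := -k - l with hmdef
  have hkm : nrm k ≤ nrm m + nrm l := nrm_le_third_add k l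
  have hmk : nrm m ≤ nrm k + nrm l := nrm_third_le k l
  have jkm : jb k ≤ 2 * jb m := jb_le_two_mul (by linarith)
  have jmk : jb m ≤ 2 * jb k := jb_le_two_mul (by linarith)
  have jlk : jb l ≤ jb k := Real.sqrt_le_sqrt (by rw [← nrm_sq, ← nrm_sq]; gcongr; exact nrm_nonneg l)
  set Y := max (jb k) (jb m) with hY
  have hkY : jb k ≤ Y := le_max_left _ _
  have hmY : jb m ≤ Y := le_max_right _ _
  have hY0 : 0 < Y := lt_of_lt_of_le (jb_pos k) hkY
  have m0 : ((m 0 : ℤ) : ℝ) = -(k 0 : ℝ) - (l 0 : ℝ) := by simp [hmdef]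
  have hsplit : energyMult s k l = (k 0 : ℝ) * ((1 + normSq k) ^ s - (1 + normSq m) ^ s)
      + (l 0 : ℝ) * ((1 + normSq l) ^ s - (1 + normSq m) ^ s) := by
    unfold energyMult; rw [← hmdef, m0]; ring
  have bk : 1 + normSq k ≤ Y ^ 2 := by rw [← jb_sq]; gcongr; exact (jb_pos k).le
  have bm : 1 + normSq m ≤ Y ^ 2 := by rw [← jb_sq]; gcongr; exact (jb_pos m).le
  have bl : 1 + normSq l ≤ Y ^ 2 := by
    rw [← jb_sq]; gcongr; exacts [(jb_pos l).le, jlk.trans hkY]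
  have nk := normSq_nonneg k
  have nl := normSq_nonneg l
  have nm := normSq_nonneg m
  have d1 := abs_rpow_sub_rpow_le (p := s) (by linarith : 0 ≤ 1 + normSq k)
    (by linarith : 0 ≤ 1 + normSq m) bk bm (by linarith)
  have hdiff : |(1 + normSq k) - (1 + normSq m)| ≤ nrm l * (2 * Y) := by
    rw [← nrm_sq, ← nrm_sq, show 1 + nrm k ^ 2 - (1 + nrm m ^ 2)
      = (nrm k - nrm m) * (nrm k + nrm m) by ring, abs_mul]
    have h1 : |nrm k - nrm m| ≤ nrm l := abs_le.2 ⟨by linarith, by linarith⟩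
    have h2 : |nrm k + nrm m| ≤ 2 * Y := by
      rw [abs_of_nonneg (add_nonneg (nrm_nonneg k) (nrm_nonneg m))]
      linarith [nrm_le_jb k, nrm_le_jb m]
    have := nrm_nonneg l
    gcongr
  have eY : Y ^ 2 * (Y ^ 2) ^ (s - 1) = (Y ^ 2) ^ s := by
    rw [← Real.rpow_one_add' (by positivity) (by linarith)]; ring_nf
  have hYs : 0 ≤ (Y ^ 2) ^ (s - 1) := by positivity
  have t1 : |(k 0 : ℝ) * ((1 + normSq k) ^ s - (1 + normSq m) ^ s)| ≤ 6 * nrm l * (Y ^ 2) ^ s := by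
    rw [abs_mul]
    calc |(k 0 : ℝ)| * |(1 + normSq k) ^ s - (1 + normSq m) ^ s|
        ≤ Y * (3 * (nrm l * (2 * Y)) * (Y ^ 2) ^ (s - 1)) := by
          gcongr
          · exact (abs_fst_le k).trans ((nrm_le_jb k).trans hkY)
          · refine d1.trans ?_
            gcongr
      _ = 6 * nrm l * (Y ^ 2 * (Y ^ 2) ^ (s - 1)) := by ring
      _ = _ := by rw [eY]
  have t2 : |(l 0 : ℝ) * ((1 + normSq l) ^ s - (1 + normSq m) ^ s)| ≤ nrm l * (Y ^ 2) ^ s := by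
    rw [abs_mul]
    have hl1 : (1 + normSq l) ^ s ≤ (Y ^ 2) ^ s := by gcongr
    have hm1 : (1 + normSq m) ^ s ≤ (Y ^ 2) ^ s := by gcongr
    have hl0 : 0 ≤ (1 + normSq l) ^ s := by positivity
    have hm0 : 0 ≤ (1 + normSq m) ^ s := by positivity
    gcongr
    · exact nrm_nonneg l
    · exact abs_fst_le l
    · exact abs_le.2 ⟨by linarith, by linarith⟩
  have hYk : Y ≤ 2 * jb k := max_le (by linarith [jb_pos k]) jmk
  have hYm : Y ≤ 2 * jb m := max_le jkm (by linarith [jb_pos m])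
  have two : (2 : ℝ) ^ s ≤ 8 := by
    calc (2 : ℝ) ^ s ≤ 2 ^ (3 : ℝ) := Real.rpow_le_rpow_of_exponent_le (by norm_num) hs3
      _ = 8 := by norm_num
  have yk : Y ^ s ≤ 8 * jb k ^ s := by
    calc Y ^ s ≤ (2 * jb k) ^ s := by gcongr
      _ = 2 ^ s * jb k ^ s := Real.mul_rpow (by norm_num) (jb_pos k).le
      _ ≤ _ := by gcongr; exact Real.rpow_nonneg (jb_pos k).le _
  have ym : Y ^ s ≤ 8 * jb m ^ s := by
    calc Y ^ s ≤ (2 * jb m) ^ s := by gcongr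
      _ = 2 ^ s * jb m ^ s := Real.mul_rpow (by norm_num) (jb_pos m).le
      _ ≤ _ := by gcongr; exact Real.rpow_nonneg (jb_pos m).le _
  have yy : (Y ^ 2) ^ s ≤ 64 * (jb k ^ s * jb m ^ s) := by
    rw [sq, Real.mul_rpow hY0.le hY0.le]
    calc Y ^ s * Y ^ s ≤ (8 * jb k ^ s) * (8 * jb m ^ s) := by
          gcongr
          exact mul_nonneg (by norm_num) (Real.rpow_nonneg (jb_pos k).le _)
      _ = _ := by ring
  have pk : 0 ≤ jb k ^ s := Real.rpow_nonneg (jb_pos k).le _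
  have pm : 0 ≤ jb m ^ s := Real.rpow_nonneg (jb_pos m).le _
  -- The place where `s ≥ 2` enters; it is sharp for `α = 1`.
  have lpow : jb l ≤ (jb l)⁻¹ * jb l ^ s := by
    rw [le_inv_mul_iff₀ (jb_pos l), ← sq, ← Real.rpow_natCast]
    exact Real.rpow_le_rpow_of_exponent_le (one_le_jb l) (by exact_mod_cast hs2)
  calc |energyMult s k l| ≤ 6 * nrm l * (Y ^ 2) ^ s + nrm l * (Y ^ 2) ^ s := by
        rw [hsplit]; exact (abs_add_le _ _).trans (add_le_add t1 t2)
    _ = 7 * nrm l * (Y ^ 2) ^ s := by ring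
    _ ≤ 7 * jb l * (64 * (jb k ^ s * jb m ^ s)) := by
        gcongr
        · exact mul_nonneg (by norm_num) (jb_pos l).le
        · exact nrm_le_jb l
    _ = 448 * jb l * (jb k ^ s * jb m ^ s) := by ring
    _ ≤ 448 * ((jb l)⁻¹ * jb l ^ s) * (jb k ^ s * jb m ^ s) := by gcongr
    _ = _ := by unfold tripleWeight; ring

/-- Twice the increment equals `(q₁ - p₁)(|q|^α + |p|^α) + (q₁ + p₁)(|q|^α - |p|^α)`. The last
product is nonnegative because `|q|² - |p|² = (q₁ - p₁)(q₁ + p₁)` on a line of fixed second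
coordinate. -/
theorem omega_increment_ge {α : ℝ} (hα : 0 ≤ α) {r : ℝ} (hr : 0 ≤ r) {p q : Fin 2 → ℤ}
    (h1 : p 1 = q 1) (h0 : p 0 ≤ q 0) (hp : r ≤ nrm p) (hq : r ≤ nrm q) :
    ((q 0 : ℝ) - p 0) * r ^ α ≤ omega α q - omega α p := by
  have h0' : (p 0 : ℝ) ≤ q 0 := by exact_mod_cast h0
  have rp : r ^ α ≤ absPow α p := Real.rpow_le_rpow hr hp hα
  have rq : r ^ α ≤ absPow α q := Real.rpow_le_rpow hr hq hα
  have key : 0 ≤ ((q 0 : ℝ) + p 0) * (absPow α q - absPow α p) := by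
    rcases le_total 0 ((q 0 : ℝ) + p 0) with h | h
    · refine mul_nonneg h (sub_nonneg.2 (Real.rpow_le_rpow (nrm_nonneg p) ?_ hα))
      exact Real.sqrt_le_sqrt (by unfold normSq; rw [h1]; nlinarith)
    · refine mul_nonneg_of_nonpos_of_nonpos h
        (sub_nonpos.2 (Real.rpow_le_rpow (nrm_nonneg q) ?_ hα))
      exact Real.sqrt_le_sqrt (by unfold normSq; rw [h1]; nlinarith)
  unfold omega
  nlinarith

theorem abs_nrm_sub_le {p q : Fin 2 → ℤ} (h1 : p 1 = q 1) (h0 : p 0 ≤ q 0) :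
    |nrm q - nrm p| ≤ (q 0 : ℝ) - p 0 := by
  have h0' : (p 0 : ℝ) ≤ q 0 := by exact_mod_cast h0
  rw [nrm_eq_norm, nrm_eq_norm]
  refine (abs_norm_sub_norm_le _ _).trans (le_of_eq ?_)
  rw [show (⟨q 0, q 1⟩ : ℂ) - ⟨p 0, p 1⟩ = (((q 0 : ℝ) - p 0 : ℝ) : ℂ) by
    apply Complex.ext <;> simp [h1]]
  rw [Complex.norm_real, Real.norm_of_nonneg (by linarith)]

/-- The factor 3 is `1 + α` with `α ≤ 2`, from the product rule for `k₁ |k|^α`. -/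
theorem omega_increment_le {α : ℝ} (hα : α ∈ Set.Icc (1 : ℝ) 2) {r : ℝ} {p q : Fin 2 → ℤ}
    (h1 : p 1 = q 1) (h0 : p 0 ≤ q 0) (hp : nrm p ≤ r) (hq : nrm q ≤ r) :
    omega α q - omega α p ≤ 3 * ((q 0 : ℝ) - p 0) * r ^ α := by
  have h0' : (p 0 : ℝ) ≤ q 0 := by exact_mod_cast h0
  have hr : 0 ≤ r := (nrm_nonneg p).trans hp
  have d := abs_rpow_sub_rpow_le (p := α) (nrm_nonneg q) (nrm_nonneg p) hq hp hα.1
  have e : r ^ α = r * r ^ (α - 1) := by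
    rw [← Real.rpow_one_add' hr (by linarith [hα.1])]; ring_nf
  have hr1 : 0 ≤ r ^ (α - 1) := Real.rpow_nonneg hr _
  have hq1 : absPow α q ≤ r ^ α := Real.rpow_le_rpow (nrm_nonneg q) hq (by linarith [hα.1])
  have a1 : ((q 0 : ℝ) - p 0) * absPow α q ≤ ((q 0 : ℝ) - p 0) * r ^ α := by
    gcongr
  have a2 : (p 0 : ℝ) * (absPow α q - absPow α p) ≤ r * (2 * ((q 0 : ℝ) - p 0) * r ^ (α - 1)) := by
    refine (le_abs_self _).trans ?_
    rw [abs_mul]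
    gcongr
    · exact (abs_fst_le p).trans hp
    · refine d.trans ?_
      refine mul_le_mul_of_nonneg_right ?_ hr1
      exact mul_le_mul hα.2 (abs_nrm_sub_le h1 h0) (abs_nonneg _) (by norm_num)
  unfold omega
  nlinarith

/-- For `l` much shorter than `k`, the resonance function is strictly monotone in `l₁`. -/
theorem reson_increment {α : ℝ} (hα : α ∈ Set.Icc (1 : ℝ) 2) {k l l' : Fin 2 → ℤ}
    (h1 : l 1 = l' 1) (h0 : l 0 ≤ l' 0) (hl : 8 * nrm l ≤ nrm k) (hl' : 8 * nrm l' ≤ nrm k) :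
    ((l' 0 : ℝ) - l 0) * (absPow α k / 4) ≤ reson α k l - reson α k l' := by
  have h0' : (l 0 : ℝ) ≤ l' 0 := by exact_mod_cast h0
  have hα0 : 0 ≤ α := by linarith [hα.1]
  have hk := nrm_nonneg k
  have up := omega_increment_le hα h1 h0 (r := nrm k / 8) (by linarith) (by linarith)
  have tl : ∀ j : Fin 2 → ℤ, 8 * nrm j ≤ nrm k → 7 / 8 * nrm k ≤ nrm (k + j) := by
    intro j hj
    have := nrm_add_le (k + j) (-j)
    rw [add_neg_cancel_right, nrm_neg] at this
    linarith
  have lo := omega_increment_ge hα0 (r := 7 / 8 * nrm k) (by positivity)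
    (p := k + l) (q := k + l') (by simp [h1]) (by simpa using h0) (tl l hl) (tl l' hl')
  have ne : ∀ j : Fin 2 → ℤ, omega α (-k - j) = -omega α (k + j) := by
    intro j; rw [← omega_neg]; congr 1; abel
  have hdiff : (((k + l') 0 : ℤ) : ℝ) - ((k + l) 0 : ℤ) = (l' 0 : ℝ) - l 0 := by simp
  rw [hdiff] at lo
  have e1 : (7 / 8 * nrm k) ^ α = (7 / 8) ^ α * absPow α k :=
    Real.mul_rpow (by norm_num) hk
  have e2 : (nrm k / 8) ^ α = (1 / 8) ^ α * absPow α k := by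
    rw [show nrm k / 8 = 1 / 8 * nrm k by ring]; exact Real.mul_rpow (by norm_num) hk
  -- The increment of `ω(k + l)` beats that of `ω(l)`: the slope is at least `49/64 - 3 · 1/8 =
  -- 25/64 > 1/4` times `|k|^α`.
  have b1 : (49 / 64 : ℝ) ≤ (7 / 8) ^ α := by
    calc (49 / 64 : ℝ) = (7 / 8) ^ (2 : ℝ) := by norm_num
      _ ≤ _ := Real.rpow_le_rpow_of_exponent_ge (by norm_num) (by norm_num) hα.2
  have b2 : (1 / 8 : ℝ) ^ α ≤ 1 / 8 := by
    calc (1 / 8 : ℝ) ^ α ≤ (1 / 8) ^ (1 : ℝ) :=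
          Real.rpow_le_rpow_of_exponent_ge (by norm_num) (by norm_num) hα.1
      _ = _ := by norm_num
  rw [e1] at lo
  rw [e2] at up
  have ha := absPow_nonneg α k
  have hd : 0 ≤ ((l' 0 : ℝ) - l 0) * absPow α k := mul_nonneg (by linarith) ha
  have c1 : 49 / 64 * (((l' 0 : ℝ) - l 0) * absPow α k)
      ≤ (7 / 8) ^ α * (((l' 0 : ℝ) - l 0) * absPow α k) := by gcongr
  have c2 : (1 / 8) ^ α * (((l' 0 : ℝ) - l 0) * absPow α k)
      ≤ 1 / 8 * (((l' 0 : ℝ) - l 0) * absPow α k) := by gcongr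
  unfold reson
  rw [ne, ne]
  linarith

theorem Nonres.ne_zero {α K : ℝ} (hK : 0 ≤ K) {k l : Fin 2 → ℤ} (h : Nonres α K k l) : k ≠ 0 := by
  rintro rfl
  have hl : l = 0 := by
    by_contra hl
    have := one_le_nrm hl
    have := h.1
    rw [nrm_zero] at this
    linarith
  subst hl
  have h2 := h.2
  have : 0 ≤ K * absPow α 0 * Real.sqrt (jbi ((0 : Fin 2 → ℤ) 1)) :=
    mul_nonneg (mul_nonneg hK (absPow_nonneg _ _)) (Real.sqrt_nonneg _)
  simp [reson, omega] at h2
  simp at this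
  linarith

/-- In the nonresonant region, division by the resonance function gains a derivative. -/
theorem Nonres.energyMult_div_le {α K : ℝ} (hα : α ∈ Set.Icc (1 : ℝ) 2) (hK : 0 < K)
    {k l : Fin 2 → ℤ} (h : Nonres α K k l) :
    |energyMult (1 + α) k l / (3 * reson α k l)| * (1 + nrm k + nrm l + nrm (-k - l))
      ≤ 800 / K * ((jb l)⁻¹ * (Real.sqrt (jbi (l 1)))⁻¹ * tripleWeight (1 + α) k l) := by
  have hk1 := one_le_nrm (h.ne_zero hK.le)
  obtain ⟨hl, hphi⟩ := h
  have hl0 := nrm_nonneg l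
  have hm := nrm_third_le k l
  have hm' := nrm_le_third_add k l
  have hth := energyMult_le (s := 1 + α) ⟨by linarith [hα.1], by linarith [hα.2]⟩ (k := k) (l := l)
    (by linarith) (by linarith)
  -- Here `α ≥ 1` is used: the resonance function is at least of the size of a full derivative.
  have ha : nrm k ≤ absPow α k := by
    calc nrm k = nrm k ^ (1 : ℝ) := (Real.rpow_one _).symm
      _ ≤ nrm k ^ α := Real.rpow_le_rpow_of_exponent_le hk1 hα.1
  have hsq : 0 < Real.sqrt (jbi (l 1)) := Real.sqrt_pos.2 (jbi_pos _)
  have hsum : 1 + nrm k + nrm l + nrm (-k - l) ≤ 5 * absPow α k := by linarith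
  have hapos : 0 < absPow α k := by linarith
  have hden : 0 < K * absPow α k * Real.sqrt (jbi (l 1)) := by positivity
  have htw : 0 ≤ tripleWeight (1 + α) k l := by
    unfold tripleWeight
    exact mul_nonneg (mul_nonneg (Real.rpow_nonneg (jb_pos _).le _)
      (Real.rpow_nonneg (jb_pos _).le _)) (Real.rpow_nonneg (jb_pos _).le _)
  have hj : 0 ≤ (jb l)⁻¹ := inv_nonneg.2 (jb_pos l).le
  rw [abs_div, abs_mul, abs_of_pos (by norm_num : (0 : ℝ) < 3)]
  calc |energyMult (1 + α) k l| / (3 * |reson α k l|) * (1 + nrm k + nrm l + nrm (-k - l))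
      ≤ 448 * (jb l)⁻¹ * tripleWeight (1 + α) k l / (3 * (K * absPow α k * Real.sqrt (jbi (l 1))))
        * (5 * absPow α k) := by
        gcongr
        · linarith [nrm_nonneg (-k - l)]
    _ = 2240 / 3 / K * ((jb l)⁻¹ * (Real.sqrt (jbi (l 1)))⁻¹ * tripleWeight (1 + α) k l) := by
        field_simp; ring
    _ ≤ _ := by
        gcongr
        norm_num

end FZK
end

noncomputable section
namespace FZK
open scoped ENNReal

/-! ### Extended-valued `ℓ²` norms and trilinear Schur bounds. -/

section ExtendedSums

variable {ι : Type*}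

/-- The `ℓ²` norm of an extended nonnegative family. -/
def l2n (x : ι → ℝ≥0∞) : ℝ≥0∞ := (∑' i, x i ^ 2) ^ (1 / 2 : ℝ)

theorem rpow_half_sq (x : ℝ≥0∞) : (x ^ (1 / 2 : ℝ)) ^ 2 = x := by
  rw [← ENNReal.rpow_natCast, ← ENNReal.rpow_mul]; norm_num

theorem sq_rpow_half (x : ℝ≥0∞) : (x ^ 2) ^ (1 / 2 : ℝ) = x := by
  rw [← ENNReal.rpow_natCast, ← ENNReal.rpow_mul]; norm_num

theorem l2n_sq (x : ι → ℝ≥0∞) : l2n x ^ 2 = ∑' i, x i ^ 2 := rpow_half_sq _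

theorem l2n_mono {x y : ι → ℝ≥0∞} (h : ∀ i, x i ≤ y i) : l2n x ≤ l2n y := by
  unfold l2n
  gcongr with i
  exact h i

theorem le_of_sq_le_sq {x y : ℝ≥0∞} (h : x ^ 2 ≤ y ^ 2) : x ≤ y :=
  (ENNReal.pow_le_pow_left_iff two_ne_zero).1 h

theorem tsum_mul_le_l2n_mul_l2n (x y : ι → ℝ≥0∞) : ∑' i, x i * y i ≤ l2n x * l2n y := by
  let _ : MeasurableSpace ι := ⊤
  have h := ENNReal.lintegral_mul_le_Lp_mul_Lq (Measure.count : Measure ι)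
    (show (2 : ℝ).HolderConjugate 2 from Real.HolderConjugate.two_two)
    (f := x) (g := y) (measurable_from_top).aemeasurable (measurable_from_top).aemeasurable
  simp only [lintegral_count, Pi.mul_apply] at h
  unfold l2n
  simpa only [← ENNReal.rpow_natCast, Nat.cast_ofNat] using h

theorem sq_add_le (x y : ℝ≥0∞) : (x + y) ^ 2 ≤ 4 * (x ^ 2 + y ^ 2) := by
  wlog h : x ≤ y generalizing x y
  · rw [add_comm x, add_comm (x ^ 2)]; exact this _ _ (le_of_not_ge h)
  calc (x + y) ^ 2 ≤ (y + y) ^ 2 := by gcongr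
    _ = 4 * y ^ 2 := by ring
    _ ≤ _ := by gcongr; exact le_add_self

theorem l2n_add_le (x y : ι → ℝ≥0∞) : l2n (fun i => x i + y i) ≤ 2 * (l2n x + l2n y) := by
  refine le_of_sq_le_sq ?_
  rw [l2n_sq, mul_pow]
  calc ∑' i, (x i + y i) ^ 2 ≤ ∑' i, 4 * (x i ^ 2 + y i ^ 2) :=
        ENNReal.tsum_le_tsum fun i => sq_add_le _ _
    _ = 4 * (l2n x ^ 2 + l2n y ^ 2) := by
        rw [ENNReal.tsum_mul_left, ENNReal.tsum_add, l2n_sq, l2n_sq]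
    _ ≤ 2 ^ 2 * (l2n x + l2n y) ^ 2 := by
        rw [show (2 : ℝ≥0∞) ^ 2 = 4 by norm_num]
        gcongr
        rw [add_sq, add_right_comm]
        exact le_self_add

theorem le_l2n (x : ι → ℝ≥0∞) (i : ι) : x i ≤ l2n x := by
  refine le_of_sq_le_sq ?_
  rw [l2n_sq]
  exact ENNReal.le_tsum (f := fun i => x i ^ 2) i

variable {G : Type*} [AddCommGroup G]

theorem l2n_comp_equiv {κ : Type*} (e : κ ≃ ι) (x : ι → ℝ≥0∞) : l2n (fun i => x (e i)) = l2n x := by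
  unfold l2n
  rw [e.tsum_eq (fun i => x i ^ 2)]

theorem l2n_third (x : G → ℝ≥0∞) (l : G) : l2n (fun k => x (-k - l)) = l2n x :=
  l2n_comp_equiv ((Equiv.neg G).trans (Equiv.subRight l)) x

/-- The cyclic relabelling `(k, l, m) ↦ (l, m, k)` of triples with `k + l + m = 0`. -/
def rot (G : Type*) [AddCommGroup G] : G × G ≃ G × G where
  toFun p := (p.2, -p.1 - p.2)
  invFun p := (-p.1 - p.2, p.1)
  left_inv p := by ext <;> simp <;> abel
  right_inv p := by ext <;> simp

/-- A Schur test for trilinear forms on triples `k + l + m = 0`. -/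
theorem tsum_trilinear_le (M : G → G → ℝ≥0∞) (S : ℝ≥0∞) (hM : ∀ k, ∑' l, M k l ^ 2 ≤ S)
    (X Y Z : G → ℝ≥0∞) :
    ∑' p : G × G, M p.1 p.2 * (X p.1 * Y p.2 * Z (-p.1 - p.2))
      ≤ S ^ (1 / 2 : ℝ) * (l2n X * l2n Y * l2n Z) := by
  -- Cauchy–Schwarz over pairs, grouping `M(k,l) X(k)` against `Y(l) Z(-k-l)`. The second family has
  -- an `ℓ²` norm that factorizes exactly.
  have h1 : l2n (fun p : G × G => M p.1 p.2 * X p.1) ≤ S ^ (1 / 2 : ℝ) * l2n X := by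
    refine le_of_sq_le_sq ?_
    rw [mul_pow, rpow_half_sq, l2n_sq, l2n_sq]
    calc ∑' p : G × G, (M p.1 p.2 * X p.1) ^ 2 = ∑' k, ∑' l, (M k l * X k) ^ 2 :=
          ENNReal.tsum_prod (f := fun k l => (M k l * X k) ^ 2)
      _ = ∑' k, (∑' l, M k l ^ 2) * X k ^ 2 := by
          simp_rw [mul_pow, ENNReal.tsum_mul_right]
      _ ≤ ∑' k, S * X k ^ 2 := by gcongr with k; exact hM k
      _ = _ := ENNReal.tsum_mul_left
  have h2 : l2n (fun p : G × G => Y p.2 * Z (-p.1 - p.2)) = l2n Y * l2n Z := by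
    unfold l2n
    rw [← ENNReal.mul_rpow_of_nonneg _ _ (by norm_num)]
    congr 1
    calc ∑' p : G × G, (Y p.2 * Z (-p.1 - p.2)) ^ 2
        = ∑' k, ∑' l, (Y l * Z (-k - l)) ^ 2 :=
          ENNReal.tsum_prod (f := fun k l => (Y l * Z (-k - l)) ^ 2)
      _ = ∑' l, ∑' k, (Y l * Z (-k - l)) ^ 2 := ENNReal.tsum_comm
      _ = ∑' l, Y l ^ 2 * ∑' m, Z m ^ 2 := by
          congr 1; ext l
          simp_rw [mul_pow, ENNReal.tsum_mul_left]
          congr 1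
          exact ((Equiv.neg G).trans (Equiv.subRight l)).tsum_eq (fun m => Z m ^ 2)
      _ = _ := ENNReal.tsum_mul_right
  calc ∑' p : G × G, M p.1 p.2 * (X p.1 * Y p.2 * Z (-p.1 - p.2))
      = ∑' p : G × G, (M p.1 p.2 * X p.1) * (Y p.2 * Z (-p.1 - p.2)) := by
        congr 1; ext p; ring
    _ ≤ _ := tsum_mul_le_l2n_mul_l2n _ _
    _ ≤ S ^ (1 / 2 : ℝ) * l2n X * (l2n Y * l2n Z) := by rw [h2]; gcongr
    _ = _ := by ring

/-- Trilinear forms with an `ℓ¹` factor. -/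
theorem tsum_trilinear_le_l1 (X Y Z : G → ℝ≥0∞) :
    ∑' p : G × G, X p.1 * Y p.2 * Z (-p.1 - p.2) ≤ (∑' l, Y l) * (l2n X * l2n Z) := by
  calc ∑' p : G × G, X p.1 * Y p.2 * Z (-p.1 - p.2)
      = ∑' k, ∑' l, X k * Y l * Z (-k - l) :=
        ENNReal.tsum_prod (f := fun k l => X k * Y l * Z (-k - l))
    _ = ∑' l, ∑' k, X k * Y l * Z (-k - l) := ENNReal.tsum_comm
    _ = ∑' l, Y l * ∑' k, X k * Z (-k - l) := by
        congr 1; ext l; rw [← ENNReal.tsum_mul_left]; congr 1; ext k; ring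
    _ ≤ ∑' l, Y l * (l2n X * l2n Z) := by
        gcongr with l
        refine (tsum_mul_le_l2n_mul_l2n _ _).trans ?_
        rw [l2n_third]
    _ = _ := ENNReal.tsum_mul_right

/-- Convolution of extended nonnegative families. -/
def econv (x y : G → ℝ≥0∞) (k : G) : ℝ≥0∞ := ∑' l, x l * y (k - l)

end ExtendedSums

/-! ### Sobolev weights, lattice sums and the counting of nearly resonant frequencies. -/

section Weights

/-- The Sobolev weight `⟨k⟩^s`. -/
def wt (s : ℝ) (k : Fin 2 → ℤ) : ℝ≥0∞ := ENNReal.ofReal (jb k ^ s)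

/-- The Sobolev norm of a family of absolute values of Fourier coefficients. -/
def hsn (s : ℝ) (x : (Fin 2 → ℤ) → ℝ≥0∞) : ℝ≥0∞ := l2n fun k => wt s k * x k

theorem wt_ne_zero (s : ℝ) (k : Fin 2 → ℤ) : wt s k ≠ 0 := by
  simp only [wt, ne_eq, ENNReal.ofReal_eq_zero, not_le]
  exact Real.rpow_pos_of_pos (jb_pos k) s

theorem wt_ne_top (s : ℝ) (k : Fin 2 → ℤ) : wt s k ≠ ∞ := ENNReal.ofReal_ne_top

theorem one_le_wt {s : ℝ} (hs : 0 ≤ s) (k : Fin 2 → ℤ) : 1 ≤ wt s k :=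
  ENNReal.one_le_ofReal.2 (Real.one_le_rpow (one_le_jb k) hs)

/-- Each term is dominated by the telescoping difference `4/(y + n) - 4/(y + n + 1)`. -/
theorem tsum_nat_inv_le {y : ℝ} (hy : 1 ≤ y) :
    ∑' n : ℕ, ENNReal.ofReal (1 / (y ^ 2 + (n : ℝ) ^ 2)) ≤ ENNReal.ofReal (4 / y) := by
  refine ENNReal.tsum_le_of_sum_range_le fun N => ?_
  rw [← ENNReal.ofReal_sum_of_nonneg (fun n _ => by positivity)]
  refine ENNReal.ofReal_le_ofReal ?_
  suffices h : ∑ n ∈ Finset.range N, 1 / (y ^ 2 + (n : ℝ) ^ 2) ≤ 4 / y - 4 / (y + N) by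
    have : 0 ≤ 4 / (y + N) := by positivity
    linarith
  induction N with
  | zero => simp
  | succ n ih =>
    rw [Finset.sum_range_succ]
    have hn : (0 : ℝ) ≤ n := n.cast_nonneg
    have : 1 / (y ^ 2 + (n : ℝ) ^ 2) ≤ 4 / (y + n) - 4 / (y + (n + 1)) := by
      rw [div_sub_div _ _ (by positivity) (by positivity), div_le_div_iff₀ (by positivity)
        (by positivity)]
      nlinarith [sq_nonneg (y - n)]
    push_cast
    linarith

theorem tsum_int_inv_le {y : ℝ} (hy : 1 ≤ y) :
    ∑' n : ℤ, ENNReal.ofReal (1 / (y ^ 2 + (n : ℝ) ^ 2)) ≤ ENNReal.ofReal (8 / y) := by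
  rw [tsum_of_nat_of_neg_add_one ENNReal.summable ENNReal.summable]
  have h := tsum_nat_inv_le hy
  rw [show 8 / y = 4 / y + 4 / y by ring, ENNReal.ofReal_add (by positivity) (by positivity)]
  refine add_le_add (by simpa using h) (le_trans ?_ h)
  refine ENNReal.tsum_le_tsum fun n => ENNReal.ofReal_le_ofReal ?_
  push_cast
  have hn : (0 : ℝ) ≤ n := n.cast_nonneg
  exact one_div_le_one_div_of_le (by positivity) (by nlinarith)

/-- The inner sum runs over the first coordinate with the second one fixed, since these are the
lines on which the resonance function is monotone. -/
theorem tsum_freq (f : ℤ → ℤ → ℝ≥0∞) :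
    ∑' l : Fin 2 → ℤ, f (l 0) (l 1) = ∑' b : ℤ, ∑' a : ℤ, f a b := by
  rw [ENNReal.tsum_comm, ← ENNReal.tsum_prod (f := f)]
  exact (finTwoArrowEquiv ℤ).tsum_eq (fun p : ℤ × ℤ => f p.1 p.2)

theorem jb_sq_eq (l : Fin 2 → ℤ) : jb l ^ 2 = jbi (l 1) ^ 2 + (l 0 : ℝ) ^ 2 := by
  rw [jb_sq, jbi_sq, normSq]; ring

theorem tsum_line_le (b : ℤ) : ∑' a : ℤ, ENNReal.ofReal (1 / (jbi b ^ 2 + (a : ℝ) ^ 2))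
    ≤ ENNReal.ofReal (8 / jbi b) := tsum_int_inv_le (one_le_jbi b)

/-- The nonresonant multiplier. -/
def nonresMult (l : Fin 2 → ℤ) : ℝ := (jb l)⁻¹ * (Real.sqrt (jbi (l 1)))⁻¹

theorem nonresMult_nonneg (l : Fin 2 → ℤ) : 0 ≤ nonresMult l :=
  mul_nonneg (inv_nonneg.2 (jb_pos l).le) (inv_nonneg.2 (Real.sqrt_nonneg _))

theorem nonresMult_sq (l : Fin 2 → ℤ) : nonresMult l ^ 2 = 1 / (jb l ^ 2) * (1 / jbi (l 1)) := by
  unfold nonresMult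
  rw [mul_pow, inv_pow, inv_pow, Real.sq_sqrt (jbi_pos _).le, one_div, one_div]

/-- The sum of `⟨l⟩⁻²` along a line is at most `8/⟨l₂⟩`. The additional `⟨l₂⟩⁻¹` then leaves the
convergent sum of `8⟨l₂⟩⁻²`, whence `64 = 8 · 8`. -/
theorem tsum_nonresMult_sq_le :
    ∑' l : Fin 2 → ℤ, ENNReal.ofReal (nonresMult l) ^ 2 ≤ 64 := by
  calc ∑' l : Fin 2 → ℤ, ENNReal.ofReal (nonresMult l) ^ 2
      = ∑' l : Fin 2 → ℤ, (fun a b : ℤ => ENNReal.ofReal (1 / jbi b) *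
          ENNReal.ofReal (1 / (jbi b ^ 2 + (a : ℝ) ^ 2))) (l 0) (l 1) := by
        congr 1; ext l
        rw [← ENNReal.ofReal_pow (nonresMult_nonneg l), nonresMult_sq, jb_sq_eq, mul_comm,
          ENNReal.ofReal_mul (by have := jbi_pos (l 1); positivity)]
    _ ≤ ∑' b : ℤ, ENNReal.ofReal (8 * (1 / (1 ^ 2 + (b : ℝ) ^ 2))) := by
        rw [tsum_freq (fun a b : ℤ => ENNReal.ofReal (1 / jbi b) *
          ENNReal.ofReal (1 / (jbi b ^ 2 + (a : ℝ) ^ 2)))]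
        gcongr with b
        rw [ENNReal.tsum_mul_left]
        have hb := jbi_pos b
        calc _ ≤ ENNReal.ofReal (1 / jbi b) * ENNReal.ofReal (8 / jbi b) := by
              gcongr; exact tsum_line_le b
          _ = _ := by
              rw [← ENNReal.ofReal_mul (by positivity)]
              congr 1
              rw [one_pow, ← jbi_sq]; field_simp
    _ ≤ 64 := by
        simp_rw [ENNReal.ofReal_mul (show (0 : ℝ) ≤ 8 by norm_num)]
        rw [ENNReal.tsum_mul_left]
        calc _ ≤ ENNReal.ofReal 8 * ENNReal.ofReal (8 / 1) := by
              gcongr; exact tsum_int_inv_le le_rfl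
          _ = 64 := by norm_num

/-- Lets the sum of `⟨l⟩^{-2s}` reuse the bound 64 already proved for `nonresMult`. -/
theorem wt_inv_le {s : ℝ} (hs : 2 ≤ s) (l : Fin 2 → ℤ) :
    (wt s l)⁻¹ ≤ ENNReal.ofReal (nonresMult l) := by
  unfold wt
  rw [← ENNReal.ofReal_inv_of_pos (Real.rpow_pos_of_pos (jb_pos l) s)]
  refine ENNReal.ofReal_le_ofReal ?_
  unfold nonresMult
  rw [← mul_inv]
  have h1 : Real.sqrt (jbi (l 1)) ≤ jb l := by
    refine Real.sqrt_le_iff.2 ⟨(jb_pos l).le, ?_⟩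
    nlinarith [jbi_le_jb l, one_le_jb l]
  have h2 : jb l * jb l ≤ jb l ^ s := by
    rw [← sq, ← Real.rpow_natCast]
    exact Real.rpow_le_rpow_of_exponent_le (one_le_jb l) (by exact_mod_cast hs)
  have h3 : 0 < Real.sqrt (jbi (l 1)) := Real.sqrt_pos.2 (jbi_pos _)
  have h4 := jb_pos l
  gcongr
  exact le_trans (by gcongr) h2

theorem tsum_wt_inv_sq_le {s : ℝ} (hs : 2 ≤ s) : ∑' l, (wt s l)⁻¹ ^ 2 ≤ 64 :=
  le_trans (ENNReal.tsum_le_tsum fun l => by gcongr; exact wt_inv_le hs l) tsum_nonresMult_sq_le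

/-- Sobolev embedding into functions with absolutely convergent Fourier series; `8` is the square
root of `64`. -/
theorem tsum_le_hsn {s : ℝ} (hs : 2 ≤ s) (x : (Fin 2 → ℤ) → ℝ≥0∞) : ∑' l, x l ≤ 8 * hsn s x := by
  calc ∑' l, x l = ∑' l, (wt s l)⁻¹ * (wt s l * x l) := by
        congr 1; ext l
        rw [← mul_assoc, ENNReal.inv_mul_cancel (wt_ne_zero s l) (wt_ne_top s l), one_mul]
    _ ≤ _ := tsum_mul_le_l2n_mul_l2n _ _
    _ ≤ 8 * hsn s x := by
        unfold hsn
        gcongr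
        refine le_of_sq_le_sq ?_
        rw [l2n_sq]
        exact (tsum_wt_inv_sq_le hs).trans (by norm_num)

theorem wt_le_add {s : ℝ} (hs : s ∈ Set.Icc (2 : ℝ) 3) (k l : Fin 2 → ℤ) :
    wt s k ≤ 8 * (wt s l + wt s (k - l)) := by
  have two : (2 : ℝ) ^ s ≤ 8 := by
    calc (2 : ℝ) ^ s ≤ 2 ^ (3 : ℝ) := Real.rpow_le_rpow_of_exponent_le (by norm_num) hs.2
      _ = 8 := by norm_num
  have key : ∀ m, nrm k ≤ 2 * nrm m → wt s k ≤ 8 * wt s m := by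
    intro m hm
    unfold wt
    rw [show (8 : ℝ≥0∞) = ENNReal.ofReal 8 by norm_num, ← ENNReal.ofReal_mul (by norm_num)]
    refine ENNReal.ofReal_le_ofReal ?_
    calc jb k ^ s ≤ (2 * jb m) ^ s :=
          Real.rpow_le_rpow (jb_pos k).le (jb_le_two_mul hm) (by linarith [hs.1])
      _ = 2 ^ s * jb m ^ s := Real.mul_rpow (by norm_num) (jb_pos m).le
      _ ≤ 8 * jb m ^ s := by gcongr; exact Real.rpow_nonneg (jb_pos m).le _
  have tri := nrm_add_le l (k - l)
  rw [add_sub_cancel] at tri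
  rcases le_total (nrm l) (nrm (k - l)) with h | h
  · refine (key (k - l) (by linarith)).trans ?_
    gcongr; exact le_add_self
  · refine (key l (by linarith)).trans ?_
    gcongr; exact le_self_add

/-- The Sobolev space `H^s` is an algebra. -/
theorem hsn_econv_le {s : ℝ} (hs : s ∈ Set.Icc (2 : ℝ) 3) (x y : (Fin 2 → ℤ) → ℝ≥0∞) :
    hsn s (econv x y) ≤ 256 * (hsn s x * hsn s y) := by
  -- The weight of `k` is split onto `l` or `k - l`; the factor left without need of it supplies a
  -- square-summable `⟨·⟩^{-s}`. The Cauchy–Schwarz sum is at most `256 · 128`, rounded up to the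
  -- perfect square `65536 = 256²`.
  have hb : ∀ k, wt s k * econv x y k ≤ (65536 : ℝ≥0∞) ^ (1 / 2 : ℝ) *
      l2n (fun l => (wt s l * x l) * (wt s (k - l) * y (k - l))) := by
    intro k
    have hc : ∀ l, wt s k * (x l * y (k - l)) ≤ (8 * ((wt s (k - l))⁻¹ + (wt s l)⁻¹)) *
        ((wt s l * x l) * (wt s (k - l) * y (k - l))) := by
      intro l
      have e1 := ENNReal.inv_mul_cancel (wt_ne_zero s l) (wt_ne_top s l)
      have e2 := ENNReal.inv_mul_cancel (wt_ne_zero s (k - l)) (wt_ne_top s (k - l))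
      calc wt s k * (x l * y (k - l))
          ≤ 8 * (wt s l + wt s (k - l)) * (x l * y (k - l)) := by gcongr; exact wt_le_add hs k l
        _ = 8 * (((wt s (k - l))⁻¹ * wt s (k - l)) * wt s l
              + ((wt s l)⁻¹ * wt s l) * wt s (k - l)) * (x l * y (k - l)) := by
            rw [e1, e2, one_mul, one_mul]
        _ = _ := by ring
    calc wt s k * econv x y k = ∑' l, wt s k * (x l * y (k - l)) := ENNReal.tsum_mul_left.symm
      _ ≤ _ := ENNReal.tsum_le_tsum hc
      _ ≤ _ := tsum_mul_le_l2n_mul_l2n _ _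
      _ ≤ _ := by
          gcongr
          unfold l2n
          gcongr
          have e3 : ∑' l, (wt s (k - l))⁻¹ ^ 2 = ∑' l, (wt s l)⁻¹ ^ 2 :=
            (Equiv.subLeft k).tsum_eq (fun l => (wt s l)⁻¹ ^ 2)
          calc ∑' l, (8 * ((wt s (k - l))⁻¹ + (wt s l)⁻¹)) ^ 2
              ≤ ∑' l, 256 * ((wt s (k - l))⁻¹ ^ 2 + (wt s l)⁻¹ ^ 2) := by
                gcongr with l
                rw [mul_pow]
                refine (mul_le_mul_right (sq_add_le _ _) _).trans (le_of_eq ?_)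
                ring
            _ = 256 * (∑' l, (wt s l)⁻¹ ^ 2 + ∑' l, (wt s l)⁻¹ ^ 2) := by
                rw [ENNReal.tsum_mul_left, ENNReal.tsum_add, e3]
            _ ≤ 256 * (64 + 64) := by
                have := tsum_wt_inv_sq_le hs.1
                gcongr
            _ ≤ 65536 := by norm_num
  have h256 : (65536 : ℝ≥0∞) ^ (1 / 2 : ℝ) = 256 := by
    rw [show (65536 : ℝ≥0∞) = 256 ^ 2 by norm_num, sq_rpow_half]
  refine le_of_sq_le_sq ?_
  rw [hsn, l2n_sq]
  calc ∑' k, (wt s k * econv x y k) ^ 2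
      ≤ ∑' k, (256 * l2n (fun l => (wt s l * x l) * (wt s (k - l) * y (k - l)))) ^ 2 := by
        refine ENNReal.tsum_le_tsum fun k => pow_le_pow_left' ?_ 2
        exact (hb k).trans_eq (by rw [h256])
    _ = 256 ^ 2 * ∑' k, ∑' l, (wt s l * x l) ^ 2 * (wt s (k - l) * y (k - l)) ^ 2 := by
        rw [← ENNReal.tsum_mul_left]
        congr 1; ext k
        rw [mul_pow, l2n_sq]; simp_rw [mul_pow]
    _ = 256 ^ 2 * ((∑' l, (wt s l * x l) ^ 2) * ∑' m, (wt s m * y m) ^ 2) := by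
        congr 1
        rw [ENNReal.tsum_comm, ← ENNReal.tsum_mul_right]
        congr 1; ext l
        rw [ENNReal.tsum_mul_left]
        congr 1
        exact (Equiv.subRight l).tsum_eq (fun m => (wt s m * y m) ^ 2)
    _ = (256 * (hsn s x * hsn s y)) ^ 2 := by
        rw [mul_pow, mul_pow, hsn, hsn, l2n_sq, l2n_sq]

/-- All integers with the property lie within `⌊D⌋` of any one of them. -/
theorem tsum_indicator_le {P : ℤ → Prop} [DecidablePred P] {D : ℝ} (hD : 0 ≤ D)
    (h : ∀ a a', P a → P a' → a ≤ a' → (a' : ℝ) - a ≤ D) :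
    ∑' a, (if P a then (1 : ℝ≥0∞) else 0) ≤ ENNReal.ofReal (2 * D + 1) := by
  by_cases hP : ∃ a, P a
  · obtain ⟨c, hc⟩ := hP
    have hsub : ∀ a, P a → a ∈ Finset.Icc (c - ⌊D⌋) (c + ⌊D⌋) := by
      intro a ha
      rw [Finset.mem_Icc]
      rcases le_total a c with hac | hac
      · have h1 := h a c ha hc hac
        have : c - a ≤ ⌊D⌋ := Int.le_floor.2 (by push_cast; exact h1)
        have : 0 ≤ ⌊D⌋ := Int.floor_nonneg.2 hD
        constructor <;> linarith
      · have h1 := h c a hc ha hac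
        have : a - c ≤ ⌊D⌋ := Int.le_floor.2 (by push_cast; exact h1)
        have : 0 ≤ ⌊D⌋ := Int.floor_nonneg.2 hD
        constructor <;> linarith
    rw [tsum_eq_sum (s := Finset.Icc (c - ⌊D⌋) (c + ⌊D⌋))
      (fun a ha => if_neg fun hPa => ha (hsub a hPa))]
    calc ∑ a ∈ Finset.Icc (c - ⌊D⌋) (c + ⌊D⌋), (if P a then (1 : ℝ≥0∞) else 0)
        ≤ ∑ a ∈ Finset.Icc (c - ⌊D⌋) (c + ⌊D⌋), 1 := by
          gcongr with a; split_ifs <;> simp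
      _ = ((Finset.Icc (c - ⌊D⌋) (c + ⌊D⌋)).card : ℝ≥0∞) := by simp
      _ = ENNReal.ofReal ((Finset.Icc (c - ⌊D⌋) (c + ⌊D⌋)).card : ℝ) := by simp
      _ ≤ _ := by
          refine ENNReal.ofReal_le_ofReal ?_
          have h0 : 0 ≤ ⌊D⌋ := Int.floor_nonneg.2 hD
          have : ((Finset.Icc (c - ⌊D⌋) (c + ⌊D⌋)).card : ℤ) = 2 * ⌊D⌋ + 1 := by
            rw [Int.card_Icc, Int.toNat_of_nonneg (by linarith)]; ring
          have h2 : ((Finset.Icc (c - ⌊D⌋) (c + ⌊D⌋)).card : ℝ) = 2 * (⌊D⌋ : ℝ) + 1 := by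
            exact_mod_cast this
          rw [h2]
          linarith [Int.floor_le D]
  · push Not at hP
    simp [hP]

/-- The square of frequencies with `max(|k₁|, |k₂|) ≤ N`. -/
def box (N : ℕ) : Finset (Fin 2 → ℤ) := Fintype.piFinset fun _ => Finset.Icc (-(N : ℤ)) N

theorem mem_box {N : ℕ} {k : Fin 2 → ℤ} : k ∈ box N ↔ ∀ j, |k j| ≤ (N : ℤ) := by
  simp [box, abs_le]

theorem neg_mem_box {N : ℕ} {k : Fin 2 → ℤ} : -k ∈ box N ↔ k ∈ box N := by simp [mem_box]

theorem card_box (N : ℕ) : ((box N).card : ℝ) = (2 * N + 1) ^ 2 := by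
  have : ((Finset.Icc (-(N : ℤ)) N).card : ℤ) = 2 * N + 1 := by
    rw [Int.card_Icc, Int.toNat_of_nonneg (by linarith [Int.natCast_nonneg N])]; ring
  have h2 : ((Finset.Icc (-(N : ℤ)) N).card : ℝ) = 2 * (N : ℝ) + 1 := by exact_mod_cast this
  simp only [box, Fintype.card_piFinset_const]
  rw [Nat.cast_pow, h2]

theorem mem_box_floor (l : Fin 2 → ℤ) {r : ℝ} (h : nrm l ≤ r) : l ∈ box ⌊r⌋₊ := by
  rw [mem_box]
  have key : ∀ n : ℤ, |(n : ℝ)| ≤ nrm l → |n| ≤ (⌊r⌋₊ : ℤ) := by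
    intro n hn
    rw [← Int.natCast_natAbs]
    exact_mod_cast Nat.le_floor (by rw [Nat.cast_natAbs, Int.cast_abs]; exact hn.trans h)
  intro j
  fin_cases j
  · exact key _ (abs_fst_le l)
  · exact key _ (abs_snd_le l)

theorem lt_nrm_of_notMem_box {N : ℕ} {l : Fin 2 → ℤ} (h : l ∉ box N) : (N : ℝ) < nrm l := by
  by_contra! h'
  have := mem_box_floor l h'
  rw [Nat.floor_natCast] at this
  exact h this

open Classical in
/-- The multiplier of the region without normal form. -/
def resMult (α K : ℝ) (k l : Fin 2 → ℤ) : ℝ :=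
  if nrm l ≤ nrm k ∧ ¬ Nonres α K k l then (jb l)⁻¹ else 0

theorem resMult_nonneg (α K : ℝ) (k l : Fin 2 → ℤ) : 0 ≤ resMult α K k l := by
  unfold resMult
  split_ifs
  exacts [inv_nonneg.2 (jb_pos l).le, le_rfl]

-- There are at most `(2|k| + 1)²` such lattice points and each contributes at most `64/⟨k⟩²`, so
-- comparable frequencies produce no logarithm.
open Classical in
theorem tsum_comparable_le (k : Fin 2 → ℤ) :
    ∑' l, (if nrm l ≤ nrm k ∧ nrm k < 8 * nrm l then ENNReal.ofReal (1 / jb l ^ 2) else 0)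
      ≤ 512 := by
  calc ∑' l, (if nrm l ≤ nrm k ∧ nrm k < 8 * nrm l then ENNReal.ofReal (1 / jb l ^ 2) else 0)
      = ∑ l ∈ box ⌊nrm k⌋₊,
        (if nrm l ≤ nrm k ∧ nrm k < 8 * nrm l then ENNReal.ofReal (1 / jb l ^ 2) else 0) :=
        tsum_eq_sum fun l hl => if_neg fun h => hl (mem_box_floor l h.1)
    _ ≤ ∑ l ∈ box ⌊nrm k⌋₊, ENNReal.ofReal (64 / jb k ^ 2) := by
        refine Finset.sum_le_sum fun l _ => ?_
        split_ifs with h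
        · refine ENNReal.ofReal_le_ofReal ?_
          have h1 := jb_pos l
          have h2 := jb_pos k
          rw [div_le_div_iff₀ (by positivity) (by positivity), jb_sq, jb_sq, ← nrm_sq, ← nrm_sq]
          nlinarith [h.2, nrm_nonneg k, nrm_nonneg l]
        · exact zero_le
    _ = ENNReal.ofReal ((box ⌊nrm k⌋₊).card * (64 / jb k ^ 2)) := by
        rw [Finset.sum_const, nsmul_eq_mul, ENNReal.ofReal_mul (by positivity),
          ENNReal.ofReal_natCast]
    _ ≤ ENNReal.ofReal 512 := by
        refine ENNReal.ofReal_le_ofReal ?_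
        rw [card_box]
        have h1 := Nat.floor_le (nrm_nonneg k)
        have h2 := jb_pos k
        rw [← mul_div_assoc, div_le_iff₀ (by positivity), jb_sq, ← nrm_sq]
        have h3 : (2 * (⌊nrm k⌋₊ : ℝ) + 1) ^ 2 ≤ (2 * nrm k + 1) ^ 2 := by gcongr
        nlinarith [sq_nonneg (2 * nrm k - 1)]
    _ = 512 := by norm_num

-- On a line of fixed `l₂` the resonance function has slope at least `|k|^α/4` and stays in a window
-- of length `2K|k|^α⟨l₂⟩^{1/2}`. The admissible `l₁` thus have diameter at most `8K⟨l₂⟩^{1/2}`, and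
-- each carries weight at most `⟨l₂⟩⁻²`.
open Classical in
theorem tsum_resonant_le {α K : ℝ} (hα : α ∈ Set.Icc (1 : ℝ) 2) (hK : 0 ≤ K) (k : Fin 2 → ℤ) :
    ∑' l, (if 8 * nrm l ≤ nrm k ∧ |reson α k l| ≤ K * absPow α k * Real.sqrt (jbi (l 1))
        then ENNReal.ofReal (1 / jb l ^ 2) else 0)
      ≤ ∑' b : ℤ, ENNReal.ofReal ((16 * K + 1) * (1 / jbi b ^ 2 * Real.sqrt (jbi b))) := by
  let P : ℤ → ℤ → Prop := fun a b => 8 * nrm ![a, b] ≤ nrm k ∧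
    |reson α k ![a, b]| ≤ K * absPow α k * Real.sqrt (jbi b)
  have e : ∀ l : Fin 2 → ℤ, ![l 0, l 1] = l := fun l => by ext j; fin_cases j <;> rfl
  calc _ ≤ ∑' l : Fin 2 → ℤ, (fun a b : ℤ => ENNReal.ofReal (1 / jbi b ^ 2) *
          (if P a b then (1 : ℝ≥0∞) else 0)) (l 0) (l 1) := by
        refine ENNReal.tsum_le_tsum fun l => ?_
        simp only [P, e, mul_ite, mul_one, mul_zero]
        split_ifs
        · refine ENNReal.ofReal_le_ofReal ?_
          have := jbi_pos (l 1)
          exact one_div_le_one_div_of_le (by positivity)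
            (by gcongr; exact jbi_le_jb l)
        · exact le_rfl
    _ ≤ _ := by
        rw [tsum_freq (fun a b : ℤ => ENNReal.ofReal (1 / jbi b ^ 2) *
          (if P a b then (1 : ℝ≥0∞) else 0))]
        refine ENNReal.tsum_le_tsum fun b => ?_
        rw [ENNReal.tsum_mul_left]
        have hb := jbi_pos b
        have hsq : 1 ≤ Real.sqrt (jbi b) := Real.one_le_sqrt.2 (one_le_jbi b)
        have hcount := tsum_indicator_le (P := fun a => P a b) (D := 8 * K * Real.sqrt (jbi b))
          (by positivity) (by
            intro a a' ha ha' haa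
            have hinc := reson_increment hα (k := k) (l := ![a, b]) (l' := ![a', b]) rfl haa
              ha.1 ha'.1
            simp only [Matrix.cons_val_zero] at hinc
            -- The slope degenerates at `k = 0`, but there `8|l| ≤ |k|` leaves only `l = 0`.
            by_cases hk : k = 0
            · subst hk
              have hz : ∀ a, P a b → a = 0 := by
                intro a ha
                by_contra hne
                have : (![a, b] : Fin 2 → ℤ) ≠ 0 := fun h => hne (by simpa using congrFun h 0)
                have h1 := one_le_nrm this
                have h2 := ha.1
                rw [nrm_zero] at h2
                linarith
              rw [hz a ha, hz a' ha', sub_self]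
              positivity
            · have hpos : 0 < absPow α k :=
                Real.rpow_pos_of_pos (lt_of_lt_of_le one_pos (one_le_nrm hk)) _
              have h1 := (abs_le.1 ha.2).2
              have h2 := (abs_le.1 ha'.2).1
              have : ((a' : ℝ) - a) * absPow α k ≤ 8 * K * Real.sqrt (jbi b) * absPow α k := by
                nlinarith
              exact le_of_mul_le_mul_right this hpos)
        calc _ ≤ ENNReal.ofReal (1 / jbi b ^ 2) *
              ENNReal.ofReal (2 * (8 * K * Real.sqrt (jbi b)) + 1) := by gcongr
          _ = ENNReal.ofReal (1 / jbi b ^ 2 * (2 * (8 * K * Real.sqrt (jbi b)) + 1)) :=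
              (ENNReal.ofReal_mul (by positivity)).symm
          _ ≤ _ := by
              refine ENNReal.ofReal_le_ofReal ?_
              rw [show (16 * K + 1) * (1 / jbi b ^ 2 * Real.sqrt (jbi b))
                = 1 / jbi b ^ 2 * ((16 * K + 1) * Real.sqrt (jbi b)) by ring]
              gcongr
              nlinarith

theorem tsum_jbi_lt_top :
    ∑' b : ℤ, ENNReal.ofReal (1 / jbi b ^ 2 * Real.sqrt (jbi b)) < ∞ := by
  have hs : Summable fun b : ℤ => 1 / jbi b ^ 2 * Real.sqrt (jbi b) := by
    have h1 := Real.summable_abs_int_rpow (b := 3 / 2) (by norm_num)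
    have h2 : Summable fun b : ℤ => if b = 0 then (1 : ℝ) else 0 :=
      summable_of_hasFiniteSupport (Set.Finite.subset (Set.finite_singleton 0)
        (by intro b; simp))
    refine Summable.of_nonneg_of_le (fun b => by have := jbi_pos b; positivity) (fun b => ?_)
      (h1.add h2)
    by_cases hb : b = 0
    · subst hb
      simp [jbi, Real.zero_rpow]
    · simp only [hb, if_false, add_zero]
      have hb0 : (0 : ℝ) < |(b : ℝ)| := by simpa using hb
      have hj := jbi_pos b
      have e : 1 / jbi b ^ 2 * Real.sqrt (jbi b) = jbi b ^ (-(3 / 2) : ℝ) := by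
        rw [Real.sqrt_eq_rpow, one_div, ← Real.rpow_natCast, ← Real.rpow_neg hj.le,
          ← Real.rpow_add hj]
        norm_num
      rw [e]
      exact Real.rpow_le_rpow_of_nonpos hb0 (Real.abs_le_sqrt (by linarith)) (by norm_num)
  rw [← ENNReal.ofReal_tsum_of_nonneg (fun b => by have := jbi_pos b; positivity) hs]
  exact ENNReal.ofReal_lt_top

/-- Without normal form a pair is either comparable (`|k| < 8|l|`) or nearly resonant; the two
preceding counts cover these cases, uniformly in `k`. -/
theorem exists_tsum_resMult_sq_le {α K : ℝ} (hα : α ∈ Set.Icc (1 : ℝ) 2) (hK : 0 ≤ K) :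
    ∃ S : ℝ≥0∞, S ≠ ∞ ∧ ∀ k, ∑' l, ENNReal.ofReal (resMult α K k l) ^ 2 ≤ S := by
  classical
  refine ⟨512 + ∑' b : ℤ, ENNReal.ofReal ((16 * K + 1) * (1 / jbi b ^ 2 * Real.sqrt (jbi b))),
    ?_, fun k => ?_⟩
  · simp_rw [ENNReal.ofReal_mul (show 0 ≤ 16 * K + 1 by positivity)]
    rw [ENNReal.tsum_mul_left]
    exact ENNReal.add_ne_top.2 ⟨by norm_num,
      ENNReal.mul_ne_top ENNReal.ofReal_ne_top tsum_jbi_lt_top.ne⟩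
  · refine le_trans ?_ (add_le_add (tsum_comparable_le k) (tsum_resonant_le hα hK k))
    rw [← ENNReal.tsum_add]
    refine ENNReal.tsum_le_tsum fun l => ?_
    rw [← ENNReal.ofReal_pow (resMult_nonneg _ _ _ _)]
    unfold resMult Nonres
    split_ifs with h1 h2 h3 h3 h2 h3 h3
    all_goals first
      | (exact absurd h1.2 (by push Not; grind))
      | simp

end Weights

end FZK
end

noncomputable section
namespace FZK
open scoped ENNReal

/-! ### The multiplier of the cubic correction and what it leaves of the energy multiplier. -/

section Multipliers

/-- This invariance and its analogues for `tripleWeight` and `reson` carry a bound proved for one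
ordering of a triple to its rotations. -/
theorem energyMult_rot (s : ℝ) (k l : Fin 2 → ℤ) :
    energyMult s l (-k - l) = energyMult s k l := by
  unfold energyMult
  rw [show -l - (-k - l) = k by abel]; ring

theorem tripleWeight_rot (s : ℝ) (k l : Fin 2 → ℤ) :
    tripleWeight s l (-k - l) = tripleWeight s k l := by
  unfold tripleWeight
  rw [show -l - (-k - l) = k by abel]; ring

theorem reson_rot (α : ℝ) (k l : Fin 2 → ℤ) : reson α l (-k - l) = reson α k l := by
  unfold reson
  rw [show -l - (-k - l) = k by abel]; ring

theorem tripleWeight_nonneg (s : ℝ) (k l : Fin 2 → ℤ) : 0 ≤ tripleWeight s k l := by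
  have h := fun k => Real.rpow_nonneg (jb_pos k).le s
  exact mul_nonneg (mul_nonneg (h _) (h _)) (h _)

/-- Some ordering of the triple `(k, l, -k-l)` is nonresonant. -/
def NonresTriple (α K : ℝ) (k l : Fin 2 → ℤ) : Prop :=
  Nonres α K k l ∨ Nonres α K l (-k - l) ∨ Nonres α K (-k - l) k

open Classical in
/-- The multiplier of the cubic correction of the energy. -/
def corrMult (α K : ℝ) (k l : Fin 2 → ℤ) : ℝ :=
  if NonresTriple α K k l then -(energyMult (1 + α) k l / (3 * reson α k l)) else 0

open Classical in
/-- The part of the energy multiplier that is not removed by the correction. -/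
def remMult (α K : ℝ) (k l : Fin 2 → ℤ) : ℝ :=
  if NonresTriple α K k l then 0 else energyMult (1 + α) k l

theorem Nonres.reson_ne_zero {α K : ℝ} (hK : 0 ≤ K) {k l : Fin 2 → ℤ} (h : Nonres α K k l) :
    reson α k l ≠ 0 := by
  have h1 : 0 ≤ K * absPow α k * Real.sqrt (jbi (l 1)) :=
    mul_nonneg (mul_nonneg hK (absPow_nonneg _ _)) (Real.sqrt_nonneg _)
  exact abs_pos.1 (lt_of_le_of_lt h1 h.2)

theorem NonresTriple.reson_ne_zero {α K : ℝ} (hK : 0 ≤ K) {k l : Fin 2 → ℤ}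
    (h : NonresTriple α K k l) : reson α k l ≠ 0 := by
  rcases h with h | h | h
  · exact h.reson_ne_zero hK
  · rw [← reson_rot]; exact h.reson_ne_zero hK
  · have := h.reson_ne_zero hK
    rw [← reson_rot, ← reson_rot α l]
    rwa [show -l - (-k - l) = k by abel]

/-- The derivative of the energy has multiplier `energyMult / 3`, and the linear flow acts on the
correction through `corrMult * reson`. The factor 3 in `corrMult` makes the two cancel on
nonresonant triples. -/
theorem remMult_eq {α K : ℝ} (hK : 0 ≤ K) (k l : Fin 2 → ℤ) :
    remMult α K k l = energyMult (1 + α) k l + 3 * (corrMult α K k l * reson α k l) := by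
  unfold remMult corrMult
  split_ifs with h
  · have := h.reson_ne_zero hK
    field_simp; ring
  · ring

/-- One rotation of the triple puts its shortest frequency in second place, where `energyMult_le`
applies; the cyclic sum covers all three cases. -/
theorem abs_remMult_le {α K : ℝ} (hα : α ∈ Set.Icc (1 : ℝ) 2) (k l : Fin 2 → ℤ) :
    |remMult α K k l| ≤ 448 * (resMult α K k l + resMult α K l (-k - l)
      + resMult α K (-k - l) k) * tripleWeight (1 + α) k l := by
  have n1 := resMult_nonneg α K k l
  have n2 := resMult_nonneg α K l (-k - l)
  have n3 := resMult_nonneg α K (-k - l) k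
  have hs : 1 + α ∈ Set.Icc (2 : ℝ) 3 := ⟨by linarith [hα.1], by linarith [hα.2]⟩
  have htw := tripleWeight_nonneg (1 + α) k l
  unfold remMult
  split_ifs with h
  · rw [abs_zero]; positivity
  · simp only [NonresTriple, not_or] at h
    obtain ⟨h1, h2, h3⟩ := h
    -- The three alternatives below treat `l`, `-k - l` and `k` as the shortest frequency.
    rcases le_total (nrm l) (nrm k) with a | a <;>
    rcases le_total (nrm l) (nrm (-k - l)) with b | b <;>
    rcases le_total (nrm k) (nrm (-k - l)) with c | c
    all_goals first
    | (have e := energyMult_le hs a b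
       have r : resMult α K k l = (jb l)⁻¹ := if_pos ⟨a, h1⟩
       rw [← r] at e
       refine e.trans ?_
       gcongr
       linarith)
    | (have e := energyMult_le hs (k := l) (l := -k - l) b
         (by rw [show -l - (-k - l) = k by abel]; first | exact c | exact b.trans a)
       have r : resMult α K l (-k - l) = (jb (-k - l))⁻¹ := if_pos ⟨b, h2⟩
       rw [energyMult_rot, tripleWeight_rot, ← r] at e
       refine e.trans ?_
       gcongr
       linarith)
    | (have e := energyMult_le hs (k := -k - l) (l := k) (by first | exact c | exact a.trans b)
         (by rw [show -(-k - l) - k = l by abel]; exact a)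
       have r : resMult α K (-k - l) k = (jb k)⁻¹ :=
         if_pos ⟨by first | exact c | exact a.trans b, h3⟩
       have e1 := energyMult_rot (1 + α) l (-k - l)
       have e2 := tripleWeight_rot (1 + α) l (-k - l)
       rw [show -l - (-k - l) = k by abel] at e1 e2
       rw [e1, e2, energyMult_rot, tripleWeight_rot, ← r] at e
       refine e.trans ?_
       gcongr
       linarith)

/-- The factor `1 + |k| + |l| + |m|` pays for the derivative that the nonlinearity puts on one of
the three entries when the correction is differentiated in time. -/
theorem abs_corrMult_mul_le {α K : ℝ} (hα : α ∈ Set.Icc (1 : ℝ) 2) (hK : 0 < K)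
    (k l : Fin 2 → ℤ) :
    |corrMult α K k l * (1 + nrm k + nrm l + nrm (-k - l))| ≤
      800 / K * (nonresMult l + nonresMult (-k - l) + nonresMult k) *
        tripleWeight (1 + α) k l := by
  have n1 := nonresMult_nonneg k
  have n2 := nonresMult_nonneg l
  have n3 := nonresMult_nonneg (-k - l)
  have htw := tripleWeight_nonneg (1 + α) k l
  have hq : 0 ≤ 1 + nrm k + nrm l + nrm (-k - l) := by
    linarith [nrm_nonneg k, nrm_nonneg l, nrm_nonneg (-k - l)]
  have key : ∀ m, |energyMult (1 + α) k l / (3 * reson α k l)| *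
      (1 + nrm k + nrm l + nrm (-k - l)) ≤ 800 / K * (nonresMult m * tripleWeight (1 + α) k l) →
      nonresMult m ≤ nonresMult l + nonresMult (-k - l) + nonresMult k →
      |(-(energyMult (1 + α) k l / (3 * reson α k l))) * (1 + nrm k + nrm l + nrm (-k - l))| ≤
      800 / K * (nonresMult l + nonresMult (-k - l) + nonresMult k) *
        tripleWeight (1 + α) k l := by
    intro m h1 h2
    rw [abs_mul, abs_neg, abs_of_nonneg hq]
    refine h1.trans ?_
    rw [mul_assoc]
    gcongr
  unfold corrMult
  split_ifs with h
  · rcases h with h | h | h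
    · exact key l (h.energyMult_div_le hα hK) (by linarith)
    · have e := h.energyMult_div_le hα hK
      rw [energyMult_rot, tripleWeight_rot, reson_rot, show -l - (-k - l) = k by abel] at e
      refine key (-k - l) (le_trans (le_of_eq ?_) e) (by linarith)
      ring
    · have e := h.energyMult_div_le hα hK
      have e1 := energyMult_rot (1 + α) l (-k - l)
      have e2 := tripleWeight_rot (1 + α) l (-k - l)
      have e3 := reson_rot α l (-k - l)
      rw [show -l - (-k - l) = k by abel] at e1 e2 e3
      rw [e1, e2, e3, energyMult_rot, tripleWeight_rot, reson_rot,
        show -(-k - l) - k = l by abel] at e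
      refine key k (le_trans (le_of_eq ?_) e) (by linarith)
      ring
  · rw [zero_mul, abs_zero]; positivity

end Multipliers

/-! ### Trilinear forms over triples of frequencies with zero sum. -/

section Trilinear

theorem ofReal_tripleWeight (s : ℝ) (k l : Fin 2 → ℤ) :
    ENNReal.ofReal (tripleWeight s k l) = wt s k * wt s l * wt s (-k - l) := by
  have h := fun k => Real.rpow_nonneg (jb_pos k).le s
  unfold tripleWeight wt
  rw [ENNReal.ofReal_mul (mul_nonneg (h _) (h _)), ENNReal.ofReal_mul (h _)]

/-- Trilinear forms whose multiplier is dominated by a cyclic sum of Schur multipliers are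
bounded on Sobolev spaces. -/
theorem tsum_mult_le {s C : ℝ} (hC : 0 ≤ C) {f M : (Fin 2 → ℤ) → (Fin 2 → ℤ) → ℝ}
    (hM0 : ∀ k l, 0 ≤ M k l) {S : ℝ≥0∞} (hS : ∀ k, ∑' l, ENNReal.ofReal (M k l) ^ 2 ≤ S)
    (hf : ∀ k l, |f k l| ≤ C * (M k l + M l (-k - l) + M (-k - l) k) * tripleWeight s k l)
    (x y z : (Fin 2 → ℤ) → ℝ≥0∞) :
    ∑' p : (Fin 2 → ℤ) × (Fin 2 → ℤ), ENNReal.ofReal |f p.1 p.2| *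
        (x p.1 * y p.2 * z (-p.1 - p.2))
      ≤ 3 * ENNReal.ofReal C * S ^ (1 / 2 : ℝ) * (hsn s x * hsn s y * hsn s z) := by
  let V := Fin 2 → ℤ
  let g : (V → ℝ≥0∞) → (V → ℝ≥0∞) → (V → ℝ≥0∞) → V × V → ℝ≥0∞ := fun x y z p =>
    ENNReal.ofReal (M p.1 p.2) * ((wt s p.1 * x p.1) * (wt s p.2 * y p.2) *
      (wt s (-p.1 - p.2) * z (-p.1 - p.2)))
  have hg : ∀ x y z, ∑' p, g x y z p ≤ S ^ (1 / 2 : ℝ) * (hsn s x * hsn s y * hsn s z) :=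
    fun x y z => tsum_trilinear_le (fun k l => ENNReal.ofReal (M k l)) S hS _ _ _
  have r1 : ∀ x y z, ∑' p, g x y z (rot V p) = ∑' p, g x y z p :=
    fun x y z => (rot V).tsum_eq (g x y z)
  -- Each of the three multipliers is the same form `g` evaluated on a rotated triple with the
  -- factors permuted accordingly.
  have hpt : ∀ p : V × V, ENNReal.ofReal |f p.1 p.2| * (x p.1 * y p.2 * z (-p.1 - p.2)) ≤
      ENNReal.ofReal C * (g x y z p + g y z x (rot V p) + g z x y (rot V (rot V p))) := by
    rintro ⟨k, l⟩
    have e1 : -l - (-k - l) = k := by abel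
    have e2 : -(-k - l) - k = l := by abel
    simp only [g, rot, Equiv.coe_fn_mk, e1, e2]
    calc ENNReal.ofReal |f k l| * (x k * y l * z (-k - l))
        ≤ ENNReal.ofReal (C * (M k l + M l (-k - l) + M (-k - l) k) * tripleWeight s k l) *
          (x k * y l * z (-k - l)) := by gcongr; exact hf k l
      _ = ENNReal.ofReal C * (ENNReal.ofReal (M k l) + ENNReal.ofReal (M l (-k - l)) +
            ENNReal.ofReal (M (-k - l) k)) * (wt s k * wt s l * wt s (-k - l)) *
            (x k * y l * z (-k - l)) := by
          have h1 := hM0 k l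
          have h2 := hM0 l (-k - l)
          have h3 := hM0 (-k - l) k
          rw [ENNReal.ofReal_mul (by positivity), ENNReal.ofReal_mul hC,
            ENNReal.ofReal_add (by positivity) h3, ENNReal.ofReal_add h1 h2, ofReal_tripleWeight]
      _ = _ := by ring
  calc _ ≤ ∑' p, ENNReal.ofReal C *
        (g x y z p + g y z x (rot V p) + g z x y (rot V (rot V p))) := ENNReal.tsum_le_tsum hpt
    _ = ENNReal.ofReal C * (∑' p, g x y z p + ∑' p, g y z x p + ∑' p, g z x y p) := by
        rw [ENNReal.tsum_mul_left, ENNReal.tsum_add, ENNReal.tsum_add, r1,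
          (rot V).tsum_eq (fun p => g z x y (rot V p)), r1]
    _ ≤ ENNReal.ofReal C * (S ^ (1 / 2 : ℝ) * (hsn s x * hsn s y * hsn s z) +
          S ^ (1 / 2 : ℝ) * (hsn s y * hsn s z * hsn s x) +
          S ^ (1 / 2 : ℝ) * (hsn s z * hsn s x * hsn s y)) := by
        gcongr <;> exact hg _ _ _
    _ = _ := by ring

/-- A trilinear form on triples `k + l + m = 0`. -/
def tri (f : (Fin 2 → ℤ) → (Fin 2 → ℤ) → ℝ) (x y z : (Fin 2 → ℤ) → ℂ) : ℂ :=
  ∑' p : (Fin 2 → ℤ) × (Fin 2 → ℤ), (f p.1 p.2 : ℂ) * (x p.1 * y p.2 * z (-p.1 - p.2))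

theorem enorm_tri_le (f : (Fin 2 → ℤ) → (Fin 2 → ℤ) → ℝ) (x y z : (Fin 2 → ℤ) → ℂ) :
    ‖tri f x y z‖ₑ ≤ ∑' p : (Fin 2 → ℤ) × (Fin 2 → ℤ), ENNReal.ofReal |f p.1 p.2| *
      (‖x p.1‖ₑ * ‖y p.2‖ₑ * ‖z (-p.1 - p.2)‖ₑ) := by
  refine enorm_tsum_le_tsum_enorm.trans (le_of_eq ?_)
  congr 1; ext p
  rw [enorm_mul, enorm_mul, enorm_mul, ← ofReal_norm (f p.1 p.2 : ℂ), Complex.norm_real,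
    Real.norm_eq_abs]

theorem tri_rot (f : (Fin 2 → ℤ) → (Fin 2 → ℤ) → ℝ) (x y z : (Fin 2 → ℤ) → ℂ) :
    tri (fun k l => f l (-k - l)) x y z = tri f y z x := by
  unfold tri
  refine Eq.trans ?_ ((rot (Fin 2 → ℤ)).tsum_eq
    (fun p => (f p.1 p.2 : ℂ) * (y p.1 * z p.2 * x (-p.1 - p.2))))
  congr 1; ext p
  simp only [rot, Equiv.coe_fn_mk, show -p.2 - (-p.1 - p.2) = p.1 by abel]
  ring

theorem tri_eq_sum {N : ℕ} (f : (Fin 2 → ℤ) → (Fin 2 → ℤ) → ℝ) {x y : (Fin 2 → ℤ) → ℂ}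
    (hx : ∀ k ∉ box N, x k = 0) (hy : ∀ k ∉ box N, y k = 0) (z : (Fin 2 → ℤ) → ℂ) :
    tri f x y z = ∑ p ∈ box N ×ˢ box N, (f p.1 p.2 : ℂ) * (x p.1 * y p.2 * z (-p.1 - p.2)) := by
  refine tsum_eq_sum fun p hp => ?_
  rw [Finset.mem_product, not_and_or] at hp
  rcases hp with h | h
  · rw [hx _ h]; ring
  · rw [hy _ h]; ring

end Trilinear

end FZK
end

/-! ### The corrected energy of the Galerkin system and the a priori bound. -/

noncomputable section
namespace FZK
open scoped ENNReal

/-- Convolution of families of Fourier coefficients. -/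
def conv (c d : (Fin 2 → ℤ) → ℂ) (k : Fin 2 → ℤ) : ℂ := ∑' l, c l * d (k - l)

/-- The right-hand side of the equation in terms of Fourier coefficients. -/
def rhs (α : ℝ) (c : (Fin 2 → ℤ) → ℂ) (k : Fin 2 → ℤ) : ℂ :=
  Complex.I * (omega α k : ℂ) * c k - Complex.I * (k 0 : ℂ) / 2 * conv c c k

theorem enorm_conv_le (c d : (Fin 2 → ℤ) → ℂ) (k : Fin 2 → ℤ) :
    ‖conv c d k‖ₑ ≤ econv (fun l => ‖c l‖ₑ) (fun l => ‖d l‖ₑ) k := by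
  refine enorm_tsum_le_tsum_enorm.trans (le_of_eq ?_)
  simp_rw [enorm_mul]; rfl

theorem enorm_real_eq (r : ℝ) : ‖(r : ℂ)‖ₑ = ENNReal.ofReal |r| := by
  rw [← ofReal_norm, Complex.norm_real, Real.norm_eq_abs]

/-- Fourier coefficients of real-valued solutions of the Galerkin scheme. -/
structure IsGalerkinCoeff (α T : ℝ) (N : ℕ) (a : ℝ → (Fin 2 → ℤ) → ℂ) : Prop where
  real : ∀ t ∈ Set.Icc 0 T, ∀ k, a t (-k) = (starRingEnd ℂ) (a t k)
  supp : ∀ t ∈ Set.Icc 0 T, ∀ k ∉ box N, a t k = 0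
  ode : ∀ t ∈ Set.Icc 0 T, ∀ k ∈ box N,
    HasDerivWithinAt (fun τ => a τ k) (rhs α (a t) k) (Set.Icc 0 T) t

/-- The squared Sobolev norm over the frequencies of `box N`. -/
def energy (s : ℝ) (N : ℕ) (c : (Fin 2 → ℤ) → ℂ) : ℝ :=
  ∑ k ∈ box N, (1 + normSq k) ^ s * ‖c k‖ ^ 2

theorem wt_mul_enorm_sq (s : ℝ) (c : (Fin 2 → ℤ) → ℂ) (k : Fin 2 → ℤ) :
    (wt s k * ‖c k‖ₑ) ^ 2 = ENNReal.ofReal ((1 + normSq k) ^ s * ‖c k‖ ^ 2) := by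
  have h := Real.rpow_nonneg (jb_pos k).le s
  rw [wt, ← ofReal_norm, ← ENNReal.ofReal_mul h, ← ENNReal.ofReal_pow (by positivity),
    mul_pow, sq (jb k ^ s), jb_rpow_mul_self]

theorem hsn_enorm_eq {s : ℝ} {N : ℕ} {c : (Fin 2 → ℤ) → ℂ} (hc : ∀ k ∉ box N, c k = 0) :
    hsn s (fun k => ‖c k‖ₑ) ^ 2 = ENNReal.ofReal (energy s N c) := by
  rw [hsn, l2n_sq, energy, ENNReal.ofReal_sum_of_nonneg (fun k _ => mul_nonneg
    (Real.rpow_nonneg (by linarith [normSq_nonneg k]) _) (sq_nonneg _))]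
  rw [tsum_eq_sum (s := box N) (fun k hk => by rw [hc k hk]; simp)]
  exact Finset.sum_congr rfl fun k _ => wt_mul_enorm_sq s c k

theorem hsn_enorm_le {s A : ℝ} (hA : 0 ≤ A) {N : ℕ} {c : (Fin 2 → ℤ) → ℂ}
    (hc : ∀ k ∉ box N, c k = 0) (h : energy s N c ≤ A ^ 2) :
    hsn s (fun k => ‖c k‖ₑ) ≤ ENNReal.ofReal A := by
  refine le_of_sq_le_sq ?_
  rw [hsn_enorm_eq hc, ← ENNReal.ofReal_pow hA]
  exact ENNReal.ofReal_le_ofReal h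

/-- The nonlinear part of the Galerkin vector field. -/
def nonlin (N : ℕ) (c : (Fin 2 → ℤ) → ℂ) (k : Fin 2 → ℤ) : ℂ :=
  if k ∈ box N then -(Complex.I * (k 0 : ℂ) / 2 * conv c c k) else 0

theorem nonlin_of_notMem {N : ℕ} {c : (Fin 2 → ℤ) → ℂ} {k : Fin 2 → ℤ} (hk : k ∉ box N) :
    nonlin N c k = 0 := if_neg hk

theorem enorm_nonlin_le (N : ℕ) (c : (Fin 2 → ℤ) → ℂ) (k : Fin 2 → ℤ) :
    ‖nonlin N c k‖ₑ ≤ ENNReal.ofReal (nrm k) * econv (fun l => ‖c l‖ₑ) (fun l => ‖c l‖ₑ) k := by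
  unfold nonlin
  split_ifs
  · rw [enorm_neg, enorm_mul]
    refine mul_le_mul' ?_ (enorm_conv_le c c k)
    rw [← ofReal_norm]
    refine ENNReal.ofReal_le_ofReal ?_
    rw [norm_div, norm_mul, Complex.norm_I, one_mul, Complex.norm_intCast, Complex.norm_two]
    have := abs_fst_le k
    linarith [abs_nonneg (k 0 : ℝ)]
  · simp

/-- The cubic correction of the energy. -/
def correction (α K : ℝ) (c : (Fin 2 → ℤ) → ℂ) : ℝ := (tri (corrMult α K) c c c).re

theorem tsum_corrMult_le {α K : ℝ} (hα : α ∈ Set.Icc (1 : ℝ) 2) (hK : 0 < K)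
    (x y z : (Fin 2 → ℤ) → ℝ≥0∞) :
    ∑' p : (Fin 2 → ℤ) × (Fin 2 → ℤ),
      ENNReal.ofReal |corrMult α K p.1 p.2 * (1 + nrm p.1 + nrm p.2 + nrm (-p.1 - p.2))| *
        (x p.1 * y p.2 * z (-p.1 - p.2))
      ≤ ENNReal.ofReal (19200 / K) * (hsn (1 + α) x * hsn (1 + α) y * hsn (1 + α) z) := by
  refine (tsum_mult_le (f := fun k l => corrMult α K k l * (1 + nrm k + nrm l + nrm (-k - l)))
    (M := fun _ l => nonresMult l) (C := 800 / K) (by positivity)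
    (fun _ l => nonresMult_nonneg l) (fun _ => tsum_nonresMult_sq_le)
    (abs_corrMult_mul_le hα hK) x y z).trans (le_of_eq ?_)
  congr 1
  rw [show (64 : ℝ≥0∞) = 8 ^ 2 by norm_num, sq_rpow_half,
    show (3 : ℝ≥0∞) = ENNReal.ofReal 3 by norm_num, show (8 : ℝ≥0∞) = ENNReal.ofReal 8 by norm_num,
    ← ENNReal.ofReal_mul (by norm_num), ← ENNReal.ofReal_mul (by positivity)]
  congr 1; ring

/-- The hypothesis allows the product to exceed its majorant by one derivative in total, which is
what `corrMult` can absorb. -/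
theorem enorm_tri_corrMult_le {α K : ℝ} (hα : α ∈ Set.Icc (1 : ℝ) 2) (hK : 0 < K)
    {c d e : (Fin 2 → ℤ) → ℂ} {x y z : (Fin 2 → ℤ) → ℝ≥0∞}
    (h : ∀ k l, ‖c k‖ₑ * ‖d l‖ₑ * ‖e (-k - l)‖ₑ ≤
      ENNReal.ofReal (1 + nrm k + nrm l + nrm (-k - l)) * (x k * y l * z (-k - l))) :
    ‖tri (corrMult α K) c d e‖ₑ ≤
      ENNReal.ofReal (19200 / K) * (hsn (1 + α) x * hsn (1 + α) y * hsn (1 + α) z) := by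
  refine (enorm_tri_le _ _ _ _).trans (le_trans (ENNReal.tsum_le_tsum fun p => ?_)
    (tsum_corrMult_le hα hK x y z))
  calc ENNReal.ofReal |corrMult α K p.1 p.2| * (‖c p.1‖ₑ * ‖d p.2‖ₑ * ‖e (-p.1 - p.2)‖ₑ)
      ≤ ENNReal.ofReal |corrMult α K p.1 p.2| *
        (ENNReal.ofReal |1 + nrm p.1 + nrm p.2 + nrm (-p.1 - p.2)| *
          (x p.1 * y p.2 * z (-p.1 - p.2))) := by
        refine mul_le_mul_right ((h _ _).trans ?_) _
        gcongr
        exact le_abs_self _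
    _ = _ := by rw [abs_mul, ENNReal.ofReal_mul (abs_nonneg _)]; ring

theorem abs_correction_le {α K A : ℝ} (hα : α ∈ Set.Icc (1 : ℝ) 2) (hK : 0 < K) (hA : 0 ≤ A)
    {N : ℕ} {c : (Fin 2 → ℤ) → ℂ} (hc : ∀ k ∉ box N, c k = 0)
    (h : energy (1 + α) N c ≤ A ^ 2) : |correction α K c| ≤ 19200 / K * A ^ 3 := by
  have hn := hsn_enorm_le hA hc h
  have h1 := enorm_tri_corrMult_le hα hK (c := c) (d := c) (e := c) (x := fun k => ‖c k‖ₑ)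
    (y := fun k => ‖c k‖ₑ) (z := fun k => ‖c k‖ₑ) (fun k l => by
      refine le_mul_of_one_le_left zero_le (ENNReal.one_le_ofReal.2 ?_)
      linarith [nrm_nonneg k, nrm_nonneg l, nrm_nonneg (-k - l)])
  have h2 : ‖tri (corrMult α K) c c c‖ₑ ≤ ENNReal.ofReal (19200 / K * A ^ 3) := by
    refine h1.trans ?_
    rw [ENNReal.ofReal_mul (by positivity), show A ^ 3 = A * A * A by ring,
      ENNReal.ofReal_mul (by positivity), ENNReal.ofReal_mul hA]
    gcongr
  rw [← ofReal_norm, ENNReal.ofReal_le_ofReal_iff (by positivity)] at h2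
  exact (Complex.abs_re_le_norm _).trans h2

theorem tri_add_of_supp {N : ℕ} (f g : (Fin 2 → ℤ) → (Fin 2 → ℤ) → ℝ) {x : (Fin 2 → ℤ) → ℂ}
    (hx : ∀ k ∉ box N, x k = 0) :
    tri (fun k l => f k l + g k l) x x x = tri f x x x + tri g x x x := by
  rw [tri_eq_sum _ hx hx, tri_eq_sum _ hx hx, tri_eq_sum _ hx hx, ← Finset.sum_add_distrib]
  refine Finset.sum_congr rfl fun p _ => ?_
  push_cast; ring

/-- `energyMult` is the sum of the three rotations of the one-sided multiplier, and with equal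
arguments all rotations give the same form. -/
theorem tri_energyMult {N : ℕ} (s : ℝ) {x : (Fin 2 → ℤ) → ℂ} (hx : ∀ k ∉ box N, x k = 0) :
    tri (energyMult s) x x x = 3 * tri (fun k _ => (k 0 : ℝ) * (1 + normSq k) ^ s) x x x := by
  let f : (Fin 2 → ℤ) → (Fin 2 → ℤ) → ℝ := fun k _ => (k 0 : ℝ) * (1 + normSq k) ^ s
  have e : energyMult s = fun k l => (f k l + f l (-k - l)) +
      (fun k l => f l (-k - l)) l (-k - l) := by
    ext k l; simp only [energyMult, f]
  rw [e, tri_add_of_supp (fun k l => f k l + f l (-k - l)) _ hx, tri_add_of_supp f _ hx,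
    tri_rot (fun k l => f l (-k - l)), tri_rot f]
  ring

theorem conv_eq_sum {N : ℕ} {c : (Fin 2 → ℤ) → ℂ} (hc : ∀ k ∉ box N, c k = 0)
    (d : (Fin 2 → ℤ) → ℂ) (k : Fin 2 → ℤ) : conv c d k = ∑ l ∈ box N, c l * d (k - l) :=
  tsum_eq_sum fun l hl => by rw [hc l hl, zero_mul]

namespace IsGalerkinCoeff

variable {α T : ℝ} {N : ℕ} {a : ℝ → (Fin 2 → ℤ) → ℂ}

/-- The linear term needs no truncation because the coefficients vanish off the box. A formula valid
for every `k` is needed for the third frequency `-k - l`, which may leave the box. -/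
theorem hasDeriv (h : IsGalerkinCoeff α T N a) {t : ℝ} (ht : t ∈ Set.Icc 0 T) (k : Fin 2 → ℤ) :
    HasDerivWithinAt (fun τ => a τ k)
      (Complex.I * (omega α k : ℂ) * a t k + nonlin N (a t) k) (Set.Icc 0 T) t := by
  by_cases hk : k ∈ box N
  · convert h.ode t ht k hk using 1
    rw [nonlin, if_pos hk, rhs]; ring
  · rw [nonlin_of_notMem hk, h.supp t ht k hk, mul_zero, add_zero]
    exact (hasDerivWithinAt_const t _ (0 : ℂ)).congr (fun τ hτ => h.supp τ hτ k hk)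
      (h.supp t ht k hk)

theorem energy_eq (h : IsGalerkinCoeff α T N a) (s : ℝ) {t : ℝ} (ht : t ∈ Set.Icc 0 T) :
    energy s N (a t) = (∑ k ∈ box N, (((1 + normSq k) ^ s : ℝ) : ℂ) * (a t k * a t (-k))).re := by
  rw [Complex.re_sum, energy]
  refine Finset.sum_congr rfl fun k _ => ?_
  rw [h.real t ht, Complex.mul_conj, ← Complex.ofReal_mul, Complex.ofReal_re,
    Complex.normSq_eq_norm_sq]

/-- `ω` is odd, so the linear contributions of `k` and `-k` cancel. The nonlinear ones agree after
`k ↦ -k`, and their sum cancels the factor `1/2`; expanding the convolution at `-k` produces the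
triples `(k, l, -k-l)`. -/
theorem hasDeriv_energy (h : IsGalerkinCoeff α T N a) (s : ℝ) {t : ℝ} (ht : t ∈ Set.Icc 0 T) :
    HasDerivWithinAt (fun τ => energy s N (a τ))
      (Complex.I * tri (fun k _ => (k 0 : ℝ) * (1 + normSq k) ^ s) (a t) (a t) (a t)).re
      (Set.Icc 0 T) t := by
  have hd : HasDerivWithinAt
      (fun τ => ∑ k ∈ box N, (((1 + normSq k) ^ s : ℝ) : ℂ) * (a τ k * a τ (-k)))
      (∑ k ∈ box N, (((1 + normSq k) ^ s : ℝ) : ℂ) *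
        ((Complex.I * (omega α k : ℂ) * a t k + nonlin N (a t) k) * a t (-k) +
          a t k * (Complex.I * (omega α (-k) : ℂ) * a t (-k) + nonlin N (a t) (-k))))
      (Set.Icc 0 T) t :=
    HasDerivWithinAt.fun_sum fun k _ =>
      ((h.hasDeriv ht k).mul (h.hasDeriv ht (-k))).const_mul _
  have hre := (Complex.reCLM.hasFDerivAt.comp_hasDerivWithinAt t hd)
  refine (hre.congr_deriv ?_).congr (fun τ hτ => h.energy_eq s hτ) (h.energy_eq s ht)
  change Complex.re _ = _
  congr 1
  have e1 : ∑ k ∈ box N, (((1 + normSq k) ^ s : ℝ) : ℂ) * (nonlin N (a t) k * a t (-k)) =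
      ∑ k ∈ box N, (((1 + normSq k) ^ s : ℝ) : ℂ) * (a t k * nonlin N (a t) (-k)) := by
    refine Finset.sum_equiv (Equiv.neg _) (fun k => neg_mem_box.symm) fun k _ => ?_
    simp only [Equiv.neg_apply, neg_neg, normSq_neg]; ring
  have e2 : ∀ k ∈ box N, (((1 + normSq k) ^ s : ℝ) : ℂ) *
        ((Complex.I * (omega α k : ℂ) * a t k + nonlin N (a t) k) * a t (-k) +
          a t k * (Complex.I * (omega α (-k) : ℂ) * a t (-k) + nonlin N (a t) (-k))) =
      (((1 + normSq k) ^ s : ℝ) : ℂ) * (nonlin N (a t) k * a t (-k)) +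
      (((1 + normSq k) ^ s : ℝ) : ℂ) * (a t k * nonlin N (a t) (-k)) := by
    intro k _
    rw [omega_neg]; push_cast; ring
  rw [Finset.sum_congr rfl e2, Finset.sum_add_distrib, e1, ← two_mul,
    tri_eq_sum _ (h.supp t ht) (h.supp t ht), Finset.sum_product, Finset.mul_sum, Finset.mul_sum]
  refine Finset.sum_congr rfl fun k hk => ?_
  rw [nonlin, if_pos (neg_mem_box.2 hk), conv_eq_sum (h.supp t ht)]
  simp only [Finset.mul_sum, ← Finset.sum_neg_distrib]
  refine Finset.sum_congr rfl fun l _ => ?_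
  simp only [Pi.neg_apply, Int.cast_neg]
  push_cast; ring

/-- The linear flow multiplies each product over a triple by `i` times the resonance function. The
remaining three terms are quartic. -/
theorem hasDeriv_correction (h : IsGalerkinCoeff α T N a) (K : ℝ) {t : ℝ}
    (ht : t ∈ Set.Icc 0 T) :
    HasDerivWithinAt (fun τ => correction α K (a τ))
      (Complex.I * tri (fun k l => corrMult α K k l * reson α k l) (a t) (a t) (a t)
        + tri (corrMult α K) (nonlin N (a t)) (a t) (a t)
        + tri (corrMult α K) (a t) (nonlin N (a t)) (a t)
        + tri (corrMult α K) (a t) (a t) (nonlin N (a t))).re (Set.Icc 0 T) t := by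
  have hn : ∀ k ∉ box N, nonlin N (a t) k = 0 := fun k hk => nonlin_of_notMem hk
  have hs := h.supp t ht
  have hd : HasDerivWithinAt
      (fun τ => ∑ p ∈ box N ×ˢ box N, (corrMult α K p.1 p.2 : ℂ) *
        (a τ p.1 * a τ p.2 * a τ (-p.1 - p.2)))
      (∑ p ∈ box N ×ˢ box N, (corrMult α K p.1 p.2 : ℂ) *
        (((Complex.I * (omega α p.1 : ℂ) * a t p.1 + nonlin N (a t) p.1) * a t p.2 +
          a t p.1 * (Complex.I * (omega α p.2 : ℂ) * a t p.2 + nonlin N (a t) p.2)) *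
            a t (-p.1 - p.2) +
          a t p.1 * a t p.2 * (Complex.I * (omega α (-p.1 - p.2) : ℂ) * a t (-p.1 - p.2) +
            nonlin N (a t) (-p.1 - p.2))))
      (Set.Icc 0 T) t :=
    HasDerivWithinAt.fun_sum fun p _ =>
      (((h.hasDeriv ht p.1).mul (h.hasDeriv ht p.2)).mul (h.hasDeriv ht (-p.1 - p.2))).const_mul _
  have hre := (Complex.reCLM.hasFDerivAt.comp_hasDerivWithinAt t hd)
  have hc : ∀ τ ∈ Set.Icc 0 T, correction α K (a τ) = Complex.reCLM
      (∑ p ∈ box N ×ˢ box N, (corrMult α K p.1 p.2 : ℂ) *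
        (a τ p.1 * a τ p.2 * a τ (-p.1 - p.2))) := by
    intro τ hτ
    rw [correction, tri_eq_sum _ (h.supp τ hτ) (h.supp τ hτ)]; rfl
  refine (hre.congr_deriv ?_).congr hc (hc t ht)
  change Complex.re _ = _
  congr 1
  rw [tri_eq_sum _ hs hs, tri_eq_sum _ hn hs, tri_eq_sum _ hs hn, tri_eq_sum _ hs hs,
    Finset.mul_sum, ← Finset.sum_add_distrib, ← Finset.sum_add_distrib, ← Finset.sum_add_distrib]
  refine Finset.sum_congr rfl fun p _ => ?_
  rw [reson]; push_cast; ring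

/-- The corrected energy has a derivative without loss. -/
theorem hasDeriv_total (h : IsGalerkinCoeff α T N a) {K : ℝ} (hK : 0 ≤ K) {t : ℝ}
    (ht : t ∈ Set.Icc 0 T) :
    HasDerivWithinAt (fun τ => energy (1 + α) N (a τ) + correction α K (a τ))
      (Complex.I / 3 * tri (remMult α K) (a t) (a t) (a t)
        + tri (corrMult α K) (nonlin N (a t)) (a t) (a t)
        + tri (corrMult α K) (a t) (nonlin N (a t)) (a t)
        + tri (corrMult α K) (a t) (a t) (nonlin N (a t))).re (Set.Icc 0 T) t := by
  refine ((h.hasDeriv_energy (1 + α) ht).add (h.hasDeriv_correction K ht)).congr_deriv ?_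
  rw [← Complex.add_re]
  congr 1
  have hs := h.supp t ht
  have e : tri (remMult α K) (a t) (a t) (a t) = tri (energyMult (1 + α)) (a t) (a t) (a t)
      + 3 * tri (fun k l => corrMult α K k l * reson α k l) (a t) (a t) (a t) := by
    rw [tri_eq_sum _ hs hs, tri_eq_sum _ hs hs, tri_eq_sum _ hs hs, Finset.mul_sum,
      ← Finset.sum_add_distrib]
    refine Finset.sum_congr rfl fun p _ => ?_
    rw [remMult_eq hK]; push_cast; ring
  rw [e, tri_energyMult _ hs]
  ring

end IsGalerkinCoeff

/-- The nonlinearity is a derivative of a square. `corrMult` absorbs the derivative and the algebra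
property of `H^{1+α}` bounds the square; `4915200 = 19200 · 256`. -/
theorem enorm_tri_nonlin_le {α K A : ℝ} (hα : α ∈ Set.Icc (1 : ℝ) 2) (hK : 0 < K) (hA : 0 ≤ A)
    {N : ℕ} {c : (Fin 2 → ℤ) → ℂ} (hn : hsn (1 + α) (fun k => ‖c k‖ₑ) ≤ ENNReal.ofReal A) :
    ‖tri (corrMult α K) (nonlin N c) c c‖ₑ ≤ ENNReal.ofReal (4915200 / K * A ^ 4) ∧
    ‖tri (corrMult α K) c (nonlin N c) c‖ₑ ≤ ENNReal.ofReal (4915200 / K * A ^ 4) ∧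
    ‖tri (corrMult α K) c c (nonlin N c)‖ₑ ≤ ENNReal.ofReal (4915200 / K * A ^ 4) := by
  set x : (Fin 2 → ℤ) → ℝ≥0∞ := fun k => ‖c k‖ₑ with hx
  set q := econv x x with hq
  have hs : 1 + α ∈ Set.Icc (2 : ℝ) 3 := ⟨by linarith [hα.1], by linarith [hα.2]⟩
  have hqn : hsn (1 + α) q ≤ 256 * (ENNReal.ofReal A * ENNReal.ofReal A) :=
    (hsn_econv_le hs x x).trans (by gcongr)
  have hfin : ENNReal.ofReal (19200 / K) *
      (256 * (ENNReal.ofReal A * ENNReal.ofReal A) * ENNReal.ofReal A * ENNReal.ofReal A) =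
      ENNReal.ofReal (4915200 / K * A ^ 4) := by
    rw [show (256 : ℝ≥0∞) = ENNReal.ofReal 256 by norm_num, ← ENNReal.ofReal_mul hA,
      ← ENNReal.ofReal_mul (by norm_num), ← ENNReal.ofReal_mul (by positivity),
      ← ENNReal.ofReal_mul (by positivity), ← ENNReal.ofReal_mul (by positivity)]
    congr 1; ring
  have hw : ∀ k, ‖nonlin N c k‖ₑ ≤ ENNReal.ofReal (nrm k) * q k := enorm_nonlin_le N c
  have hle : ∀ (k l : Fin 2 → ℤ) (r : ℝ) (u v : ℝ≥0∞), r ≤ 1 + nrm k + nrm l + nrm (-k - l) →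
      u ≤ ENNReal.ofReal r * v →
      u ≤ ENNReal.ofReal (1 + nrm k + nrm l + nrm (-k - l)) * v := by
    intro k l r u v hr hu
    exact hu.trans (by gcongr)
  refine ⟨?_, ?_, ?_⟩
  · refine (enorm_tri_corrMult_le hα hK (x := q) (y := x) (z := x) fun k l => ?_).trans ?_
    · refine hle k l (nrm k) _ _ (by linarith [nrm_nonneg l, nrm_nonneg (-k - l)]) ?_
      calc _ ≤ (ENNReal.ofReal (nrm k) * q k) * x l * x (-k - l) := by gcongr; exact hw k
        _ = _ := by ring
    · rw [← hfin]; gcongr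
  · refine (enorm_tri_corrMult_le hα hK (x := x) (y := q) (z := x) fun k l => ?_).trans ?_
    · refine hle k l (nrm l) _ _ (by linarith [nrm_nonneg k, nrm_nonneg (-k - l)]) ?_
      calc _ ≤ x k * (ENNReal.ofReal (nrm l) * q l) * x (-k - l) := by gcongr; exact hw l
        _ = _ := by ring
    · rw [← hfin, mul_comm (hsn (1 + α) x)]; gcongr
  · refine (enorm_tri_corrMult_le hα hK (x := x) (y := x) (z := q) fun k l => ?_).trans ?_
    · refine hle k l (nrm (-k - l)) _ _ (by linarith [nrm_nonneg k, nrm_nonneg l]) ?_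
      calc _ ≤ x k * x l * (ENNReal.ofReal (nrm (-k - l)) * q (-k - l)) := by
            gcongr; exact hw _
        _ = _ := by ring
    · rw [← hfin, mul_comm (hsn (1 + α) x * hsn (1 + α) x), ← mul_assoc (hsn (1 + α) q)]; gcongr

/-- The derivative of the corrected energy is controlled by the energy. -/
theorem exists_total_deriv_le {α K : ℝ} (hα : α ∈ Set.Icc (1 : ℝ) 2) (hK : 0 < K) :
    ∃ C : ℝ, 0 ≤ C ∧ ∀ (A : ℝ), 0 ≤ A → ∀ (N : ℕ) (c : (Fin 2 → ℤ) → ℂ), (∀ k ∉ box N, c k = 0) →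
      energy (1 + α) N c ≤ A ^ 2 →
      |(Complex.I / 3 * tri (remMult α K) c c c + tri (corrMult α K) (nonlin N c) c c
        + tri (corrMult α K) c (nonlin N c) c + tri (corrMult α K) c c (nonlin N c)).re|
        ≤ C * A ^ 3 + 3 * (4915200 / K * A ^ 4) := by
  obtain ⟨S, hS, hres⟩ := exists_tsum_resMult_sq_le hα hK.le
  refine ⟨448 * (S ^ (1 / 2 : ℝ)).toReal, by positivity, fun A hA N c hc hE => ?_⟩
  have hn := hsn_enorm_le hA hc hE
  obtain ⟨h1, h2, h3⟩ := enorm_tri_nonlin_le hα hK hA (N := N) hn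
  have hS' : S ^ (1 / 2 : ℝ) ≠ ∞ := ENNReal.rpow_ne_top_of_nonneg (by norm_num) hS
  have h0 : ‖tri (remMult α K) c c c‖ₑ ≤
      ENNReal.ofReal (3 * (448 * (S ^ (1 / 2 : ℝ)).toReal * A ^ 3)) := by
    refine (enorm_tri_le _ _ _ _).trans ((tsum_mult_le (by norm_num) (resMult_nonneg α K) hres
      (abs_remMult_le hα) (fun k => ‖c k‖ₑ) (fun k => ‖c k‖ₑ) (fun k => ‖c k‖ₑ)).trans ?_)
    rw [show 3 * (448 * (S ^ (1 / 2 : ℝ)).toReal * A ^ 3)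
      = 3 * 448 * (S ^ (1 / 2 : ℝ)).toReal * (A * A * A) by ring,
      ENNReal.ofReal_mul (by positivity), ENNReal.ofReal_mul (by positivity),
      ENNReal.ofReal_mul (by positivity), ENNReal.ofReal_mul (by positivity),
      ENNReal.ofReal_mul (by positivity), ENNReal.ofReal_toReal hS']
    gcongr
    norm_num
  have conv : ∀ (z : ℂ) (r : ℝ), 0 ≤ r → ‖z‖ₑ ≤ ENNReal.ofReal r → ‖z‖ ≤ r := by
    intro z r hr hz
    rwa [← ofReal_norm, ENNReal.ofReal_le_ofReal_iff hr] at hz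
  have h0' := conv _ _ (by positivity) h0
  have h1' := conv _ _ (by positivity) h1
  have h2' := conv _ _ (by positivity) h2
  have h3' := conv _ _ (by positivity) h3
  have h4 : ‖Complex.I / 3 * tri (remMult α K) c c c‖ ≤
      448 * (S ^ (1 / 2 : ℝ)).toReal * A ^ 3 := by
    rw [norm_mul, norm_div, Complex.norm_I, Complex.norm_ofNat]
    linarith
  refine (Complex.abs_re_le_norm _).trans ?_
  refine (norm_add_le _ _).trans ?_
  have := norm_add_le (Complex.I / 3 * tri (remMult α K) c c c
    + tri (corrMult α K) (nonlin N c) c c) (tri (corrMult α K) c (nonlin N c) c)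
  have := norm_add_le (Complex.I / 3 * tri (remMult α K) c c c)
    (tri (corrMult α K) (nonlin N c) c c)
  linarith

/-- Uniform bounds for the Galerkin approximations on a time interval that depends only on the
size of the data. -/
theorem exists_apriori_bound {α : ℝ} (hα : α ∈ Set.Icc (1 : ℝ) 2) {A : ℝ} (hA : 1 ≤ A) :
    ∃ T : ℝ, 0 < T ∧ ∀ (N : ℕ) (a : ℝ → (Fin 2 → ℤ) → ℂ), IsGalerkinCoeff α T N a →
      energy (1 + α) N (a 0) ≤ A ^ 2 → ∀ t ∈ Set.Icc 0 T, energy (1 + α) N (a t) ≤ (2 * A) ^ 2 := by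
  -- With this choice `19200/K · (2A)³ = A²/2`: the correction is at most half of the initial bound
  -- as long as the energy stays below `(2A)²`.
  set K : ℝ := 307200 * A with hKdef
  have hK : 0 < K := by positivity
  obtain ⟨C, hC, hbound⟩ := exists_total_deriv_le hα hK
  set D : ℝ := C * (2 * A) ^ 3 + 3 * (4915200 / K * (2 * A) ^ 4) with hD
  have hD0 : 0 ≤ D := by positivity
  -- The time is chosen so that the corrected energy grows by at most 1.
  refine ⟨1 / (D + 1), by positivity, fun N a h h0 => ?_⟩
  set T : ℝ := 1 / (D + 1) with hT
  have hT0 : 0 < T := by positivity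
  have hDT : D * T ≤ 1 := by
    rw [hT, mul_one_div, div_le_one (by positivity)]; linarith
  set E : ℝ → ℝ := fun t => energy (1 + α) N (a t) with hE
  have hcont : ContinuousOn E (Set.Icc 0 T) := fun t ht =>
    (h.hasDeriv_energy (1 + α) ht).continuousWithinAt
  -- Bootstrap: the bound `4A²` up to time `t` improves at time `t` to `A² + A²/2 + A²/2 + 1 ≤ 3A² <
  -- 4A²`, using `A ≥ 1`.
  have hstrict : ∀ t ∈ Set.Icc 0 T, (∀ τ ∈ Set.Icc 0 t, E τ ≤ (2 * A) ^ 2) →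
      E t < (2 * A) ^ 2 := by
    intro t ht hτ
    have hsub : Set.Icc 0 t ⊆ Set.Icc 0 T := Set.Icc_subset_Icc_right ht.2
    have hmv := norm_image_sub_le_of_norm_deriv_le_segment' (C := D)
      (f := fun τ => E τ + correction α K (a τ))
      (fun τ hτ' => (h.hasDeriv_total hK.le (hsub hτ')).mono hsub)
      (fun τ hτ' => by
        rw [Real.norm_eq_abs]
        exact hbound (2 * A) (by positivity) N (a τ)
          (h.supp τ (hsub (Set.Ico_subset_Icc_self hτ'))) (hτ τ (Set.Ico_subset_Icc_self hτ')))
      t (Set.right_mem_Icc.2 ht.1)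
    have c0 := abs_correction_le hα hK (A := 2 * A) (by positivity)
      (h.supp 0 ⟨le_rfl, hT0.le⟩) (hτ 0 ⟨le_rfl, ht.1⟩)
    have c1 := abs_correction_le hα hK (A := 2 * A) (by positivity)
      (h.supp t ht) (hτ t ⟨ht.1, le_rfl⟩)
    have e : 19200 / K * (2 * A) ^ 3 = A ^ 2 / 2 := by rw [hKdef]; field_simp; norm_num
    rw [e] at c0 c1
    rw [Real.norm_eq_abs] at hmv
    have m1 := (abs_le.1 hmv).2
    have m2 := (abs_le.1 c0).2
    have m3 := (abs_le.1 c1).1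
    have hDt : D * (t - 0) ≤ 1 := by
      rw [sub_zero]; exact (mul_le_mul_of_nonneg_left ht.2 hD0).trans hDT
    have hE0 : E 0 ≤ A ^ 2 := h0
    nlinarith
  by_contra! hcon
  obtain ⟨t₁, ht₁, hbig⟩ := hcon
  -- If the bound failed, there would be a first time at which the energy reaches `4A²`, which the
  -- strict improvement excludes.
  have hclosed : IsCompact {t ∈ Set.Icc 0 T | (2 * A) ^ 2 ≤ E t} := by
    refine isCompact_Icc.of_isClosed_subset ?_ fun t ht => ht.1
    exact hcont.preimage_isClosed_of_isClosed isClosed_Icc isClosed_Ici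
  obtain ⟨t₀, ⟨ht₀, hge⟩, hleast⟩ := hclosed.exists_isLeast ⟨t₁, ht₁, hbig.le⟩
  have hbefore : ∀ τ ∈ Set.Ico 0 t₀, E τ < (2 * A) ^ 2 := by
    intro τ hτ
    by_contra! hc
    exact absurd (hleast ⟨⟨hτ.1, hτ.2.le.trans ht₀.2⟩, hc⟩) (not_le.2 hτ.2)
  have heq : E t₀ ≤ (2 * A) ^ 2 := by
    by_contra! hgt
    have hE0 : E 0 ≤ (2 * A) ^ 2 := by
      have : E 0 ≤ A ^ 2 := h0
      nlinarith
    obtain ⟨τ, hτ, hval⟩ := intermediate_value_Icc ht₀.1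
      (hcont.mono (Set.Icc_subset_Icc_right ht₀.2)) ⟨hE0, hgt.le⟩
    rcases hτ.2.eq_or_lt with rfl | hlt
    · linarith
    · exact absurd hval (hbefore τ ⟨hτ.1, hlt⟩).ne
  have := hstrict t₀ ht₀ fun τ hτ => by
    rcases hτ.2.eq_or_lt with rfl | hlt
    · exact heq
    · exact (hbefore τ ⟨hτ.1, hlt⟩).le
  linarith

end FZK
end

noncomputable section
namespace FZK
open scoped ENNReal

/-! ### Logarithmic growth of the truncated lattice sum. -/

section LogBound

/-- The `ℓ²` norm of `⟨l⟩⁻¹` over `box J`; it grows like the square root of a logarithm. -/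
def logSum (J : ℕ) : ℝ≥0∞ := ∑ l ∈ box J, ENNReal.ofReal (1 / jb l ^ 2)

theorem inv_jbi_le (n : ℕ) : 1 / jbi n ≤ 2 * ((n + 1 : ℕ) : ℝ)⁻¹ := by
  have h := jbi_pos n
  have hn : (0 : ℝ) ≤ n := n.cast_nonneg
  rw [← div_eq_mul_inv, div_le_div_iff₀ h (by positivity), one_mul]
  have : ((n : ℝ) + 1) ^ 2 ≤ (2 * jbi n) ^ 2 := by
    rw [mul_pow, jbi_sq]; push_cast; nlinarith [sq_nonneg ((n : ℝ) - 1)]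
  push_cast
  exact le_of_abs_le (abs_le_of_sq_le_sq this (by positivity))

theorem sum_inv_jbi_le (J : ℕ) :
    ∑ n ∈ Finset.range (J + 1), 8 / jbi n ≤ 16 * (1 + Real.log (J + 1)) := by
  calc ∑ n ∈ Finset.range (J + 1), 8 / jbi n
      ≤ ∑ n ∈ Finset.range (J + 1), 16 * ((n + 1 : ℕ) : ℝ)⁻¹ := by
        refine Finset.sum_le_sum fun n _ => ?_
        have := inv_jbi_le n
        rw [div_eq_mul_one_div]; linarith
    _ = 16 * ((harmonic (J + 1) : ℚ) : ℝ) := by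
        rw [← Finset.mul_sum, harmonic]; push_cast; rfl
    _ ≤ 16 * (1 + Real.log (J + 1)) := by
        have := harmonic_le_one_add_log (J + 1)
        push_cast at this
        gcongr

/-- Each horizontal line contributes at most `8/⟨b⟩`, and summing over `|b| ≤ J` gives a harmonic
sum for either sign of `b`. -/
theorem logSum_le (J : ℕ) : logSum J ≤ ENNReal.ofReal (32 * (1 + Real.log (J + 1))) := by
  classical
  let g : ℤ → ℝ≥0∞ := fun b => if |b| ≤ (J : ℤ) then ENNReal.ofReal (8 / jbi b) else 0
  have hnat : ∑' n : ℕ, g n ≤ ENNReal.ofReal (16 * (1 + Real.log (J + 1))) := by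
    rw [tsum_eq_sum (s := Finset.range (J + 1)) (fun n hn => if_neg (by
      rw [Finset.mem_range] at hn; rw [abs_of_nonneg (by positivity)]; omega))]
    refine le_trans ?_ (ENNReal.ofReal_le_ofReal (sum_inv_jbi_le J))
    rw [ENNReal.ofReal_sum_of_nonneg (fun n _ => by have := jbi_pos n; positivity)]
    refine Finset.sum_le_sum fun n _ => ?_
    split_ifs
    · exact le_rfl
    · exact zero_le
  have hneg : ∑' n : ℕ, g (-((n : ℤ) + 1)) ≤ ∑' n : ℕ, g n := by
    refine ENNReal.tsum_le_tsum fun n => ?_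
    simp only [g]
    by_cases h : |(-((n : ℤ) + 1))| ≤ (J : ℤ)
    · rw [if_pos h, if_pos (by rw [abs_neg, abs_of_nonneg (by positivity)] at h
                               rw [abs_of_nonneg (by positivity)]; omega)]
      refine ENNReal.ofReal_le_ofReal ?_
      have h1 := jbi_pos n
      refine div_le_div_of_nonneg_left (by norm_num) h1 (Real.sqrt_le_sqrt ?_)
      push_cast
      nlinarith [(n.cast_nonneg : (0 : ℝ) ≤ n)]
    · rw [if_neg h]; exact zero_le
  calc logSum J ≤ ∑' l : Fin 2 → ℤ, (fun a b : ℤ => (if |b| ≤ (J : ℤ) then (1 : ℝ≥0∞) else 0) *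
        ENNReal.ofReal (1 / (jbi b ^ 2 + (a : ℝ) ^ 2))) (l 0) (l 1) := by
        refine le_trans (Finset.sum_le_sum fun l hl => ?_) (ENNReal.sum_le_tsum (box J))
        simp only
        rw [if_pos (mem_box.1 hl 1), one_mul, jb_sq_eq]
    _ ≤ ∑' b : ℤ, g b := by
        rw [tsum_freq (fun a b : ℤ => (if |b| ≤ (J : ℤ) then (1 : ℝ≥0∞) else 0) *
          ENNReal.ofReal (1 / (jbi b ^ 2 + (a : ℝ) ^ 2)))]
        refine ENNReal.tsum_le_tsum fun b => ?_
        rw [ENNReal.tsum_mul_left]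
        simp only [g]
        split_ifs
        · rw [one_mul]; exact tsum_line_le b
        · simp
    _ ≤ _ := by
        rw [tsum_of_nat_of_neg_add_one ENNReal.summable ENNReal.summable,
          show 32 * (1 + Real.log (J + 1)) = 16 * (1 + Real.log (J + 1))
            + 16 * (1 + Real.log (J + 1)) by ring]
        have hl : 0 ≤ Real.log ((J : ℝ) + 1) := Real.log_nonneg (by
          linarith [(J.cast_nonneg : (0 : ℝ) ≤ J)])
        rw [ENNReal.ofReal_add (by positivity) (by positivity)]
        exact add_le_add hnat (hneg.trans hnat)

end LogBound

/-! ### Transport estimate for the difference of two solutions. -/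

section Transport

theorem tri_swap (f : (Fin 2 → ℤ) → (Fin 2 → ℤ) → ℝ) (x y z : (Fin 2 → ℤ) → ℂ) :
    tri (fun k l => f (-k - l) l) x y z = tri f z y x := by
  let e : (Fin 2 → ℤ) × (Fin 2 → ℤ) ≃ (Fin 2 → ℤ) × (Fin 2 → ℤ) :=
    { toFun := fun p => (-p.1 - p.2, p.2)
      invFun := fun p => (-p.1 - p.2, p.2)
      left_inv := fun p => by ext <;> simp
      right_inv := fun p => by ext <;> simp }
  unfold tri
  refine Eq.trans ?_ (e.tsum_eq (fun p => (f p.1 p.2 : ℂ) * (z p.1 * y p.2 * x (-p.1 - p.2))))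
  congr 1; ext p
  simp only [e, Equiv.coe_fn_mk, show -(-p.1 - p.2) - p.2 = p.1 by abel]
  ring

theorem ofReal_nrm_le_wt {s : ℝ} (hs : 2 ≤ s) (k : Fin 2 → ℤ) :
    ENNReal.ofReal (nrm k) ≤ wt s k := by
  refine ENNReal.ofReal_le_ofReal ((nrm_le_jb k).trans ?_)
  calc jb k = jb k ^ (1 : ℝ) := (Real.rpow_one _).symm
    _ ≤ _ := Real.rpow_le_rpow_of_exponent_le (one_le_jb k) (by linarith)

theorem l2n_le_hsn {s : ℝ} (hs : 0 ≤ s) (x : (Fin 2 → ℤ) → ℝ≥0∞) : l2n x ≤ hsn s x :=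
  l2n_mono fun k => le_mul_of_one_le_left zero_le (one_le_wt hs k)

/-- High frequencies: outside `box J` a derivative and a factor `J` are absorbed by the weight. -/
theorem nrm_le_inv_mul_wt {s : ℝ} (hs : 2 ≤ s) {J : ℕ} (hJ : 1 ≤ J) {k : Fin 2 → ℤ}
    (hk : k ∉ box J) : ENNReal.ofReal (nrm k) ≤ (J : ℝ≥0∞)⁻¹ * wt s k ∧
      1 ≤ (J : ℝ≥0∞)⁻¹ * wt s k := by
  have h1 := lt_nrm_of_notMem_box hk
  have hJ1 : (1 : ℝ) ≤ J := by exact_mod_cast hJ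
  have hJ0 : (0 : ℝ) < J := by linarith
  have h2 : jb k ^ 2 ≤ jb k ^ s := by
    rw [← Real.rpow_natCast]
    exact Real.rpow_le_rpow_of_exponent_le (one_le_jb k) (by exact_mod_cast hs)
  have h3 := nrm_le_jb k
  have e : (J : ℝ≥0∞)⁻¹ * wt s k = ENNReal.ofReal ((J : ℝ)⁻¹ * jb k ^ s) := by
    rw [ENNReal.ofReal_mul (by positivity), ENNReal.ofReal_inv_of_pos hJ0, ENNReal.ofReal_natCast,
      wt]
  rw [e]
  constructor
  · refine ENNReal.ofReal_le_ofReal ?_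
    rw [le_inv_mul_iff₀ hJ0]
    nlinarith
  · refine ENNReal.one_le_ofReal.2 ?_
    rw [le_inv_mul_iff₀ hJ0]
    nlinarith

/-- Replaces a Lipschitz bound on the transporting field: the derivative is not in `ℓ¹` for `s = 2`,
but on `box J` it is, up to the square root of a logarithm. -/
theorem sum_nrm_mul_le {s : ℝ} (hs : 2 ≤ s) (J : ℕ) (z : (Fin 2 → ℤ) → ℝ≥0∞) :
    ∑ l ∈ box J, ENNReal.ofReal (nrm l) * z l ≤ logSum J ^ (1 / 2 : ℝ) * hsn s z := by
  classical
  have hpt : ∀ l, ENNReal.ofReal (nrm l) * z l ≤ ENNReal.ofReal (1 / jb l) * (wt s l * z l) := by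
    intro l
    have hj := jb_pos l
    rw [← mul_assoc, wt, ← ENNReal.ofReal_mul (by positivity)]
    gcongr
    rw [one_div, le_inv_mul_iff₀ hj]
    calc jb l * nrm l ≤ jb l * jb l := by gcongr; exact nrm_le_jb l
      _ = jb l ^ (2 : ℝ) := by rw [Real.rpow_two]; ring
      _ ≤ _ := Real.rpow_le_rpow_of_exponent_le (one_le_jb l) hs
  calc ∑ l ∈ box J, ENNReal.ofReal (nrm l) * z l
      ≤ ∑ l ∈ box J, ENNReal.ofReal (1 / jb l) * (wt s l * z l) := Finset.sum_le_sum fun l _ => hpt l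
    _ = ∑' l, (if l ∈ box J then ENNReal.ofReal (1 / jb l) else 0) * (wt s l * z l) := by
        rw [tsum_eq_sum (s := box J) (fun l hl => by rw [if_neg hl, zero_mul])]
        exact Finset.sum_congr rfl fun l hl => by rw [if_pos hl]
    _ ≤ _ := tsum_mul_le_l2n_mul_l2n _ _
    _ = _ := by
        unfold hsn
        congr 1
        unfold l2n logSum
        congr 1
        rw [tsum_eq_sum (s := box J) (fun l hl => by simp [hl])]
        refine Finset.sum_congr rfl fun l hl => ?_
        simp only [if_pos hl]
        rw [← ENNReal.ofReal_pow (by have := jb_pos l; positivity)]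
        congr 1; ring

theorem summable_tri {s : ℝ} (hs : 2 ≤ s) {f : (Fin 2 → ℤ) → (Fin 2 → ℤ) → ℝ}
    (hf : ∀ k l, |f k l| ≤ nrm k) {c d : (Fin 2 → ℤ) → ℂ}
    (hc : hsn s (fun k => ‖c k‖ₑ) ≠ ∞) (hd : hsn s (fun k => ‖d k‖ₑ) ≠ ∞) :
    Summable fun p : (Fin 2 → ℤ) × (Fin 2 → ℤ) =>
      (f p.1 p.2 : ℂ) * (d p.1 * c p.2 * d (-p.1 - p.2)) := by
  refine Summable.of_enorm (ne_top_of_le_ne_top ?_ (le_trans (ENNReal.tsum_le_tsum fun p => ?_)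
    (tsum_trilinear_le_l1 (fun k => wt s k * ‖d k‖ₑ) (fun k => ‖c k‖ₑ) (fun k => ‖d k‖ₑ))))
  · refine ENNReal.mul_ne_top (ne_top_of_le_ne_top (ENNReal.mul_ne_top (by norm_num) hc)
      (tsum_le_hsn hs _)) (ENNReal.mul_ne_top hd ?_)
    exact ne_top_of_le_ne_top hd (l2n_le_hsn (by linarith) _)
  · rw [enorm_mul, enorm_mul, enorm_mul, enorm_real_eq]
    calc _ ≤ wt s p.1 * (‖d p.1‖ₑ * ‖c p.2‖ₑ * ‖d (-p.1 - p.2)‖ₑ) := by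
          gcongr
          exact (ENNReal.ofReal_le_ofReal (hf _ _)).trans (ofReal_nrm_le_wt hs _)
      _ = _ := by ring

open Classical in
/-- The transport form `∑_{k ∈ box J} k₁ d_k c_l d_m`. -/
theorem enorm_transport_le {s : ℝ} (hs : 2 ≤ s) {J : ℕ} (hJ : 1 ≤ J) {c d : (Fin 2 → ℤ) → ℂ}
    {B : ℝ≥0∞} (hB : B ≠ ∞) (hc : hsn s (fun k => ‖c k‖ₑ) ≤ B) (hd : hsn s (fun k => ‖d k‖ₑ) ≤ B) :
    ‖tri (fun k _ => if k ∈ box J then (k 0 : ℝ) else 0) d c d‖ₑ ≤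
      logSum J ^ (1 / 2 : ℝ) * B * (∑ k ∈ box J, ‖d k‖ₑ ^ 2) + 16 * B ^ 3 * (J : ℝ≥0∞)⁻¹ := by
  set x : (Fin 2 → ℤ) → ℝ≥0∞ := fun k => ‖d k‖ₑ with hx
  set z : (Fin 2 → ℤ) → ℝ≥0∞ := fun k => ‖c k‖ₑ with hz
  have hc' : hsn s z ≠ ∞ := ne_top_of_le_ne_top hB hc
  have hd' : hsn s x ≠ ∞ := ne_top_of_le_ne_top hB hd
  -- `f₁` keeps the triples whose two `d`-frequencies are both low and can be symmetrized; `f₂` has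
  -- the second one high.
  let f₁ : (Fin 2 → ℤ) → (Fin 2 → ℤ) → ℝ := fun k l =>
    if k ∈ box J ∧ -k - l ∈ box J then (k 0 : ℝ) else 0
  let f₂ : (Fin 2 → ℤ) → (Fin 2 → ℤ) → ℝ := fun k l =>
    if k ∈ box J ∧ -k - l ∉ box J then (k 0 : ℝ) else 0
  let g : (Fin 2 → ℤ) → (Fin 2 → ℤ) → ℝ := fun k l =>
    if k ∈ box J ∧ -k - l ∈ box J then (l 0 : ℝ) else 0
  have hf₁ : ∀ k l, |f₁ k l| ≤ nrm k := by
    intro k l; simp only [f₁]; split_ifs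
    · exact abs_fst_le k
    · simpa using nrm_nonneg k
  have hf₂ : ∀ k l, |f₂ k l| ≤ nrm k := by
    intro k l; simp only [f₂]; split_ifs
    · exact abs_fst_le k
    · simpa using nrm_nonneg k
  have s₁ := summable_tri hs hf₁ hc' hd'
  have s₂ := summable_tri hs hf₂ hc' hd'
  have hsplit : tri (fun k _ => if k ∈ box J then (k 0 : ℝ) else 0) d c d =
      tri f₁ d c d + tri f₂ d c d := by
    unfold tri
    rw [← s₁.tsum_add s₂]
    congr 1; ext p
    simp only [f₁, f₂]
    by_cases h1 : p.1 ∈ box J <;> by_cases h2 : -p.1 - p.2 ∈ box J <;> simp [h1, h2]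
  -- Integration by parts: exchanging `k` and `m` symmetrizes the multiplier to `k₁ + m₁ = -l₁`,
  -- which moves the derivative from `d` to `c`.
  have hsym : tri f₁ d c d + tri f₁ d c d = -tri g d c d := by
    have hsw := tri_swap f₁ d c d
    have s₁' : Summable fun p : (Fin 2 → ℤ) × (Fin 2 → ℤ) =>
        ((fun k l => f₁ (-k - l) l) p.1 p.2 : ℂ) * (d p.1 * c p.2 * d (-p.1 - p.2)) := by
      let e : (Fin 2 → ℤ) × (Fin 2 → ℤ) ≃ (Fin 2 → ℤ) × (Fin 2 → ℤ) :=
        { toFun := fun p => (-p.1 - p.2, p.2)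
          invFun := fun p => (-p.1 - p.2, p.2)
          left_inv := fun p => by ext <;> simp
          right_inv := fun p => by ext <;> simp }
      refine (e.summable_iff.2 s₁).congr fun p => ?_
      simp only [e, Function.comp, Equiv.coe_fn_mk, show -(-p.1 - p.2) - p.2 = p.1 by abel]
      ring
    nth_rewrite 2 [← hsw]
    unfold tri
    rw [← s₁.tsum_add s₁', ← tsum_neg]
    congr 1; ext p
    simp only [f₁, g, show -(-p.1 - p.2) - p.2 = p.1 by abel]
    by_cases h1 : p.1 ∈ box J <;> by_cases h2 : -p.1 - p.2 ∈ box J <;> simp [h1, h2]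
    ring
  -- No symmetry is available, but the high frequency `m` yields the factor `1/J` from its Sobolev
  -- weight.
  have b₂ : ‖tri f₂ d c d‖ₑ ≤ 8 * B ^ 3 * (J : ℝ≥0∞)⁻¹ := by
    calc ‖tri f₂ d c d‖ₑ ≤ _ := enorm_tri_le _ _ _ _
      _ ≤ ∑' p : (Fin 2 → ℤ) × (Fin 2 → ℤ), (J : ℝ≥0∞)⁻¹ * ((wt s p.1 * x p.1) * z p.2 *
            (wt s (-p.1 - p.2) * x (-p.1 - p.2))) := by
          refine ENNReal.tsum_le_tsum fun p => ?_
          by_cases h2 : p.1 ∈ box J ∧ -p.1 - p.2 ∉ box J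
          · have n1 := (ENNReal.ofReal_le_ofReal (hf₂ p.1 p.2)).trans (ofReal_nrm_le_wt hs p.1)
            have n2 := (nrm_le_inv_mul_wt hs hJ h2.2).2
            calc _ ≤ wt s p.1 * (‖d p.1‖ₑ * ‖c p.2‖ₑ *
                  (((J : ℝ≥0∞)⁻¹ * wt s (-p.1 - p.2)) * ‖d (-p.1 - p.2)‖ₑ)) := by
                  gcongr
                  exact le_mul_of_one_le_left zero_le n2
              _ = _ := by simp only [hx, hz]; ring
          · simp [f₂, h2]
      _ ≤ (J : ℝ≥0∞)⁻¹ * ((∑' l, z l) * (hsn s x * hsn s x)) := by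
          rw [ENNReal.tsum_mul_left]
          gcongr
          exact tsum_trilinear_le_l1 (fun k => wt s k * x k) z (fun k => wt s k * x k)
      _ ≤ (J : ℝ≥0∞)⁻¹ * ((8 * B) * (B * B)) := by
          gcongr
          exact (tsum_le_hsn hs z).trans (by gcongr)
      _ = _ := by ring
  -- If `l` lies in `box J` the logarithmic sum applies; if not, its weight yields `1/J`.
  have b₁ : ‖tri g d c d‖ₑ ≤ logSum J ^ (1 / 2 : ℝ) * B * (∑ k ∈ box J, ‖d k‖ₑ ^ 2)
      + 8 * B ^ 3 * (J : ℝ≥0∞)⁻¹ := by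
    let xJ : (Fin 2 → ℤ) → ℝ≥0∞ := fun k => if k ∈ box J then x k else 0
    have hxJ : l2n xJ * l2n xJ = ∑ k ∈ box J, ‖d k‖ₑ ^ 2 := by
      rw [← sq, l2n_sq, tsum_eq_sum (s := box J) (fun k hk => by simp [xJ, hk])]
      exact Finset.sum_congr rfl fun k hk => by simp [xJ, hk, hx]
    let zJ : (Fin 2 → ℤ) → ℝ≥0∞ := fun l => if l ∈ box J then ENNReal.ofReal (nrm l) * z l else 0
    calc ‖tri g d c d‖ₑ ≤ _ := enorm_tri_le _ _ _ _
      _ ≤ ∑' p : (Fin 2 → ℤ) × (Fin 2 → ℤ), (xJ p.1 * zJ p.2 * xJ (-p.1 - p.2) +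
            (J : ℝ≥0∞)⁻¹ * (x p.1 * (wt s p.2 * z p.2) * x (-p.1 - p.2))) := by
          refine ENNReal.tsum_le_tsum fun p => ?_
          by_cases h2 : p.1 ∈ box J ∧ -p.1 - p.2 ∈ box J
          · have hg : |g p.1 p.2| ≤ nrm p.2 := by
              simp only [g, if_pos h2]; exact abs_fst_le p.2
            have hg' := ENNReal.ofReal_le_ofReal hg
            by_cases hl : p.2 ∈ box J
            · refine le_add_right ?_
              simp only [xJ, zJ, if_pos h2.1, if_pos h2.2, if_pos hl]
              calc _ ≤ ENNReal.ofReal (nrm p.2) * (‖d p.1‖ₑ * ‖c p.2‖ₑ * ‖d (-p.1 - p.2)‖ₑ) := by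
                    gcongr
                _ = _ := by simp only [hx, hz]; ring
            · refine le_add_left ?_
              calc _ ≤ ((J : ℝ≥0∞)⁻¹ * wt s p.2) *
                    (‖d p.1‖ₑ * ‖c p.2‖ₑ * ‖d (-p.1 - p.2)‖ₑ) := by
                    gcongr
                    exact hg'.trans (nrm_le_inv_mul_wt hs hJ hl).1
                _ = _ := by simp only [hx, hz]; ring
          · simp [g, h2]
      _ = (∑' p : (Fin 2 → ℤ) × (Fin 2 → ℤ), xJ p.1 * zJ p.2 * xJ (-p.1 - p.2)) +
            (J : ℝ≥0∞)⁻¹ * ∑' p : (Fin 2 → ℤ) × (Fin 2 → ℤ),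
              (wt s p.1 * z p.1) * x p.2 * x (-p.1 - p.2) := by
          rw [ENNReal.tsum_add, ENNReal.tsum_mul_left,
            ← (rot (Fin 2 → ℤ)).tsum_eq (fun p => (wt s p.1 * z p.1) * x p.2 * x (-p.1 - p.2))]
          congr 3
          ext p
          simp only [rot, Equiv.coe_fn_mk, show -p.2 - (-p.1 - p.2) = p.1 by abel]
          ring
      _ ≤ (∑' l, zJ l) * (l2n xJ * l2n xJ) +
            (J : ℝ≥0∞)⁻¹ * ((∑' l, x l) * (hsn s z * l2n x)) := by
          gcongr
          · exact tsum_trilinear_le_l1 xJ zJ xJ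
          · exact tsum_trilinear_le_l1 (fun k => wt s k * z k) x x
      _ ≤ (logSum J ^ (1 / 2 : ℝ) * B) * (∑ k ∈ box J, ‖d k‖ₑ ^ 2) +
            (J : ℝ≥0∞)⁻¹ * ((8 * B) * (B * B)) := by
          rw [hxJ]
          gcongr
          · rw [tsum_eq_sum (s := box J) (fun l hl => by simp [zJ, hl])]
            calc ∑ l ∈ box J, zJ l = ∑ l ∈ box J, ENNReal.ofReal (nrm l) * z l :=
                  Finset.sum_congr rfl fun l hl => by simp [zJ, hl]
              _ ≤ _ := sum_nrm_mul_le hs J z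
              _ ≤ _ := by gcongr
          · exact (tsum_le_hsn hs x).trans (by gcongr)
          · exact (l2n_le_hsn (by linarith) x).trans hd
      _ = _ := by ring
  have b₃ : ‖tri f₁ d c d‖ₑ ≤ ‖tri g d c d‖ₑ := by
    rw [← enorm_neg (tri g d c d), ← hsym, ← two_mul, enorm_mul]
    refine le_mul_of_one_le_left zero_le ?_
    rw [← ofReal_norm, Complex.norm_two]
    norm_num
  calc _ ≤ ‖tri f₁ d c d‖ₑ + ‖tri f₂ d c d‖ₑ := by rw [hsplit]; exact enorm_add_le _ _
    _ ≤ (logSum J ^ (1 / 2 : ℝ) * B * (∑ k ∈ box J, ‖d k‖ₑ ^ 2) + 8 * B ^ 3 * (J : ℝ≥0∞)⁻¹) +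
        8 * B ^ 3 * (J : ℝ≥0∞)⁻¹ := add_le_add (b₃.trans b₁) b₂
    _ = _ := by ring

end Transport

end FZK
end

/-! ### Stability in `L²` with a logarithmic loss. -/

noncomputable section
namespace FZK
open scoped ENNReal

/-- Fourier coefficients of a real-valued function of time that satisfies the equation for the
frequencies in `box J`, with a bound in the Sobolev space `H^{1+α}`. -/
structure IsCoeffSol (α T A : ℝ) (J : ℕ) (a : ℝ → (Fin 2 → ℤ) → ℂ) : Prop where
  real : ∀ t ∈ Set.Icc 0 T, ∀ k, a t (-k) = (starRingEnd ℂ) (a t k)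
  bound : ∀ t ∈ Set.Icc 0 T, hsn (1 + α) (fun k => ‖a t k‖ₑ) ≤ ENNReal.ofReal A
  ode : ∀ t ∈ Set.Icc 0 T, ∀ k ∈ box J,
    HasDerivWithinAt (fun τ => a τ k) (rhs α (a t) k) (Set.Icc 0 T) t

/-- Brings Galerkin solutions of different orders, and solutions with different bounds, to a common
box and a common constant. -/
theorem IsCoeffSol.mono {α T A B : ℝ} {J L : ℕ} {a : ℝ → (Fin 2 → ℤ) → ℂ}
    (h : IsCoeffSol α T A J a) (hAB : A ≤ B) (hLJ : L ≤ J) : IsCoeffSol α T B L a where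
  real := h.real
  bound t ht := (h.bound t ht).trans (ENNReal.ofReal_le_ofReal hAB)
  ode t ht k hk := h.ode t ht k (mem_box.2 fun j => (mem_box.1 hk j).trans (by exact_mod_cast hLJ))

theorem summable_conv {c d : (Fin 2 → ℤ) → ℂ} (hc : l2n (fun k => ‖c k‖ₑ) ≠ ∞)
    (hd : l2n (fun k => ‖d k‖ₑ) ≠ ∞) (k : Fin 2 → ℤ) : Summable fun l => c l * d (k - l) := by
  refine Summable.of_enorm (ne_top_of_le_ne_top (ENNReal.mul_ne_top hc hd) ?_)
  simp_rw [enorm_mul]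
  refine (tsum_mul_le_l2n_mul_l2n _ _).trans ?_
  rw [← l2n_comp_equiv (Equiv.subLeft k) (fun k => ‖d k‖ₑ)]
  rfl

theorem conv_comm (c d : (Fin 2 → ℤ) → ℂ) (k : Fin 2 → ℤ) : conv c d k = conv d c k := by
  unfold conv
  rw [← (Equiv.subLeft k).tsum_eq]
  congr 1; ext l
  simp only [Equiv.subLeft_apply, sub_sub_cancel]
  ring

/-- `u² - v² = (u + v)(u - v)` in coefficients; square summability justifies splitting the series.
-/
theorem conv_sub_conv {c d : (Fin 2 → ℤ) → ℂ} (hc : l2n (fun k => ‖c k‖ₑ) ≠ ∞)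
    (hd : l2n (fun k => ‖d k‖ₑ) ≠ ∞) (k : Fin 2 → ℤ) :
    conv c c k - conv d d k = conv (fun l => c l + d l) (fun l => c l - d l) k := by
  have hcd := conv_comm c d k
  have e : conv (fun l => c l + d l) (fun l => c l - d l) k =
      (conv c c k - conv c d k) + (conv d c k - conv d d k) := by
    unfold conv
    rw [← (summable_conv hc hc k).tsum_sub (summable_conv hc hd k),
      ← (summable_conv hd hc k).tsum_sub (summable_conv hd hd k),
      ← ((summable_conv hc hc k).sub (summable_conv hc hd k)).tsum_add
        ((summable_conv hd hc k).sub (summable_conv hd hd k))]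
    congr 1; ext l; ring
  rw [e, hcd]; ring

theorem hsn_add_le {s : ℝ} {c d e : (Fin 2 → ℤ) → ℂ} {A : ℝ} (hA : 0 ≤ A)
    (hc : hsn s (fun k => ‖c k‖ₑ) ≤ ENNReal.ofReal A) (hd : hsn s (fun k => ‖d k‖ₑ) ≤ ENNReal.ofReal A)
    (he : ∀ k, ‖e k‖ₑ ≤ ‖c k‖ₑ + ‖d k‖ₑ) :
    hsn s (fun k => ‖e k‖ₑ) ≤ ENNReal.ofReal (4 * A) := by
  calc hsn s (fun k => ‖e k‖ₑ) ≤ l2n fun k => wt s k * ‖c k‖ₑ + wt s k * ‖d k‖ₑ :=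
        l2n_mono fun k => by rw [← mul_add]; gcongr; exact he k
    _ ≤ 2 * (hsn s (fun k => ‖c k‖ₑ) + hsn s (fun k => ‖d k‖ₑ)) := l2n_add_le _ _
    _ ≤ 2 * (ENNReal.ofReal A + ENNReal.ofReal A) := by gcongr
    _ = _ := by
        rw [← ENNReal.ofReal_add hA hA, show (2 : ℝ≥0∞) = ENNReal.ofReal 2 by norm_num,
          ← ENNReal.ofReal_mul (by norm_num)]
        congr 1; ring

-- The dispersive terms cancel between `k` and `-k`, and the difference of squares makes `a + b`
-- transport `a - b`. Only `k` is confined to the box: the convolutions are full series.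
open Classical in
theorem hasDeriv_sum_norm_sq_sub {α T A : ℝ} (hα : α ∈ Set.Icc (1 : ℝ) 2) {J : ℕ}
    {a b : ℝ → (Fin 2 → ℤ) → ℂ} (ha : IsCoeffSol α T A J a) (hb : IsCoeffSol α T A J b)
    {t : ℝ} (ht : t ∈ Set.Icc 0 T) :
    HasDerivWithinAt (fun τ => ∑ k ∈ box J, ‖a τ k - b τ k‖ ^ 2)
      (Complex.I * tri (fun k _ => if k ∈ box J then (k 0 : ℝ) else 0) (fun k => a t k - b t k)
        (fun k => a t k + b t k) (fun k => a t k - b t k)).re (Set.Icc 0 T) t := by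
  have hs : (2 : ℝ) ≤ 1 + α := by linarith [hα.1]
  have hA : hsn (1 + α) (fun k => ‖a t k‖ₑ) ≠ ∞ :=
    ne_top_of_le_ne_top ENNReal.ofReal_ne_top (ha.bound t ht)
  have hB : hsn (1 + α) (fun k => ‖b t k‖ₑ) ≠ ∞ :=
    ne_top_of_le_ne_top ENNReal.ofReal_ne_top (hb.bound t ht)
  have hA2 := ne_top_of_le_ne_top hA (l2n_le_hsn (by linarith) _)
  have hB2 := ne_top_of_le_ne_top hB (l2n_le_hsn (by linarith) _)
  set d : (Fin 2 → ℤ) → ℂ := fun k => a t k - b t k with hd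
  set c : (Fin 2 → ℤ) → ℂ := fun k => a t k + b t k with hc
  have hdn : hsn (1 + α) (fun k => ‖d k‖ₑ) ≠ ∞ := by
    refine ne_top_of_le_ne_top ?_ ((l2n_mono fun k => ?_).trans (l2n_add_le
      (fun k => wt (1 + α) k * ‖a t k‖ₑ) (fun k => wt (1 + α) k * ‖b t k‖ₑ)))
    · exact ENNReal.mul_ne_top (by norm_num) (ENNReal.add_ne_top.2 ⟨hA, hB⟩)
    · rw [← mul_add]; gcongr; exact enorm_sub_le
  have hcn : hsn (1 + α) (fun k => ‖c k‖ₑ) ≠ ∞ := by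
    refine ne_top_of_le_ne_top ?_ ((l2n_mono fun k => ?_).trans (l2n_add_le
      (fun k => wt (1 + α) k * ‖a t k‖ₑ) (fun k => wt (1 + α) k * ‖b t k‖ₑ)))
    · exact ENNReal.mul_ne_top (by norm_num) (ENNReal.add_ne_top.2 ⟨hA, hB⟩)
    · rw [← mul_add]; gcongr; exact enorm_add_le _ _
  have hderiv : ∀ k ∈ box J, HasDerivWithinAt (fun τ => a τ k - b τ k)
      (Complex.I * (omega α k : ℂ) * d k - Complex.I * (k 0 : ℂ) / 2 * conv c d k)
      (Set.Icc 0 T) t := by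
    intro k hk
    refine ((ha.ode t ht k hk).sub (hb.ode t ht k hk)).congr_deriv ?_
    rw [← conv_sub_conv hA2 hB2 k, rhs, rhs]
    simp only [hd]; ring
  have heq : ∀ τ ∈ Set.Icc 0 T, ∑ k ∈ box J, ‖a τ k - b τ k‖ ^ 2 =
      Complex.reCLM (∑ k ∈ box J, (a τ k - b τ k) * (a τ (-k) - b τ (-k))) := by
    intro τ hτ
    rw [Complex.reCLM_apply, Complex.re_sum]
    refine Finset.sum_congr rfl fun k _ => ?_
    rw [ha.real τ hτ, hb.real τ hτ, ← map_sub, Complex.mul_conj, Complex.ofReal_re,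
      Complex.normSq_eq_norm_sq]
  have hsum : HasDerivWithinAt
      (fun τ => ∑ k ∈ box J, (a τ k - b τ k) * (a τ (-k) - b τ (-k)))
      (∑ k ∈ box J,
        ((Complex.I * (omega α k : ℂ) * d k - Complex.I * (k 0 : ℂ) / 2 * conv c d k) * d (-k) +
          d k * (Complex.I * (omega α (-k) : ℂ) * d (-k)
            - Complex.I * ((-k) 0 : ℤ) / 2 * conv c d (-k)))) (Set.Icc 0 T) t :=
    HasDerivWithinAt.fun_sum fun k hk => (hderiv k hk).mul (hderiv (-k) (neg_mem_box.2 hk))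
  refine ((Complex.reCLM.hasFDerivAt.comp_hasDerivWithinAt t hsum).congr_deriv ?_).congr heq
    (heq t ht)
  change Complex.re _ = _
  congr 1
  have e1 : ∑ k ∈ box J, -(Complex.I * (k 0 : ℂ) / 2 * conv c d k * d (-k)) =
      ∑ k ∈ box J, d k * (Complex.I * (k 0 : ℂ) / 2 * conv c d (-k)) := by
    refine Finset.sum_equiv (Equiv.neg _) (fun k => neg_mem_box.symm) fun k _ => ?_
    simp only [Equiv.neg_apply, neg_neg, Pi.neg_apply, Int.cast_neg]; ring
  have e2 : ∀ k ∈ box J,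
      (Complex.I * (omega α k : ℂ) * d k - Complex.I * (k 0 : ℂ) / 2 * conv c d k) * d (-k) +
          d k * (Complex.I * (omega α (-k) : ℂ) * d (-k)
            - Complex.I * ((-k) 0 : ℤ) / 2 * conv c d (-k)) =
      -(Complex.I * (k 0 : ℂ) / 2 * conv c d k * d (-k)) +
        d k * (Complex.I * (k 0 : ℂ) / 2 * conv c d (-k)) := by
    intro k _
    rw [omega_neg]; simp only [Pi.neg_apply]; push_cast; ring
  rw [Finset.sum_congr rfl e2, Finset.sum_add_distrib, e1, ← two_mul]
  have hsumm := summable_tri (f := fun k _ => if k ∈ box J then (k 0 : ℝ) else 0) hs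
    (fun k l => by
      split_ifs
      · exact abs_fst_le k
      · simpa using nrm_nonneg k) hcn hdn
  unfold tri
  rw [hsumm.tsum_prod, tsum_eq_sum (s := box J) (fun k hk => by simp [hk]), Finset.mul_sum,
    Finset.mul_sum]
  refine Finset.sum_congr rfl fun k hk => ?_
  simp only [if_pos hk, conv]
  rw [← tsum_mul_left, ← tsum_mul_left, ← tsum_mul_left, ← tsum_mul_left]
  congr 1; ext l
  push_cast
  ring

/-- Young's inequality `M r ≤ 16 M² + r²/64` turns `√log` into half a logarithm, so the exponential
costs at most `√(J + 1)` up to a constant. -/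
theorem exp_log_bound {M : ℝ} {J : ℕ} (hJ : 1 ≤ J) :
    Real.exp (M * Real.sqrt (32 * (1 + Real.log (J + 1)))) / J
      ≤ 2 * Real.exp (16 * M ^ 2 + 1 / 2) / Real.sqrt J := by
  have hJ1 : (1 : ℝ) ≤ J := by exact_mod_cast hJ
  have hJ0 : (0 : ℝ) < J := by linarith
  have hl : 0 ≤ Real.log ((J : ℝ) + 1) := Real.log_nonneg (by linarith)
  set r := Real.sqrt (32 * (1 + Real.log (J + 1))) with hr
  have hr2 : r ^ 2 = 32 * (1 + Real.log (J + 1)) := Real.sq_sqrt (by positivity)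
  have h1 : M * r ≤ (16 * M ^ 2 + 1 / 2) + Real.log (J + 1) / 2 := by
    nlinarith [sq_nonneg (4 * M - r / 8)]
  have h2 : Real.exp (M * r) ≤ Real.exp (16 * M ^ 2 + 1 / 2) * (2 * Real.sqrt J) := by
    calc Real.exp (M * r) ≤ Real.exp ((16 * M ^ 2 + 1 / 2) + Real.log (J + 1) / 2) :=
          Real.exp_le_exp.2 h1
      _ = Real.exp (16 * M ^ 2 + 1 / 2) * Real.sqrt (J + 1) := by
          rw [Real.exp_add, ← Real.log_sqrt (by linarith), Real.exp_log (by positivity)]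
      _ ≤ _ := by
          gcongr
          refine Real.sqrt_le_iff.2 ⟨by positivity, ?_⟩
          rw [mul_pow, Real.sq_sqrt hJ0.le]; linarith
  have hs : Real.sqrt J * Real.sqrt J = J := Real.mul_self_sqrt hJ0.le
  have hs0 : 0 < Real.sqrt J := Real.sqrt_pos.2 hJ0
  rw [div_le_div_iff₀ hJ0 hs0]
  calc Real.exp (M * r) * Real.sqrt J
      ≤ Real.exp (16 * M ^ 2 + 1 / 2) * (2 * Real.sqrt J) * Real.sqrt J := by gcongr
    _ = 2 * Real.exp (16 * M ^ 2 + 1 / 2) * (Real.sqrt J * Real.sqrt J) := by ring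
    _ = _ := by rw [hs]

/-- Stability: two solutions with the same low-frequency data stay close in `L²`. -/
theorem exists_stability {α : ℝ} (hα : α ∈ Set.Icc (1 : ℝ) 2) (T : ℝ) {A : ℝ} (hA : 1 ≤ A) :
    ∃ C : ℝ, 0 ≤ C ∧ ∀ J : ℕ, 1 ≤ J → ∀ a b : ℝ → (Fin 2 → ℤ) → ℂ,
      IsCoeffSol α T A J a → IsCoeffSol α T A J b → (∀ k ∈ box J, a 0 k = b 0 k) →
      ∀ t ∈ Set.Icc 0 T, ∑' k, ‖a t k - b t k‖ₑ ^ 2 ≤ ENNReal.ofReal (C / Real.sqrt J) := by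
  classical
  have hs : (2 : ℝ) ≤ 1 + α := by linarith [hα.1]
  set M : ℝ := 4 * A * T with hM
  refine ⟨1024 * A ^ 3 * (2 * Real.exp (16 * M ^ 2 + 1 / 2)) + 16 * A ^ 2, by positivity,
    fun J hJ a b ha hb h0 t ht => ?_⟩
  have hJ1 : (1 : ℝ) ≤ J := by exact_mod_cast hJ
  have hJ0 : (0 : ℝ) < J := by linarith
  have hl : 0 ≤ Real.log ((J : ℝ) + 1) := Real.log_nonneg (by linarith)
  set r := Real.sqrt (32 * (1 + Real.log (J + 1))) with hr
  have hr1 : 1 ≤ r := Real.one_le_sqrt.2 (by linarith)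
  have hrL : logSum J ^ (1 / 2 : ℝ) ≤ ENNReal.ofReal r := by
    refine le_of_sq_le_sq ?_
    rw [rpow_half_sq, ← ENNReal.ofReal_pow (by positivity), hr, Real.sq_sqrt (by positivity)]
    exact logSum_le J
  set y : ℝ → ℝ := fun τ => ∑ k ∈ box J, ‖a τ k - b τ k‖ ^ 2 with hy
  have hd4 : ∀ τ ∈ Set.Icc 0 T, hsn (1 + α) (fun k => ‖a τ k - b τ k‖ₑ) ≤ ENNReal.ofReal (4 * A) :=
    fun τ hτ => hsn_add_le (by linarith) (ha.bound τ hτ) (hb.bound τ hτ) fun k => enorm_sub_le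
  have hc4 : ∀ τ ∈ Set.Icc 0 T, hsn (1 + α) (fun k => ‖a τ k + b τ k‖ₑ) ≤ ENNReal.ofReal (4 * A) :=
    fun τ hτ => hsn_add_le (by linarith) (ha.bound τ hτ) (hb.bound τ hτ) fun k => enorm_add_le _ _
  have hye : ∀ τ, ∑ k ∈ box J, ‖a τ k - b τ k‖ₑ ^ 2 = ENNReal.ofReal (y τ) := by
    intro τ
    rw [hy, ENNReal.ofReal_sum_of_nonneg (fun k _ => sq_nonneg _)]
    refine Finset.sum_congr rfl fun k _ => ?_
    rw [← ofReal_norm, ENNReal.ofReal_pow (norm_nonneg _)]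
  have hy0 : ∀ τ, 0 ≤ y τ := fun τ => Finset.sum_nonneg fun k _ => sq_nonneg _
  have hbound : ∀ τ ∈ Set.Icc 0 T,
      ‖(Complex.I * tri (fun k _ => if k ∈ box J then (k 0 : ℝ) else 0) (fun k => a τ k - b τ k)
        (fun k => a τ k + b τ k) (fun k => a τ k - b τ k)).re‖ ≤
      r * (4 * A) * ‖y τ‖ + 1024 * A ^ 3 / J := by
    intro τ hτ
    rw [Real.norm_eq_abs, Real.norm_of_nonneg (hy0 τ)]
    refine (Complex.abs_re_le_norm _).trans ?_
    rw [norm_mul, Complex.norm_I, one_mul]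
    have h := enorm_transport_le hs hJ ENNReal.ofReal_ne_top (hc4 τ hτ) (hd4 τ hτ)
    rw [hye τ] at h
    have h' := h.trans (add_le_add_left (mul_le_mul_left (mul_le_mul_left hrL _) _) _)
    rw [← ofReal_norm, ← ENNReal.ofReal_mul (by positivity), ← ENNReal.ofReal_mul (by positivity),
      ← ENNReal.ofReal_pow (by positivity), ← ENNReal.ofReal_natCast J,
      ← ENNReal.ofReal_inv_of_pos hJ0, show (16 : ℝ≥0∞) = ENNReal.ofReal 16 by norm_num,
      ← ENNReal.ofReal_mul (by norm_num), ← ENNReal.ofReal_mul (by positivity),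
      ← ENNReal.ofReal_add (mul_nonneg (by positivity) (hy0 τ)) (by positivity),
      ENNReal.ofReal_le_ofReal_iff
        (add_nonneg (mul_nonneg (by positivity) (hy0 τ)) (by positivity))] at h'
    refine h'.trans (le_of_eq ?_)
    rw [div_eq_mul_inv]; ring
  -- The initial value is 0 because the low modes agree, so only the truncation error `16 (4A)³/J =
  -- 1024 A³/J` feeds the growth.
  have hgr := norm_le_gronwallBound_of_norm_deriv_right_le (f := y) (a := 0) (b := T) (δ := 0)
    (K := r * (4 * A)) (ε := 1024 * A ^ 3 / J)
    (fun τ hτ => (hasDeriv_sum_norm_sq_sub hα ha hb hτ).continuousWithinAt)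
    (fun τ hτ => (hasDeriv_sum_norm_sq_sub hα ha hb (Set.Ico_subset_Icc_self hτ)).mono_of_mem_nhdsWithin
      (Icc_mem_nhdsGE_of_mem hτ))
    (by
      rw [hy]
      simp only [norm_le_zero_iff]
      exact Finset.sum_eq_zero fun k hk => by rw [h0 k hk]; simp)
    (fun τ hτ => hbound τ (Set.Ico_subset_Icc_self hτ)) t ht
  have hK : 1 ≤ r * (4 * A) := by nlinarith
  rw [gronwallBound_of_K_ne_0 (by linarith), sub_zero, Real.norm_of_nonneg (hy0 t)] at hgr
  simp only [zero_mul, zero_add] at hgr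
  have hT0 : 0 ≤ T := ht.1.trans ht.2
  have hyt : y t ≤ 1024 * A ^ 3 * (2 * Real.exp (16 * M ^ 2 + 1 / 2)) / Real.sqrt J := by
    calc y t ≤ 1024 * A ^ 3 / J / (r * (4 * A)) * (Real.exp (r * (4 * A) * t) - 1) := hgr
      _ ≤ 1024 * A ^ 3 / J / 1 * Real.exp (M * r) := by
          have : r * (4 * A) * t ≤ M * r := by
            rw [hM]
            have := mul_le_mul_of_nonneg_left ht.2 (show 0 ≤ r * (4 * A) by positivity)
            linarith
          gcongr
          · exact sub_nonneg.2 (Real.one_le_exp (mul_nonneg (by positivity) ht.1))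
          · have := Real.exp_le_exp.2 this
            linarith
      _ = 1024 * A ^ 3 * (Real.exp (M * r) / J) := by ring
      _ ≤ 1024 * A ^ 3 * (2 * Real.exp (16 * M ^ 2 + 1 / 2) / Real.sqrt J) := by
          exact mul_le_mul_of_nonneg_left (exp_log_bound hJ) (by positivity)
      _ = _ := by ring
  have hsJ : Real.sqrt J ≤ (J : ℝ) ^ 2 := by
    refine Real.sqrt_le_iff.2 ⟨by positivity, ?_⟩
    nlinarith [pow_le_pow_left₀ zero_le_one hJ1 3]
  -- Modes in the box are controlled by Gronwall, the others by the `H^{1+α}` bound with a gain of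
  -- `J⁻²`.
  calc ∑' k, ‖a t k - b t k‖ₑ ^ 2
      ≤ ∑' k, ((if k ∈ box J then ‖a t k - b t k‖ₑ ^ 2 else 0) +
          (J : ℝ≥0∞)⁻¹ ^ 2 * (wt (1 + α) k * ‖a t k - b t k‖ₑ) ^ 2) := by
        refine ENNReal.tsum_le_tsum fun k => ?_
        by_cases hk : k ∈ box J
        · rw [if_pos hk]; exact le_self_add
        · rw [if_neg hk, zero_add, ← mul_pow, ← mul_assoc]
          gcongr
          exact le_mul_of_one_le_left zero_le (nrm_le_inv_mul_wt hs hJ hk).2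
    _ = ENNReal.ofReal (y t) +
          (J : ℝ≥0∞)⁻¹ ^ 2 * hsn (1 + α) (fun k => ‖a t k - b t k‖ₑ) ^ 2 := by
        rw [ENNReal.tsum_add, ENNReal.tsum_mul_left, hsn, l2n_sq,
          tsum_eq_sum (s := box J) (fun k hk => if_neg hk), ← hye t]
        congr 1
        exact Finset.sum_congr rfl fun k hk => if_pos hk
    _ ≤ ENNReal.ofReal (1024 * A ^ 3 * (2 * Real.exp (16 * M ^ 2 + 1 / 2)) / Real.sqrt J) +
          (J : ℝ≥0∞)⁻¹ ^ 2 * ENNReal.ofReal (4 * A) ^ 2 := by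
        gcongr
        exact hd4 t ht
    _ = ENNReal.ofReal (1024 * A ^ 3 * (2 * Real.exp (16 * M ^ 2 + 1 / 2)) / Real.sqrt J +
          ((J : ℝ)⁻¹) ^ 2 * (4 * A) ^ 2) := by
        rw [ENNReal.ofReal_add (by positivity) (by positivity),
          ENNReal.ofReal_mul (p := (J : ℝ)⁻¹ ^ 2) (by positivity),
          ENNReal.ofReal_pow (by positivity), ENNReal.ofReal_pow (by positivity),
          ENNReal.ofReal_inv_of_pos hJ0, ENNReal.ofReal_natCast]
    _ ≤ _ := by
        refine ENNReal.ofReal_le_ofReal ?_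
        rw [add_div]
        gcongr
        rw [inv_pow, inv_mul_eq_div, mul_pow, show (4 : ℝ) ^ 2 = 16 by norm_num]
        gcongr

end FZK
end

noncomputable section
namespace FZK
open scoped ENNReal

/-! ### Fourier analysis on the period cell, transported from the unit torus. -/

section Torus

attribute [local instance] instMeasureSpaceUnitAddCircle

/-- The torus `(ℝ/ℤ)²`. -/
abbrev Torus : Type := UnitAddTorus (Fin 2)

/-- Representatives in `(-1/2, 1/2]²` of the points of the torus, rescaled to the period cell. -/
def cellRep (x : Torus) : Plane :=
  (2 * Real.pi) • (UnitAddTorus.measurableEquivPiIoc (fun _ : Fin 2 => (-1 / 2 : ℝ)) x).1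

/-- The covering map of the torus. -/
def cover (x : Plane) : Torus := fun j => ((x j / (2 * Real.pi) : ℝ) : UnitAddCircle)

theorem cover_cellRep (x : Torus) : cover (cellRep x) = x := by
  ext j
  have hpi := Real.pi_ne_zero
  simp only [cover, cellRep, Pi.smul_apply, smul_eq_mul]
  rw [mul_div_cancel_left₀ _ (by positivity)]
  have h := (UnitAddTorus.measurableEquivPiIoc (fun _ : Fin 2 => (-1 / 2 : ℝ))).symm_apply_apply x
  exact congrFun h j

theorem measurable_cover : Measurable cover :=
  measurable_pi_lambda _ fun j => AddCircle.measurable_mk'.comp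
    ((measurable_pi_apply j).div_const _)

/-- Dilation by `2π` contributes the Jacobian `(2π)⁻²`; the half-open cell and the closed cell `Ω`
differ by null faces. -/
theorem measurePreserving_cellRep :
    MeasurePreserving cellRep volume
      (ENNReal.ofReal (((2 * Real.pi) ^ 2)⁻¹) • (volume.restrict Ω)) := by
  have hpi := Real.pi_pos
  set S : Set Plane := {x | ∀ i, x i ∈ Set.Ioc (-1 / 2 : ℝ) (-1 / 2 + 1)} with hS
  have hSm : MeasurableSet S := MeasurableSet.univ_pi' fun i => measurableSet_Ioc
  have h1 := UnitAddTorus.measurePreserving_equivPiIoc (fun _ : Fin 2 => (-1 / 2 : ℝ))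
  have h2 : MeasurePreserving (Subtype.val : S → Plane) (Measure.comap Subtype.val volume)
      (volume.restrict S) := measurePreserving_subtype_coe hSm
  have h3 : MeasurePreserving (fun x : Plane => (2 * Real.pi) • x) (volume.restrict S)
      (ENNReal.ofReal (((2 * Real.pi) ^ 2)⁻¹) • (volume.restrict Ω)) := by
    refine ⟨measurable_const_smul _, ?_⟩
    let e : Plane ≃ᵐ Plane := (Homeomorph.smulOfNeZero (2 * Real.pi)
      (by positivity)).toMeasurableEquiv
    have hpre : S = e ⁻¹' (Set.univ.pi fun _ => Set.Ioc (-Real.pi) Real.pi) := by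
      ext x
      simp only [hS, Set.mem_ofPred_eq, Set.mem_preimage, Set.mem_univ_pi]
      refine forall_congr' fun i => ?_
      change _ ↔ (2 * Real.pi) * x i ∈ _
      simp only [Set.mem_Ioc]
      constructor
      · rintro ⟨a, b⟩; constructor <;> nlinarith
      · rintro ⟨a, b⟩; constructor <;> nlinarith
    have hmap : Measure.map e (volume : Measure Plane)
        = ENNReal.ofReal (((2 * Real.pi) ^ 2)⁻¹) • (volume : Measure Plane) := by
      have := Measure.map_addHaar_smul (volume : Measure Plane) (r := 2 * Real.pi) (by positivity)
      rw [Module.finrank_fin_fun, abs_of_pos (by positivity)] at this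
      exact this
    calc Measure.map (fun x : Plane => (2 * Real.pi) • x) (volume.restrict S)
        = Measure.map e (volume.restrict S) := rfl
      _ = (Measure.map e volume).restrict (Set.univ.pi fun _ => Set.Ioc (-Real.pi) Real.pi) := by
          rw [e.restrict_map, hpre]
      _ = _ := by
          rw [hmap, Measure.restrict_smul]
          congr 1
          refine Measure.restrict_congr_set ?_
          exact Measure.univ_pi_Ioc_ae_eq_Icc
  exact h3.comp (h2.comp h1)

theorem memLp_comp_cellRep {E : Type*} [NormedAddCommGroup E] {f : Plane → E}
    (hf : MemLp f 2 (volume.restrict Ω)) : MemLp (f ∘ cellRep) 2 volume :=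
  (hf.smul_measure ENNReal.ofReal_ne_top).comp_measurePreserving measurePreserving_cellRep

theorem integral_comp_cellRep {f : Plane → ℂ} (hf : AEStronglyMeasurable f (volume.restrict Ω)) :
    ∫ x : Torus, f (cellRep x) = ((2 * (Real.pi : ℂ)) ^ 2)⁻¹ * ∫ x in Ω, f x := by
  have h := measurePreserving_cellRep
  have h1 : ∫ x : Torus, f (cellRep x) = ∫ y, f y ∂(Measure.map cellRep volume) := by
    refine (integral_map h.measurable.aemeasurable ?_).symm
    rw [h.map_eq]; exact hf.smul_measure _
  rw [h1, h.map_eq, integral_smul_measure, ENNReal.toReal_ofReal (by positivity),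
    Complex.real_smul]
  push_cast
  rfl

theorem mFourier_cover (k : Fin 2 → ℤ) (x : Plane) :
    UnitAddTorus.mFourier k (cover x) = expMode k x := by
  have hpi : (Real.pi : ℂ) ≠ 0 := by exact_mod_cast Real.pi_ne_zero
  simp only [UnitAddTorus.mFourier, ContinuousMap.coe_mk, Fin.prod_univ_two, cover, expMode]
  rw [fourier_coe_apply, fourier_coe_apply, ← Complex.exp_add]
  congr 1
  push_cast
  field_simp

theorem mFourier_eq (k : Fin 2 → ℤ) (x : Torus) :
    UnitAddTorus.mFourier k x = expMode k (cellRep x) := by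
  rw [← mFourier_cover, cover_cellRep]

theorem continuous_expMode (k : Fin 2 → ℤ) : Continuous (expMode k) := by
  unfold expMode; fun_prop

theorem mFourierCoeff_comp_cellRep {f : Plane → ℂ} (hf : MemLp f 2 (volume.restrict Ω))
    (k : Fin 2 → ℤ) : UnitAddTorus.mFourierCoeff (f ∘ cellRep) k = coeff f k := by
  rw [UnitAddTorus.mFourierCoeff, coeff, ip, ← integral_comp_cellRep
    (f := fun x => f x * (starRingEnd ℂ) (expMode k x)) (hf.1.mul ((Complex.continuous_conj.comp (continuous_expMode k)).aestronglyMeasurable))]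
  congr 1; ext x
  rw [UnitAddTorus.mFourier_neg, mFourier_eq, smul_eq_mul, Function.comp, mul_comm]

/-- Parseval's identity on the period cell. -/
theorem hasSum_coeff_mul_conj {f g : Plane → ℂ} (hf : MemLp f 2 (volume.restrict Ω))
    (hg : MemLp g 2 (volume.restrict Ω)) :
    HasSum (fun k => coeff f k * (starRingEnd ℂ) (coeff g k))
      (((2 * (Real.pi : ℂ)) ^ 2)⁻¹ * ip f g) := by
  have hF := memLp_comp_cellRep hf
  have hG := memLp_comp_cellRep hg
  have h := UnitAddTorus.hasSum_prod_mFourierCoeff (hG.toLp _) (hF.toLp _)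
  have cf : ∀ k, UnitAddTorus.mFourierCoeff (hF.toLp _) k = coeff f k := by
    intro k
    rw [← mFourierCoeff_comp_cellRep hf]
    refine integral_congr_ae ?_
    filter_upwards [hF.coeFn_toLp] with x hx
    rw [hx]
  have cg : ∀ k, UnitAddTorus.mFourierCoeff (hG.toLp _) k = coeff g k := by
    intro k
    rw [← mFourierCoeff_comp_cellRep hg]
    refine integral_congr_ae ?_
    filter_upwards [hG.coeFn_toLp] with x hx
    rw [hx]
  have hi : ∫ t, (starRingEnd ℂ) ((hG.toLp _ : Torus → ℂ) t) * (hF.toLp _ : Torus → ℂ) t =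
      ((2 * (Real.pi : ℂ)) ^ 2)⁻¹ * ip f g := by
    rw [ip, ← integral_comp_cellRep (f := fun x => f x * (starRingEnd ℂ) (g x))
      (hf.1.mul (Complex.continuous_conj.comp_aestronglyMeasurable hg.1))]
    refine integral_congr_ae ?_
    filter_upwards [hG.coeFn_toLp, hF.coeFn_toLp] with x hx hy
    rw [hx, hy, Function.comp, Function.comp, mul_comm]
  rw [hi] at h
  simpa only [cf, cg, mul_comm] using h

/-- Every square-summable family is the family of Fourier coefficients of an `L²` function. -/
theorem exists_memLp_coeff_eq {c : (Fin 2 → ℤ) → ℂ} (hc : Summable fun k => ‖c k‖ ^ 2) :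
    ∃ f : Plane → ℂ, MemLp f 2 (volume.restrict Ω) ∧ ∀ k, coeff f k = c k := by
  have hpi := Real.pi_pos
  have hmem : Memℓp c 2 := memℓp_gen (by simpa using hc)
  let F := (UnitAddTorus.mFourierBasis (d := Fin 2)).repr.symm ⟨c, hmem⟩
  have hFm : MemLp (F : Torus → ℂ) 2 volume := Lp.memLp F
  have hF : ∀ k, UnitAddTorus.mFourierCoeff F k = c k := by
    intro k
    rw [← UnitAddTorus.mFourierBasis_repr]
    simp only [F, LinearIsometryEquiv.apply_symm_apply]
  -- A strongly measurable representative is taken so that its composition with `cover` is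
  -- measurable on the plane.
  obtain ⟨G, hGm, hGF⟩ := hFm.1
  have hmem2 : MemLp (G ∘ cover) 2 (volume.restrict Ω) := by
    have h1 : MemLp (G ∘ cover) 2
        (ENNReal.ofReal (((2 * Real.pi) ^ 2)⁻¹) • (volume.restrict Ω)) := by
      rw [← measurePreserving_cellRep.map_eq, memLp_map_measure_iff
        (hGm.comp_measurable measurable_cover).aestronglyMeasurable
        measurePreserving_cellRep.measurable.aemeasurable]
      refine (memLp_congr_ae ?_).1 hFm
      filter_upwards [hGF] with x hx
      rw [hx, Function.comp, Function.comp, cover_cellRep]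
    refine h1.of_measure_le_smul (c := ENNReal.ofReal ((2 * Real.pi) ^ 2)) ENNReal.ofReal_ne_top ?_
    rw [smul_smul, ← ENNReal.ofReal_mul (by positivity), mul_inv_cancel₀ (by positivity),
      ENNReal.ofReal_one, one_smul]
  refine ⟨G ∘ cover, hmem2, fun k => ?_⟩
  rw [← mFourierCoeff_comp_cellRep hmem2, ← hF k]
  refine integral_congr_ae ?_
  filter_upwards [hGF] with x hx
  rw [hx, Function.comp, Function.comp, cover_cellRep]

theorem coeff_expMode (l k : Fin 2 → ℤ) : coeff (expMode l) k = if k = l then 1 else 0 := by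
  have h := orthonormal_iff_ite.1 (UnitAddTorus.orthonormal_mFourier (d := Fin 2)) k l
  rw [← h, ContinuousMap.inner_toLp, coeff, ip,
    ← integral_comp_cellRep (f := fun x => expMode l x * (starRingEnd ℂ) (expMode k x))
      ((continuous_expMode l).mul (Complex.continuous_conj.comp
        (continuous_expMode k))).aestronglyMeasurable]
  congr 1; ext x
  rw [mFourier_eq, mFourier_eq, mul_comm]

end Torus

/-! ### Fourier coefficients of real-valued `L²` functions. -/

section Coefficients

theorem coeff_congr {f g : Plane → ℂ} (h : f =ᵐ[volume.restrict Ω] g) : coeff f = coeff g := by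
  ext k
  rw [coeff, coeff, ip, ip]
  congr 1
  refine integral_congr_ae ?_
  filter_upwards [h] with x hx
  rw [hx]

theorem ip_expMode (f : Plane → ℂ) (k : Fin 2 → ℤ) :
    ip f (expMode k) = (2 * (Real.pi : ℂ)) ^ 2 * coeff f k := by
  have hpi : (Real.pi : ℂ) ≠ 0 := by exact_mod_cast Real.pi_ne_zero
  rw [coeff, ← mul_assoc, mul_inv_cancel₀ (pow_ne_zero 2 (mul_ne_zero two_ne_zero hpi)), one_mul]

theorem norm_expMode (k : Fin 2 → ℤ) (x : Plane) : ‖expMode k x‖ = 1 := by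
  unfold expMode
  rw [mul_comm, show ((k 0 : ℂ) * (x 0 : ℂ) + (k 1 : ℂ) * (x 1 : ℂ))
    = (((k 0 : ℝ) * x 0 + (k 1 : ℝ) * x 1 : ℝ) : ℂ) by push_cast; rfl]
  exact Complex.norm_exp_ofReal_mul_I _

theorem conj_expMode (k : Fin 2 → ℤ) (x : Plane) :
    (starRingEnd ℂ) (expMode k x) = expMode (-k) x := by
  unfold expMode
  rw [← Complex.exp_conj]
  congr 1
  simp [Complex.conj_ofReal]
  ring

theorem expMode_add (k l : Fin 2 → ℤ) (x : Plane) :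
    expMode (k + l) x = expMode k x * expMode l x := by
  unfold expMode
  rw [← Complex.exp_add]
  congr 1
  simp only [Pi.add_apply]; push_cast; ring

theorem measure_cell_lt_top : volume Ω < ∞ := by
  unfold Ω; exact (isCompact_Icc).measure_lt_top

theorem isFiniteMeasure_cell : IsFiniteMeasure (volume.restrict Ω) :=
  ⟨by rw [Measure.restrict_apply_univ]; exact measure_cell_lt_top⟩

attribute [local instance] isFiniteMeasure_cell

theorem memLp_expMode (k : Fin 2 → ℤ) : MemLp (expMode k) 2 (volume.restrict Ω) :=
  MemLp.of_bound (continuous_expMode k).aestronglyMeasurable 1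
    (ae_of_all _ fun x => (norm_expMode k x).le)

theorem _root_.MeasureTheory.MemLp.conj_cell {f : Plane → ℂ} (hf : MemLp f 2 (volume.restrict Ω)) :
    MemLp (fun x => (starRingEnd ℂ) (f x)) 2 (volume.restrict Ω) :=
  hf.star

theorem integrable_mul_conj {f g : Plane → ℂ} (hf : MemLp f 2 (volume.restrict Ω))
    (hg : MemLp g 2 (volume.restrict Ω)) :
    Integrable (fun x => f x * (starRingEnd ℂ) (g x)) (volume.restrict Ω) :=
  hf.integrable_mul hg.conj_cell

theorem memLp_toC (u : L2) : MemLp (toC u) 2 (volume.restrict Ω) := (Lp.memLp u).ofReal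

theorem conj_toC (u : L2) (x : Plane) : (starRingEnd ℂ) (toC u x) = toC u x :=
  Complex.conj_ofReal _

theorem coeff_conj (f : Plane → ℂ) (k : Fin 2 → ℤ) :
    coeff (fun x => (starRingEnd ℂ) (f x)) k = (starRingEnd ℂ) (coeff f (-k)) := by
  rw [coeff, coeff, ip, ip, map_mul, ← integral_conj]
  congr 1
  · simp [Complex.conj_ofReal, Complex.conj_ofNat]
  · congr 1; ext x
    rw [map_mul, Complex.conj_conj, conj_expMode]

theorem coeff_toC_neg (u : L2) (k : Fin 2 → ℤ) :
    coeff (toC u) (-k) = (starRingEnd ℂ) (coeff (toC u) k) := by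
  have h := coeff_conj (toC u) (-k)
  rw [neg_neg] at h
  rw [← h]
  congr 1; ext x; rw [conj_toC]

theorem coeff_add {f g : Plane → ℂ} (hf : MemLp f 2 (volume.restrict Ω))
    (hg : MemLp g 2 (volume.restrict Ω)) (k : Fin 2 → ℤ) :
    coeff (fun x => f x + g x) k = coeff f k + coeff g k := by
  rw [coeff, coeff, coeff, ip, ip, ip, ← mul_add, ← integral_add
    (integrable_mul_conj hf (memLp_expMode k)) (integrable_mul_conj hg (memLp_expMode k))]
  congr 2; ext x; ring

theorem coeff_const_mul (c : ℂ) (f : Plane → ℂ) (k : Fin 2 → ℤ) :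
    coeff (fun x => c * f x) k = c * coeff f k := by
  rw [coeff, coeff, ip, ip, mul_left_comm c]
  simp_rw [mul_assoc, integral_const_mul]

theorem coeff_finset_sum {ι : Type*} (s : Finset ι) {f : ι → Plane → ℂ}
    (hf : ∀ i, MemLp (f i) 2 (volume.restrict Ω)) (k : Fin 2 → ℤ) :
    coeff (fun x => ∑ i ∈ s, f i x) k = ∑ i ∈ s, coeff (f i) k := by
  classical
  induction s using Finset.induction_on with
  | empty => simp [coeff, ip]
  | insert i s hi ih =>
    simp only [Finset.sum_insert hi]
    rw [coeff_add (hf i) (memLp_finsetSum s fun i _ => hf i), ih]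

theorem norm_sq_eq_ip (u : L2) : ((‖u‖ ^ 2 : ℝ) : ℂ) = ip (toC u) (toC u) := by
  rw [← real_inner_self_eq_norm_sq, L2.inner_def, ip]
  refine integral_complex_ofReal.symm.trans ?_
  congr 1; ext x
  rw [conj_toC, toC]
  simp [sq]

/-- Parseval's identity for the norm of a real-valued function. -/
theorem hasSum_norm_coeff_sq (u : L2) :
    HasSum (fun k => ‖coeff (toC u) k‖ ^ 2) (((2 * Real.pi) ^ 2)⁻¹ * ‖u‖ ^ 2) := by
  have h := hasSum_coeff_mul_conj (memLp_toC u) (memLp_toC u)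
  rw [← norm_sq_eq_ip] at h
  rw [← Complex.hasSum_ofReal]
  convert h using 1
  · ext k
    rw [Complex.mul_conj, Complex.normSq_eq_norm_sq]
  · push_cast; rfl

theorem tsum_enorm_coeff_sq (u : L2) :
    ∑' k, ‖coeff (toC u) k‖ₑ ^ 2 = ENNReal.ofReal (((2 * Real.pi) ^ 2)⁻¹ * ‖u‖ ^ 2) := by
  rw [← (hasSum_norm_coeff_sq u).tsum_eq,
    ENNReal.ofReal_tsum_of_nonneg (fun k => sq_nonneg _) (hasSum_norm_coeff_sq u).summable]
  congr 1; ext k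
  rw [← ofReal_norm, ENNReal.ofReal_pow (norm_nonneg _)]

theorem l2n_coeff_ne_top (u : L2) : l2n (fun k => ‖coeff (toC u) k‖ₑ) ≠ ∞ := by
  unfold l2n
  rw [tsum_enorm_coeff_sq]
  exact ENNReal.rpow_ne_top_of_nonneg (by norm_num) ENNReal.ofReal_ne_top

theorem norm_coeff_le (u : L2) (k : Fin 2 → ℤ) : ‖coeff (toC u) k‖ ≤ ‖u‖ := by
  have h := le_hasSum (hasSum_norm_coeff_sq u) k (fun j _ => sq_nonneg _)
  refine le_of_abs_le (abs_le_of_sq_le_sq (h.trans ?_) (norm_nonneg _))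
  refine mul_le_of_le_one_left (sq_nonneg _) (inv_le_one_of_one_le₀ ?_)
  nlinarith [Real.pi_gt_three]

/-- The Fourier coefficient as a continuous functional. -/
def coeffCLM (k : Fin 2 → ℤ) : L2 →L[ℝ] ℂ :=
  LinearMap.mkContinuous
    { toFun := fun u => coeff (toC u) k
      map_add' := fun u v => by
        rw [← coeff_add (memLp_toC u) (memLp_toC v)]
        refine congrFun (coeff_congr ?_) k
        filter_upwards [Lp.coeFn_add u v] with x hx
        rw [toC, toC, toC, hx, Pi.add_apply]; push_cast; rfl
      map_smul' := fun r u => by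
        simp only [RingHom.id_apply]
        rw [Complex.real_smul, ← coeff_const_mul]
        refine congrFun (coeff_congr ?_) k
        filter_upwards [Lp.coeFn_smul r u] with x hx
        rw [toC, toC, hx, Pi.smul_apply]; simp }
    1 fun u => by rw [one_mul]; exact norm_coeff_le u k

theorem coeffCLM_apply (k : Fin 2 → ℤ) (u : L2) : coeffCLM k u = coeff (toC u) k := rfl

theorem coeff_toC_sub (u v : L2) (k : Fin 2 → ℤ) :
    coeff (toC (u - v)) k = coeff (toC u) k - coeff (toC v) k := by
  simp only [← coeffCLM_apply, map_sub]

/-- The distance in `L²` in terms of Fourier coefficients. -/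
theorem ofReal_norm_sub_sq (u v : L2) :
    ENNReal.ofReal (((2 * Real.pi) ^ 2)⁻¹ * ‖u - v‖ ^ 2) =
      ∑' k, ‖coeff (toC u) k - coeff (toC v) k‖ₑ ^ 2 := by
  rw [← tsum_enorm_coeff_sq]
  simp_rw [coeff_toC_sub]

theorem eq_of_coeff_eq {u v : L2} (h : ∀ k, coeff (toC u) k = coeff (toC v) k) : u = v := by
  have h1 := ofReal_norm_sub_sq u v
  simp only [h, sub_self, enorm_zero, ne_eq, OfNat.ofNat_ne_zero, not_false_eq_true, zero_pow,
    tsum_zero, ENNReal.ofReal_eq_zero] at h1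
  have hpi := Real.pi_pos
  have h2 : ‖u - v‖ ^ 2 ≤ 0 := by
    by_contra! hc
    have : 0 < ((2 * Real.pi) ^ 2)⁻¹ * ‖u - v‖ ^ 2 := by positivity
    linarith
  have h3 : ‖u - v‖ = 0 := by nlinarith [norm_nonneg (u - v)]
  exact sub_eq_zero.1 (norm_eq_zero.1 h3)

/-- Fourier coefficients determine square-integrable functions. -/
theorem ae_eq_of_coeff_eq {f g : Plane → ℂ} (hf : MemLp f 2 (volume.restrict Ω))
    (hg : MemLp g 2 (volume.restrict Ω)) (h : ∀ k, coeff f k = coeff g k) :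
    f =ᵐ[volume.restrict Ω] g := by
  have hpi : (Real.pi : ℂ) ≠ 0 := by exact_mod_cast Real.pi_ne_zero
  have hd : MemLp (fun x => f x + (-1) * g x) 2 (volume.restrict Ω) := hf.add (hg.const_mul _)
  have hz : ∀ k, coeff (fun x => f x + (-1) * g x) k = 0 := by
    intro k
    rw [coeff_add hf (hg.const_mul _), coeff_const_mul, h k]; ring
  have hs := (hasSum_coeff_mul_conj hd hd).tsum_eq
  simp only [hz, zero_mul, tsum_zero] at hs
  have h0 : ip (fun x => f x + (-1) * g x) (fun x => f x + (-1) * g x) = 0 := by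
    rcases mul_eq_zero.1 hs.symm with h1 | h1
    · exact absurd h1 (by simp [hpi])
    · exact h1
  have h1 : ∫ x in Ω, ‖f x + (-1) * g x‖ ^ 2 = 0 := by
    have : ((∫ x in Ω, ‖f x + (-1) * g x‖ ^ 2 : ℝ) : ℂ) = 0 := by
      rw [← h0, ip]
      refine integral_complex_ofReal.symm.trans ?_
      congr 1; ext x
      rw [Complex.mul_conj, Complex.normSq_eq_norm_sq]
    exact_mod_cast this
  rw [integral_eq_zero_iff_of_nonneg (fun x => sq_nonneg _) hd.integrable_norm_pow'] at h1
  filter_upwards [h1] with x hx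
  have : f x + (-1) * g x = 0 := by simpa using hx
  linear_combination this

/-- Every conjugation-symmetric square-summable family belongs to a real-valued function. -/
theorem exists_coeff_toC_eq {c : (Fin 2 → ℤ) → ℂ} (hc : Summable fun k => ‖c k‖ ^ 2)
    (hr : ∀ k, c (-k) = (starRingEnd ℂ) (c k)) : ∃ u : L2, ∀ k, coeff (toC u) k = c k := by
  obtain ⟨f, hf, hfc⟩ := exists_memLp_coeff_eq hc
  -- The symmetry of `c` gives `f` and its conjugate the same coefficients, so taking the real part
  -- changes nothing.
  have hreal : (fun x => (starRingEnd ℂ) (f x)) =ᵐ[volume.restrict Ω] f := by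
    refine ae_eq_of_coeff_eq hf.conj_cell hf fun k => ?_
    rw [coeff_conj, hfc, hfc, hr, Complex.conj_conj]
  refine ⟨hf.re.toLp _, fun k => ?_⟩
  rw [← hfc k]
  refine congrFun (coeff_congr ?_) k
  filter_upwards [hf.re.coeFn_toLp, hreal] with x hx hx2
  rw [toC, hx]
  exact Complex.conj_eq_iff_re.1 hx2

/-- The Fourier coefficients of a product are given by convolution. -/
theorem coeff_mul {f g : Plane → ℂ} (hf : MemLp f 2 (volume.restrict Ω))
    (hg : MemLp g 2 (volume.restrict Ω)) (k : Fin 2 → ℤ) :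
    coeff (fun x => f x * g x) k = conv (coeff f) (coeff g) k := by
  -- Parseval's identity is applied to `f` and `e_k` times the conjugate of `g`; the conjugated
  -- coefficients of the latter are those of `g` at `k - l`.
  have hh : MemLp (fun x => expMode k x * (starRingEnd ℂ) (g x)) 2 (volume.restrict Ω) := by
    have h1 := hg.conj_cell
    refine h1.of_le ((continuous_expMode k).aestronglyMeasurable.mul h1.1)
      (ae_of_all _ fun x => ?_)
    rw [norm_mul, norm_expMode, one_mul]
  have h := (hasSum_coeff_mul_conj hf hh).tsum_eq
  have hl : ∀ l, (starRingEnd ℂ) (coeff (fun x => expMode k x * (starRingEnd ℂ) (g x)) l)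
      = coeff g (k - l) := by
    intro l
    rw [coeff, coeff, ip, ip, map_mul, ← integral_conj]
    congr 1
    · simp [Complex.conj_ofReal, Complex.conj_ofNat]
    · congr 1; ext x
      rw [map_mul, map_mul, Complex.conj_conj, Complex.conj_conj, conj_expMode, conj_expMode,
        show -(k - l) = -k + l by abel, expMode_add]
      ring
  simp only [hl] at h
  rw [conv, h, coeff, ip, ip]
  congr 2; ext x
  rw [map_mul, Complex.conj_conj]; ring

theorem coeff_sq (u : L2) (k : Fin 2 → ℤ) :
    coeff (fun x => toC u x ^ 2) k = conv (coeff (toC u)) (coeff (toC u)) k := by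
  rw [← coeff_mul (memLp_toC u) (memLp_toC u)]
  congr 1; ext x; ring

end Coefficients

end FZK
end

noncomputable section
namespace FZK
open scoped ENNReal

attribute [local instance] isFiniteMeasure_cell

/-! ### Absolutely convergent trigonometric series. -/

section Series

variable {c : (Fin 2 → ℤ) → ℂ}

theorem norm_mul_expMode (z : ℂ) (k : Fin 2 → ℤ) (x : Plane) : ‖z * expMode k x‖ = ‖z‖ := by
  rw [norm_mul, norm_expMode, mul_one]

theorem norm_series_le (hc : Summable fun k => ‖c k‖) (x : Plane) :
    ‖∑' k, c k * expMode k x‖ ≤ ∑' k, ‖c k‖ := by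
  refine (norm_tsum_le_tsum_norm ?_).trans (le_of_eq ?_)
  · simpa only [norm_mul_expMode] using hc
  · simp only [norm_mul_expMode]

theorem continuous_series (hc : Summable fun k => ‖c k‖) :
    Continuous fun x => ∑' k, c k * expMode k x :=
  continuous_tsum (fun k => continuous_const.mul (continuous_expMode k)) hc
    fun _ _ => (norm_mul_expMode _ _ _).le

theorem memLp_series (hc : Summable fun k => ‖c k‖) :
    MemLp (fun x => ∑' k, c k * expMode k x) 2 (volume.restrict Ω) :=
  MemLp.of_bound (continuous_series hc).aestronglyMeasurable _
    (ae_of_all _ fun x => norm_series_le hc x)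

/-- The Fourier coefficients of an absolutely convergent trigonometric series. -/
theorem coeff_series (hc : Summable fun k => ‖c k‖) (k : Fin 2 → ℤ) :
    coeff (fun x => ∑' l, c l * expMode l x) k = c k := by
  have hF : ∀ l, Integrable (fun x => c l * expMode l x * (starRingEnd ℂ) (expMode k x))
      (volume.restrict Ω) := fun l =>
    integrable_mul_conj ((memLp_expMode l).const_mul _) (memLp_expMode k)
  have hn : ∀ l, ∫ x in Ω, ‖c l * expMode l x * (starRingEnd ℂ) (expMode k x)‖ =
      (volume.restrict Ω).real Set.univ * ‖c l‖ := by
    intro l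
    simp only [norm_mul, norm_expMode, RCLike.norm_conj, mul_one, integral_const, smul_eq_mul]
  have hs := hasSum_integral_of_summable_integral_norm hF (by
    simp_rw [hn]; exact hc.mul_left _)
  rw [coeff, ip]
  simp_rw [← tsum_mul_right]
  rw [← hs.tsum_eq, ← tsum_mul_left]
  have e : ∀ l, ((2 * (Real.pi : ℂ)) ^ 2)⁻¹ *
      ∫ x in Ω, c l * expMode l x * (starRingEnd ℂ) (expMode k x) =
        c l * (if k = l then 1 else 0) := by
    intro l
    rw [← coeff_expMode, ← coeff_const_mul]
    rfl
  simp_rw [e]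
  rw [tsum_eq_single k fun l hl => by rw [if_neg hl.symm, mul_zero]]
  simp

/-- A function with absolutely summable Fourier coefficients is the sum of its Fourier series. -/
theorem toC_ae_eq_series (u : L2) (hc : Summable fun k => ‖coeff (toC u) k‖) :
    toC u =ᵐ[volume.restrict Ω] fun x => ∑' k, coeff (toC u) k * expMode k x :=
  ae_eq_of_coeff_eq (memLp_toC u) (memLp_series hc) fun k => (coeff_series hc k).symm

theorem fracLap_eq_series (s : ℝ) (f : Plane → ℂ) :
    fracLap s f = fun x => ∑' k, (((absPow s k : ℝ) : ℂ) * coeff f k) * expMode k x := rfl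

end Series

/-! ### Trigonometric polynomials and the Galerkin scheme in coefficients. -/

section TrigPoly

theorem mem_trigPoly {N : ℕ} {v : Plane → ℂ} :
    v ∈ trigPoly N ↔ ∃ c : (Fin 2 → ℤ) → ℂ, v = fun x => ∑ k ∈ box N, c k * expMode k x := by
  have hset : {f | ∃ k : Fin 2 → ℤ, (∀ j, |k j| ≤ (N : ℤ)) ∧ f = expMode k} =
      expMode '' (box N : Set (Fin 2 → ℤ)) := by
    ext f
    simp only [Set.mem_ofPred_eq, Set.mem_image, Finset.mem_coe, mem_box]
    exact ⟨fun ⟨k, h, e⟩ => ⟨k, h, e.symm⟩, fun ⟨k, h, e⟩ => ⟨k, h, e.symm⟩⟩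
  rw [trigPoly, hset]
  constructor
  · intro h
    rw [Submodule.mem_span_image_finset_iff_exists_fun] at h
    obtain ⟨c, rfl⟩ := h
    refine ⟨fun k => if hk : k ∈ box N then c ⟨k, hk⟩ else 0, ?_⟩
    ext x
    rw [← Finset.sum_attach (box N)]
    simp [Finset.univ_eq_attach]
  · rintro ⟨c, rfl⟩
    have e : (fun x => ∑ k ∈ box N, c k * expMode k x) = ∑ k ∈ box N, c k • expMode k := by
      ext x; simp
    rw [e]
    exact Submodule.sum_mem _ fun k hk => Submodule.smul_mem _ _
      (Submodule.subset_span ⟨k, hk, rfl⟩)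

theorem expMode_mem_trigPoly {N : ℕ} {k : Fin 2 → ℤ} (hk : k ∈ box N) : expMode k ∈ trigPoly N :=
  Submodule.subset_span ⟨k, mem_box.1 hk, rfl⟩

theorem hasFDerivAt_expMode (k : Fin 2 → ℤ) (x : Plane) :
    ∃ L : Plane →L[ℝ] ℂ, HasFDerivAt (expMode k) L x ∧
      L (Pi.single 0 1) = Complex.I * (k 0 : ℂ) * expMode k x := by
  have h0 : HasFDerivAt (fun x : Plane => ((x 0 : ℝ) : ℂ))
      (Complex.ofRealCLM.comp (ContinuousLinearMap.proj (R := ℝ) (φ := fun _ : Fin 2 => ℝ) 0)) x :=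
    (Complex.ofRealCLM.comp
      (ContinuousLinearMap.proj (R := ℝ) (φ := fun _ : Fin 2 => ℝ) 0)).hasFDerivAt
  have h1 : HasFDerivAt (fun x : Plane => ((x 1 : ℝ) : ℂ))
      (Complex.ofRealCLM.comp (ContinuousLinearMap.proj (R := ℝ) (φ := fun _ : Fin 2 => ℝ) 1)) x :=
    (Complex.ofRealCLM.comp
      (ContinuousLinearMap.proj (R := ℝ) (φ := fun _ : Fin 2 => ℝ) 1)).hasFDerivAt
  refine ⟨_, (((h0.const_mul (k 0 : ℂ)).add (h1.const_mul (k 1 : ℂ))).const_mul Complex.I).cexp, ?_⟩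
  simp [expMode]
  ring

theorem pderiv_sum (s : Finset (Fin 2 → ℤ)) (c : (Fin 2 → ℤ) → ℂ) :
    pderiv (fun x => ∑ k ∈ s, c k * expMode k x) =
      fun x => ∑ k ∈ s, (c k * (Complex.I * (k 0 : ℂ))) * expMode k x := by
  ext x
  choose L hL hL1 using fun k => hasFDerivAt_expMode k x
  have h : HasFDerivAt (fun x => ∑ k ∈ s, c k * expMode k x) (∑ k ∈ s, c k • L k) x :=
    HasFDerivAt.fun_sum fun k _ => (hL k).const_mul (c k)
  rw [pderiv, h.fderiv]
  simp only [sum_apply, smul_apply, smul_eq_mul, hL1]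
  exact Finset.sum_congr rfl fun k _ => by ring

theorem ip_sum_expMode {f : Plane → ℂ} (hf : Integrable f (volume.restrict Ω))
    (s : Finset (Fin 2 → ℤ)) (c : (Fin 2 → ℤ) → ℂ) :
    ip f (fun x => ∑ k ∈ s, c k * expMode k x) =
      (2 * (Real.pi : ℂ)) ^ 2 * ∑ k ∈ s, (starRingEnd ℂ) (c k) * coeff f k := by
  have hi : ∀ k, Integrable (fun x => f x * (starRingEnd ℂ) (expMode k x)) (volume.restrict Ω) := by
    intro k
    refine hf.mul_bdd (c := 1) ?_ (ae_of_all _ fun x => ?_)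
    · exact (Complex.continuous_conj.comp (continuous_expMode k)).aestronglyMeasurable
    · rw [RCLike.norm_conj, norm_expMode]
  have e : ∀ x, f x * (starRingEnd ℂ) (∑ k ∈ s, c k * expMode k x) =
      ∑ k ∈ s, (starRingEnd ℂ) (c k) * (f x * (starRingEnd ℂ) (expMode k x)) := by
    intro x
    rw [map_sum, Finset.mul_sum]
    exact Finset.sum_congr rfl fun k _ => by rw [map_mul]; ring
  rw [ip]
  simp_rw [e]
  rw [integral_finsetSum _ fun k _ => (hi k).const_mul _, Finset.mul_sum]
  refine Finset.sum_congr rfl fun k _ => ?_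
  rw [integral_const_mul, mul_left_comm, ← ip_expMode]
  rfl

theorem coeff_of_mem_trigPoly {N : ℕ} {v : Plane → ℂ} (hv : v ∈ trigPoly N) {k : Fin 2 → ℤ}
    (hk : k ∉ box N) : coeff v k = 0 := by
  obtain ⟨c, rfl⟩ := mem_trigPoly.1 hv
  rw [coeff_finset_sum _ fun l => (memLp_expMode l).const_mul _]
  refine Finset.sum_eq_zero fun l hl => ?_
  rw [coeff_const_mul, coeff_expMode, if_neg (by rintro rfl; exact hk hl), mul_zero]

theorem summable_of_supp {N : ℕ} {c : (Fin 2 → ℤ) → ℂ} (hc : ∀ k ∉ box N, c k = 0) :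
    Summable fun k => ‖c k‖ :=
  summable_of_ne_finset_zero (s := box N) fun k hk => by rw [hc k hk, norm_zero]

theorem exists_mem_trigPoly {N : ℕ} {u : L2} (hu : ∀ k ∉ box N, coeff (toC u) k = 0) :
    ∃ f ∈ trigPoly N, toC u =ᵐ[volume.restrict Ω] f := by
  refine ⟨_, mem_trigPoly.2 ⟨coeff (toC u), rfl⟩, ?_⟩
  filter_upwards [toC_ae_eq_series u (summable_of_supp hu)] with x hx
  rw [hx]
  exact tsum_eq_sum fun k hk => by rw [hu k hk, zero_mul]

theorem integrable_toC_sq (u : L2) : Integrable (fun x => toC u x ^ 2) (volume.restrict Ω) := by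
  refine (integrable_mul_conj (memLp_toC u) (memLp_toC u)).congr (ae_of_all _ fun x => ?_)
  simp only [conj_toC]; ring

/-- The Galerkin scheme in terms of Fourier coefficients. -/
theorem scheme_eq {α : ℝ} {N : ℕ} {g w : L2} (hw : ∀ k ∉ box N, coeff (toC w) k = 0)
    (c : (Fin 2 → ℤ) → ℂ) :
    ip (toC g) (fun x => ∑ k ∈ box N, c k * expMode k x)
      + ip (fracLap α (toC w)) (pderiv fun x => ∑ k ∈ box N, c k * expMode k x)
      - (1 / 2) * ip (fun x => toC w x ^ 2) (pderiv fun x => ∑ k ∈ box N, c k * expMode k x) =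
    (2 * (Real.pi : ℂ)) ^ 2 *
      ∑ k ∈ box N, (starRingEnd ℂ) (c k) * (coeff (toC g) k - rhs α (coeff (toC w)) k) := by
  have hs : Summable fun k => ‖((absPow α k : ℝ) : ℂ) * coeff (toC w) k‖ :=
    summable_of_supp (N := N) fun k hk => by rw [hw k hk, mul_zero]
  rw [pderiv_sum, ip_sum_expMode ((memLp_toC g).integrable one_le_two), fracLap_eq_series,
    ip_sum_expMode ((memLp_series hs).integrable one_le_two), ip_sum_expMode (integrable_toC_sq w)]
  simp_rw [coeff_series hs, coeff_sq]
  rw [mul_left_comm, ← mul_add, ← mul_sub, Finset.mul_sum, ← Finset.sum_add_distrib,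
    ← Finset.sum_sub_distrib]
  congr 1
  refine Finset.sum_congr rfl fun k _ => ?_
  rw [rhs, omega]
  simp only [map_mul, Complex.conj_I, map_intCast]
  push_cast
  ring

end TrigPoly

section GalerkinCoefficients

variable {α T : ℝ} {u₀ : L2} {N : ℕ} {w : ℝ → L2}

theorem IsGalerkinSolution.coeff_eq_zero (h : IsGalerkinSolution α T u₀ N w) {t : ℝ}
    (ht : t ∈ Set.Icc 0 T) {k : Fin 2 → ℤ} (hk : k ∉ box N) : coeff (toC (w t)) k = 0 := by
  obtain ⟨f, hf, he⟩ := h.mem t ht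
  rw [coeff_congr he, coeff_of_mem_trigPoly hf hk]

theorem sum_single_expMode {N : ℕ} {k : Fin 2 → ℤ} (hk : k ∈ box N) :
    (fun x => ∑ l ∈ box N, (if l = k then (1 : ℂ) else 0) * expMode l x) = expMode k := by
  ext x
  simp only [ite_mul, one_mul, zero_mul, Finset.sum_ite_eq', if_pos hk]

theorem IsGalerkinSolution.coeff_derivWithin (h : IsGalerkinSolution α T u₀ N w) {t : ℝ}
    (ht : t ∈ Set.Icc 0 T) {k : Fin 2 → ℤ} (hk : k ∈ box N) :
    coeff (toC (derivWithin w (Set.Icc 0 T) t)) k = rhs α (coeff (toC (w t))) k := by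
  have hpi : (Real.pi : ℂ) ≠ 0 := by exact_mod_cast Real.pi_ne_zero
  have h1 := h.scheme t ht _ (expMode_mem_trigPoly hk)
  rw [← sum_single_expMode hk, scheme_eq (fun k hk => h.coeff_eq_zero ht hk)] at h1
  have h2 := (mul_eq_zero.1 h1).resolve_left (pow_ne_zero 2 (mul_ne_zero two_ne_zero hpi))
  rw [Finset.sum_eq_single k (fun l _ hl => by rw [if_neg hl, map_zero, zero_mul])
    (fun hn => absurd hk hn), if_pos rfl, map_one, one_mul] at h2
  exact sub_eq_zero.1 h2

theorem IsGalerkinSolution.isGalerkinCoeff (h : IsGalerkinSolution α T u₀ N w) :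
    IsGalerkinCoeff α T N fun t => coeff (toC (w t)) where
  real t _ k := coeff_toC_neg _ _
  supp t ht k hk := h.coeff_eq_zero ht hk
  ode t ht k hk := by
    rw [← h.coeff_derivWithin ht hk]
    exact (coeffCLM k).hasFDerivAt.comp_hasDerivWithinAt t (h.diff t ht).hasDerivWithinAt

theorem IsGalerkinSolution.coeff_init (h : IsGalerkinSolution α T u₀ N w) {k : Fin 2 → ℤ}
    (hk : k ∈ box N) : coeff (toC (w 0)) k = coeff (toC u₀) k := by
  rw [coeff, coeff, h.init _ (expMode_mem_trigPoly hk)]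

theorem isGalerkinSolution_of_hasDeriv (hT : 0 < T) {g : ℝ → L2}
    (hd : ∀ t ∈ Set.Icc 0 T, HasDerivWithinAt w (g t) (Set.Icc 0 T) t)
    (hs : ∀ t ∈ Set.Icc 0 T, ∀ k ∉ box N, coeff (toC (w t)) k = 0)
    (hg : ∀ t ∈ Set.Icc 0 T, ∀ k ∈ box N, coeff (toC (g t)) k = rhs α (coeff (toC (w t))) k)
    (h0 : ∀ k ∈ box N, coeff (toC (w 0)) k = coeff (toC u₀) k) :
    IsGalerkinSolution α T u₀ N w where
  mem t ht := exists_mem_trigPoly (hs t ht)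
  diff t ht := (hd t ht).differentiableWithinAt
  scheme t ht v hv := by
    obtain ⟨c, rfl⟩ := mem_trigPoly.1 hv
    rw [scheme_eq (hs t ht), (hd t ht).derivWithin (uniqueDiffOn_Icc hT t ht)]
    rw [Finset.sum_eq_zero fun k hk => by rw [hg t ht k hk, sub_self, mul_zero], mul_zero]
  init v hv := by
    obtain ⟨c, rfl⟩ := mem_trigPoly.1 hv
    rw [ip_sum_expMode ((memLp_toC _).integrable one_le_two),
      ip_sum_expMode ((memLp_toC _).integrable one_le_two)]
    congr 1
    exact Finset.sum_congr rfl fun k hk => by rw [h0 k hk]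

end GalerkinCoefficients

end FZK
end

noncomputable section
namespace FZK
open scoped ENNReal NNReal

/-! ### Conservation of the `L²` norm. -/

section Conservation

/-- The case `s = 0` of the symmetrization: the multiplier becomes `k₁ + l₁ + m₁ = 0`. -/
theorem tri_fst_eq_zero {N : ℕ} {x : (Fin 2 → ℤ) → ℂ} (hx : ∀ k ∉ box N, x k = 0) :
    tri (fun k _ => (k 0 : ℝ)) x x x = 0 := by
  have h := tri_energyMult 0 hx
  have e : energyMult 0 = fun _ _ => 0 := by
    ext k l
    simp only [energyMult, Real.rpow_zero, mul_one, Pi.sub_apply, Pi.neg_apply]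
    push_cast; ring
  simp only [e, Real.rpow_zero, mul_one] at h
  rw [show tri (fun _ _ => 0) x x x = 0 by simp [tri]] at h
  exact (mul_eq_zero.1 h.symm).resolve_left (by norm_num)

theorem conv_neg {c : (Fin 2 → ℤ) → ℂ} (hr : ∀ k, c (-k) = (starRingEnd ℂ) (c k))
    (k : Fin 2 → ℤ) : conv c c (-k) = (starRingEnd ℂ) (conv c c k) := by
  rw [conv, conv, Complex.conj_tsum, ← (Equiv.neg _).tsum_eq]
  congr 1; ext l
  rw [map_mul, ← hr, ← hr, Equiv.neg_apply]
  congr 2; abel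

theorem rhs_neg {α : ℝ} {c : (Fin 2 → ℤ) → ℂ} (hr : ∀ k, c (-k) = (starRingEnd ℂ) (c k))
    (k : Fin 2 → ℤ) : rhs α c (-k) = (starRingEnd ℂ) (rhs α c k) := by
  rw [rhs, rhs, conv_neg hr, hr, omega_neg]
  simp only [map_sub, map_mul, map_div₀, Complex.conj_I, Complex.conj_ofReal, map_intCast,
    Complex.conj_ofNat, Pi.neg_apply]
  push_cast; ring

/-- The Galerkin vector field is tangent to the spheres of `L²`. -/
theorem re_sum_mul_rhs {α : ℝ} {N : ℕ} {c : (Fin 2 → ℤ) → ℂ} (hc : ∀ k ∉ box N, c k = 0)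
    (hr : ∀ k, c (-k) = (starRingEnd ℂ) (c k)) :
    (∑ k ∈ box N, c (-k) * rhs α c k).re = 0 := by
  have e : ∑ k ∈ box N, c (-k) * rhs α c k =
      Complex.I * ((∑ k ∈ box N, omega α k * ‖c k‖ ^ 2 : ℝ) : ℂ) +
        Complex.I / 2 * tri (fun k _ => (k 0 : ℝ)) c c c := by
    rw [tri_eq_sum _ hc hc, Finset.sum_product]
    have e2 : ∑ k ∈ box N, ∑ l ∈ box N, (((k 0 : ℤ) : ℝ) : ℂ) * (c k * c l * c (-k - l)) =
        ∑ k ∈ box N, ∑ l ∈ box N, (((-(k 0) : ℤ) : ℝ) : ℂ) * (c (-k) * c l * c (k - l)) := by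
      refine Finset.sum_equiv (Equiv.neg _) (fun k => neg_mem_box.symm) fun k _ => ?_
      simp
    simp only []
    rw [e2]
    push_cast
    rw [Finset.mul_sum, Finset.mul_sum, ← Finset.sum_add_distrib]
    refine Finset.sum_congr rfl fun k _ => ?_
    rw [rhs, conv_eq_sum hc, mul_sub, Finset.mul_sum, Finset.mul_sum, Finset.mul_sum]
    have e3 : ((‖c k‖ : ℝ) : ℂ) ^ 2 = c (-k) * c k := by
      rw [hr, ← Complex.normSq_eq_conj_mul_self, Complex.normSq_eq_norm_sq]; push_cast; rfl
    rw [e3, sub_eq_add_neg, ← Finset.sum_neg_distrib]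
    congr 1
    · ring
    · exact Finset.sum_congr rfl fun l _ => by ring
  rw [e, tri_fst_eq_zero hc, mul_zero, add_zero, Complex.mul_re, Complex.I_re, Complex.ofReal_im]
  ring

end Conservation

/-! ### Global existence for the Galerkin scheme. -/

section Existence

/-- Extension by zero of a family indexed by `box N`. -/
def extend (N : ℕ) (x : box N → ℂ) (k : Fin 2 → ℤ) : ℂ := if h : k ∈ box N then x ⟨k, h⟩ else 0

theorem extend_of_mem {N : ℕ} (x : box N → ℂ) {k : Fin 2 → ℤ} (h : k ∈ box N) :
    extend N x k = x ⟨k, h⟩ := dif_pos h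

theorem extend_of_notMem {N : ℕ} (x : box N → ℂ) {k : Fin 2 → ℤ} (h : k ∉ box N) :
    extend N x k = 0 := dif_neg h

theorem contDiff_extend (N : ℕ) (k : Fin 2 → ℤ) :
    ContDiff ℝ 1 fun x : box N → ℂ => extend N x k := by
  by_cases h : k ∈ box N
  · simp only [extend_of_mem _ h]; fun_prop
  · simp only [extend_of_notMem _ h]; fun_prop

theorem contDiff_rhs_extend (α : ℝ) (N : ℕ) (k : Fin 2 → ℤ) :
    ContDiff ℝ 1 fun x : box N → ℂ => rhs α (extend N x) k := by
  have h : ∀ x : box N → ℂ, rhs α (extend N x) k = Complex.I * (omega α k : ℂ) * extend N x k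
      - Complex.I * (k 0 : ℂ) / 2 * ∑ l ∈ box N, extend N x l * extend N x (k - l) := fun x => by
    rw [rhs, conv_eq_sum fun k hk => extend_of_notMem x hk]
  simp only [h]
  refine (contDiff_const.mul (contDiff_extend N k)).sub (contDiff_const.mul ?_)
  exact ContDiff.sum fun l _ => (contDiff_extend N l).mul (contDiff_extend N _)

/-- Synthesis of a real-valued trigonometric polynomial from its (symmetrized) coefficients. -/
theorem exists_synthesis (N : ℕ) : ∃ S : (box N → ℂ) →L[ℝ] L2, ∀ x m,
    coeff (toC (S x)) m = (extend N x m + (starRingEnd ℂ) (extend N x (-m))) / 2 := by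
  -- Averaging with the conjugate at `-m` makes the synthesis defined and real-linear on all
  -- families; conjugation-symmetric ones are reproduced unchanged.
  have hex : ∀ x : box N → ℂ, ∃ u : L2, ∀ m,
      coeff (toC u) m = (extend N x m + (starRingEnd ℂ) (extend N x (-m))) / 2 := by
    intro x
    refine exists_coeff_toC_eq (summable_of_ne_finset_zero (s := box N) fun m hm => ?_) fun m => ?_
    · rw [extend_of_notMem x hm, extend_of_notMem x (mt neg_mem_box.1 hm)]; simp
    · rw [map_div₀, map_add, Complex.conj_conj, neg_neg, Complex.conj_ofNat, add_comm]
  choose S hS using hex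
  have hadd : ∀ x y m, extend N (x + y) m = extend N x m + extend N y m := by
    intro x y m
    by_cases h : m ∈ box N
    · simp only [extend_of_mem _ h, Pi.add_apply]
    · simp only [extend_of_notMem _ h, add_zero]
  have hsmul : ∀ (r : ℝ) x m, extend N (r • x) m = r * extend N x m := by
    intro r x m
    by_cases h : m ∈ box N
    · simp only [extend_of_mem _ h, Pi.smul_apply, Complex.real_smul]
    · simp only [extend_of_notMem _ h, mul_zero]
  let L : (box N → ℂ) →ₗ[ℝ] L2 :=
    { toFun := S
      map_add' := fun x y => eq_of_coeff_eq fun k => by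
        rw [← coeffCLM_apply k (S x + S y), map_add, coeffCLM_apply, coeffCLM_apply, hS, hS, hS,
          hadd, hadd, map_add]
        ring
      map_smul' := fun r x => eq_of_coeff_eq fun k => by
        rw [RingHom.id_apply, ← coeffCLM_apply k (r • S x), map_smul, coeffCLM_apply, hS, hS,
          hsmul, hsmul, map_mul, Complex.conj_ofReal, Complex.real_smul]
        ring }
  exact ⟨L.toContinuousLinearMap, hS⟩

/-- Picard–Lindelöf for bounded Lipschitz vector fields. -/
theorem exists_solution_of_lipschitz {E : Type*} [NormedAddCommGroup E] [NormedSpace ℝ E]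
    [CompleteSpace E] {V : E → E} {K L : ℝ≥0} (hK : LipschitzWith K V) (hL : ∀ x, ‖V x‖ ≤ L)
    {T : ℝ} (hT : 0 ≤ T) (x₀ : E) :
    ∃ w : ℝ → E, w 0 = x₀ ∧
      ∀ t ∈ Set.Icc 0 T, HasDerivWithinAt w (V (w t)) (Set.Icc 0 T) t := by
  have h0 : (0 : ℝ) ∈ Set.Icc 0 T := ⟨le_rfl, hT⟩
  -- The field is bounded by `L` everywhere, so the solution cannot leave the ball of radius `L * T`
  -- before time `T`; the trailing `0` means a single initial point.
  have hpl : IsPicardLindelof (fun _ => V) (⟨0, h0⟩ : Set.Icc 0 T) x₀ (L * ⟨T, hT⟩) 0 L K :=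
    .of_time_independent (fun x _ => hL x) hK.lipschitzOnWith (by
      simp only [sub_zero, sub_self, NNReal.coe_zero]
      rw [max_eq_left hT]
      exact le_rfl)
  exact hpl.exists_eq_forall_mem_Icc_hasDerivWithinAt₀

variable {α T : ℝ}

/-- A real factor `χ` is allowed because the field remains tangent to the spheres after rescaling,
so conservation also holds for the truncated system. -/
theorem sum_norm_sq_eq_init {N : ℕ} {a : ℝ → (Fin 2 → ℤ) → ℂ} {χ : ℝ → ℝ}
    (hr : ∀ t ∈ Set.Icc 0 T, ∀ k, a t (-k) = (starRingEnd ℂ) (a t k))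
    (hs : ∀ t ∈ Set.Icc 0 T, ∀ k ∉ box N, a t k = 0)
    (hd : ∀ t ∈ Set.Icc 0 T, ∀ k ∈ box N,
      HasDerivWithinAt (fun τ => a τ k) ((χ t : ℂ) * rhs α (a t) k) (Set.Icc 0 T) t)
    {t : ℝ} (ht : t ∈ Set.Icc 0 T) :
    ∑ k ∈ box N, ‖a t k‖ ^ 2 = ∑ k ∈ box N, ‖a 0 k‖ ^ 2 := by
  have hT : 0 ≤ T := ht.1.trans ht.2
  have he : ∀ τ ∈ Set.Icc 0 T,
      ∑ k ∈ box N, ‖a τ k‖ ^ 2 = (∑ k ∈ box N, a τ k * a τ (-k)).re := by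
    intro τ hτ
    rw [Complex.re_sum]
    refine Finset.sum_congr rfl fun k _ => ?_
    rw [hr τ hτ, Complex.mul_conj, Complex.ofReal_re, Complex.normSq_eq_norm_sq]
  have hder : ∀ τ ∈ Set.Icc 0 T, HasDerivWithinAt (fun τ => ∑ k ∈ box N, ‖a τ k‖ ^ 2) 0
      (Set.Icc 0 T) τ := by
    intro τ hτ
    have h1 : HasDerivWithinAt (fun τ => ∑ k ∈ box N, a τ k * a τ (-k))
        (∑ k ∈ box N, ((χ τ : ℂ) * rhs α (a τ) k * a τ (-k) +
          a τ k * ((χ τ : ℂ) * rhs α (a τ) (-k)))) (Set.Icc 0 T) τ :=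
      HasDerivWithinAt.fun_sum fun k hk => (hd τ hτ k hk).mul (hd τ hτ (-k) (neg_mem_box.2 hk))
    have h2 := Complex.reCLM.hasFDerivAt.comp_hasDerivWithinAt τ h1
    refine (h2.congr_deriv ?_).congr he (he τ hτ)
    have e1 : ∑ k ∈ box N, a τ k * ((χ τ : ℂ) * rhs α (a τ) (-k)) =
        ∑ k ∈ box N, (χ τ : ℂ) * rhs α (a τ) k * a τ (-k) := by
      refine Finset.sum_equiv (Equiv.neg _) (fun k => neg_mem_box.symm) fun k _ => ?_
      simp only [Equiv.neg_apply, neg_neg]; ring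
    have e2 : ∑ k ∈ box N, (χ τ : ℂ) * rhs α (a τ) k * a τ (-k) =
        (χ τ : ℂ) * ∑ k ∈ box N, a τ (-k) * rhs α (a τ) k := by
      rw [Finset.mul_sum]; exact Finset.sum_congr rfl fun k _ => by ring
    rw [Complex.reCLM_apply, Finset.sum_add_distrib, e1, e2, Complex.add_re, Complex.re_ofReal_mul,
      re_sum_mul_rhs (hs τ hτ) (hr τ hτ)]
    ring
  exact constant_of_has_deriv_right_zero (fun τ hτ => (hder τ hτ).continuousWithinAt)
    (fun τ hτ => (hder τ ⟨hτ.1, hτ.2.le⟩).mono_of_mem_nhdsWithin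
      (Icc_mem_nhdsGE_of_mem hτ)) t ht

/-- Global existence for the Galerkin scheme. -/
theorem exists_isGalerkinSolution (α : ℝ) (hT : 0 < T) (u₀ : L2) (N : ℕ) :
    ∃ w : ℝ → L2, IsGalerkinSolution α T u₀ N w := by
  obtain ⟨S, hS⟩ := exists_synthesis N
  let P : L2 →L[ℝ] (box N → ℂ) := ContinuousLinearMap.pi fun k => coeffCLM k
  have hP : ∀ (u : L2) (k : Fin 2 → ℤ), k ∈ box N → extend N (P u) k = coeff (toC u) k :=
    fun u k hk => extend_of_mem _ hk
  have hPr : ∀ (u : L2) (k : Fin 2 → ℤ),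
      extend N (P u) (-k) = (starRingEnd ℂ) (extend N (P u) k) := by
    intro u k
    by_cases hk : k ∈ box N
    · rw [hP u k hk, hP u _ (neg_mem_box.2 hk), coeff_toC_neg]
    · rw [extend_of_notMem _ hk, extend_of_notMem _ (mt neg_mem_box.1 hk), map_zero]
  have hM : 0 ≤ ∑ k ∈ box N, ‖coeff (toC u₀) k‖ ^ 2 := Finset.sum_nonneg fun k _ => sq_nonneg _
  set M : ℝ := ∑ k ∈ box N, ‖coeff (toC u₀) k‖ ^ 2 with hMdef
  -- Cutting off the quadratic field makes it bounded and globally Lipschitz. The radius `M + 1` is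
  -- never reached: `‖a_k‖² ≤ M` gives `‖a_k‖ ≤ M + 1`, and the norm on `box N → ℂ` is the supremum.
  let χ : ContDiffBump (0 : box N → ℂ) := ⟨M + 1, M + 2, by linarith, by linarith⟩
  let H : (box N → ℂ) → (box N → ℂ) := fun x => χ x • fun k : box N => rhs α (extend N x) k
  have hHd : ContDiff ℝ 1 H :=
    χ.contDiff.smul (contDiff_pi.2 fun k => contDiff_rhs_extend α N k)
  have hHc : HasCompactSupport H := χ.hasCompactSupport.smul_right
  obtain ⟨K, hK⟩ := hHd.lipschitzWith_of_hasCompactSupport hHc one_ne_zero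
  obtain ⟨B, hB⟩ := hHc.exists_bound_of_continuous hHd.continuous
  have hB0 : 0 ≤ B := (norm_nonneg _).trans (hB 0)
  have hLip := S.lipschitz.comp (hK.comp P.lipschitz)
  obtain ⟨w, hw0, hw⟩ := exists_solution_of_lipschitz (L := ⟨‖S‖ * B, by positivity⟩) hLip
    (fun u => (S.le_opNorm _).trans (mul_le_mul_of_nonneg_left (hB _) (norm_nonneg _))) hT.le
    (S (P u₀))
  have hV : ∀ (u : L2) (k : Fin 2 → ℤ), k ∈ box N →
      coeff (toC (S (H (P u)))) k = (χ (P u) : ℂ) * rhs α (extend N (P u)) k := by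
    intro u k hk
    rw [hS, extend_of_mem _ hk, extend_of_mem _ (neg_mem_box.2 hk)]
    simp only [H, Pi.smul_apply, Complex.real_smul, map_mul, Complex.conj_ofReal]
    rw [rhs_neg (hPr u), Complex.conj_conj]; ring
  have hSz : ∀ x (k : Fin 2 → ℤ), k ∉ box N → coeff (toC (S x)) k = 0 := by
    intro x k hk
    rw [hS, extend_of_notMem _ hk, extend_of_notMem _ (mt neg_mem_box.1 hk)]; simp
  have hd : ∀ t ∈ Set.Icc 0 T, ∀ k, HasDerivWithinAt (fun τ => coeff (toC (w τ)) k)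
      (coeff (toC (S (H (P (w t))))) k) (Set.Icc 0 T) t := fun t ht k =>
    (coeffCLM k).hasFDerivAt.comp_hasDerivWithinAt t (hw t ht)
  have hz : ∀ t ∈ Set.Icc 0 T, ∀ k ∉ box N, coeff (toC (w t)) k = 0 := by
    intro t ht k hk
    rw [constant_of_has_deriv_right_zero (f := fun τ => coeff (toC (w τ)) k)
      (fun τ hτ => (hd τ hτ k).continuousWithinAt)
      (fun τ hτ => by
        have := hd τ ⟨hτ.1, hτ.2.le⟩ k
        rw [hSz _ k hk] at this
        exact this.mono_of_mem_nhdsWithin (Icc_mem_nhdsGE_of_mem hτ)) t ht, hw0, hSz _ k hk]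
  have hext : ∀ t ∈ Set.Icc 0 T, extend N (P (w t)) = coeff (toC (w t)) := by
    intro t ht; ext k
    by_cases hk : k ∈ box N
    · exact hP _ k hk
    · rw [extend_of_notMem _ hk, hz t ht k hk]
  have h0 : ∀ k ∈ box N, coeff (toC (w 0)) k = coeff (toC u₀) k := by
    intro k hk
    rw [hw0, hS, hPr, hP _ k hk, Complex.conj_conj]; ring
  -- Conservation of the sum of squares keeps the solution where the cutoff equals 1, so it solves
  -- the original system.
  have hχ : ∀ t ∈ Set.Icc 0 T, χ (P (w t)) = 1 := by
    intro t ht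
    refine χ.one_of_mem_closedBall ?_
    rw [mem_closedBall_zero_iff, pi_norm_le_iff_of_nonneg (by change 0 ≤ M + 1; linarith)]
    intro k
    have h1 := sum_norm_sq_eq_init (α := α) (N := N) (a := fun t => coeff (toC (w t)))
      (χ := fun t => χ (P (w t))) (fun t _ k => coeff_toC_neg _ _) hz
      (fun t ht k hk => by
        have := hd t ht k
        rwa [hV _ k hk, hext t ht] at this) ht
    have h2 : ‖coeff (toC (w t)) k‖ ^ 2 ≤ M := by
      refine (Finset.single_le_sum (f := fun k => ‖coeff (toC (w t)) k‖ ^ 2)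
        (fun k _ => sq_nonneg _) k.2).trans (h1.le.trans (le_of_eq ?_))
      exact Finset.sum_congr rfl fun k hk => by simp only [h0 k hk]
    change ‖coeff (toC (w t)) k‖ ≤ M + 1
    nlinarith [norm_nonneg (coeff (toC (w t)) k)]
  refine ⟨w, isGalerkinSolution_of_hasDeriv hT hw hz (fun t ht k hk => ?_) h0⟩
  change coeff (toC (S (H (P (w t))))) k = _
  rw [hV _ k hk, hext t ht, hχ t ht]; simp

end Existence

end FZK
end

noncomputable section
namespace FZK
open scoped ENNReal NNReal

/-! ### Passage between coefficient bounds and the norms of the statement. -/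

section Bounds

variable {α T : ℝ} {u₀ : L2}

theorem hsn_coeff_sq (s : ℝ) (u : L2) : hsn s (fun k => ‖coeff (toC u) k‖ₑ) ^ 2 =
    ∑' k, ENNReal.ofReal ((1 + normSq k) ^ s * ‖coeff (toC u) k‖ ^ 2) := by
  rw [hsn, l2n_sq]
  congr 1; ext k
  exact wt_mul_enorm_sq s _ k

theorem sobolev_term_nonneg (s : ℝ) (u : L2) (k : Fin 2 → ℤ) :
    0 ≤ (1 + normSq k) ^ s * ‖coeff (toC u) k‖ ^ 2 :=
  mul_nonneg (Real.rpow_nonneg (by linarith [normSq_nonneg k]) _) (sq_nonneg _)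

/-- The Sobolev norm in terms of the extended weighted norm of the Fourier coefficients. -/
theorem sobolev_iff {s A : ℝ} (hA : 0 ≤ A) (u : L2) :
    MemSobolev s u ∧ sobolevNorm s u ≤ A ↔
      hsn s (fun k => ‖coeff (toC u) k‖ₑ) ≤ ENNReal.ofReal A := by
  have h0 := sobolev_term_nonneg s u
  constructor
  · rintro ⟨hm, hn⟩
    refine le_of_sq_le_sq ?_
    rw [hsn_coeff_sq, ← ENNReal.ofReal_tsum_of_nonneg h0 hm, ← ENNReal.ofReal_pow hA]
    exact ENNReal.ofReal_le_ofReal ((Real.sqrt_le_left hA).1 hn)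
  · intro h
    have h1 : ∑' k, ENNReal.ofReal ((1 + normSq k) ^ s * ‖coeff (toC u) k‖ ^ 2) ≤
        ENNReal.ofReal (A ^ 2) := by
      rw [← hsn_coeff_sq, ENNReal.ofReal_pow hA]
      exact pow_le_pow_left' h 2
    have hm : MemSobolev s u := by
      have := ENNReal.summable_toReal (ne_top_of_le_ne_top ENNReal.ofReal_ne_top h1)
      simpa only [MemSobolev, ENNReal.toReal_ofReal (h0 _)] using this
    refine ⟨hm, (Real.sqrt_le_left hA).2 ?_⟩
    rwa [← ENNReal.ofReal_tsum_of_nonneg h0 hm, ENNReal.ofReal_le_ofReal_iff (sq_nonneg _)] at h1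

theorem norm_le_of_l2n_le {B : ℝ} (hB : 0 ≤ B) {u : L2}
    (h : l2n (fun k => ‖coeff (toC u) k‖ₑ) ≤ ENNReal.ofReal B) : ‖u‖ ≤ 2 * Real.pi * B := by
  have hpi := Real.pi_pos
  have h1 : ENNReal.ofReal (((2 * Real.pi) ^ 2)⁻¹ * ‖u‖ ^ 2) ≤ ENNReal.ofReal (B ^ 2) := by
    rw [← tsum_enorm_coeff_sq, ← l2n_sq, ENNReal.ofReal_pow hB]
    exact pow_le_pow_left' h 2
  rw [ENNReal.ofReal_le_ofReal_iff (sq_nonneg _), inv_mul_le_iff₀ (by positivity), ← mul_pow] at h1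
  exact le_of_abs_le (abs_le_of_sq_le_sq h1 (by positivity))

theorem l2n_coeff_le (u : L2) : l2n (fun k => ‖coeff (toC u) k‖ₑ) ≤ ENNReal.ofReal ‖u‖ := by
  refine le_of_sq_le_sq ?_
  rw [l2n_sq, tsum_enorm_coeff_sq, ← ENNReal.ofReal_pow (norm_nonneg _)]
  refine ENNReal.ofReal_le_ofReal (mul_le_of_le_one_left (sq_nonneg _) (inv_le_one_of_one_le₀ ?_))
  nlinarith [Real.pi_gt_three]

theorem ofReal_abs_omega_le (hα : α ∈ Set.Icc (1 : ℝ) 2) (k : Fin 2 → ℤ) :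
    ‖(omega α k : ℂ)‖ₑ ≤ wt (1 + α) k := by
  rw [enorm_real_eq, wt]
  refine ENNReal.ofReal_le_ofReal ?_
  rw [omega, abs_mul, abs_of_nonneg (absPow_nonneg _ _), Real.rpow_add (jb_pos k), Real.rpow_one]
  refine mul_le_mul ((abs_fst_le k).trans (nrm_le_jb k)) ?_ (absPow_nonneg _ _) (jb_pos k).le
  exact Real.rpow_le_rpow (Real.sqrt_nonneg _) (nrm_le_jb k) (by linarith [hα.1])

theorem enorm_fst_le_wt (hα : α ∈ Set.Icc (1 : ℝ) 2) (k : Fin 2 → ℤ) :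
    ‖(k 0 : ℂ)‖ₑ ≤ wt (1 + α) k := by
  rw [← ofReal_norm, Complex.norm_intCast, wt]
  refine ENNReal.ofReal_le_ofReal (((abs_fst_le k).trans (nrm_le_jb k)).trans ?_)
  exact Real.self_le_rpow_of_one_le (one_le_jb k) (by linarith [hα.1])

/-- Both `|ω(k)|` and `|k₁|` are at most `⟨k⟩^{1+α}`, so `H^{1+α}` suffices for the right-hand side
to be in `L²`. -/
theorem enorm_rhs_le (hα : α ∈ Set.Icc (1 : ℝ) 2) (c : (Fin 2 → ℤ) → ℂ) (k : Fin 2 → ℤ) :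
    ‖rhs α c k‖ₑ ≤ wt (1 + α) k * ‖c k‖ₑ +
      wt (1 + α) k * econv (fun l => ‖c l‖ₑ) (fun l => ‖c l‖ₑ) k := by
  rw [rhs]
  refine enorm_sub_le.trans (add_le_add ?_ ?_)
  · rw [enorm_mul, enorm_mul]
    gcongr
    have : ‖Complex.I‖ₑ = 1 := by rw [← ofReal_norm]; simp
    rw [this, one_mul]
    exact ofReal_abs_omega_le hα k
  · rw [enorm_mul]
    refine mul_le_mul' ?_ (enorm_conv_le c c k)
    refine le_trans ?_ (enorm_fst_le_wt hα k)
    rw [← ofReal_norm, ← ofReal_norm]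
    refine ENNReal.ofReal_le_ofReal ?_
    rw [norm_div, norm_mul, Complex.norm_I, one_mul, Complex.norm_two]
    linarith [norm_nonneg (k 0 : ℂ)]

theorem l2n_rhs_le (hα : α ∈ Set.Icc (1 : ℝ) 2) {A : ℝ} (hA : 0 ≤ A) {c : (Fin 2 → ℤ) → ℂ}
    (hc : hsn (1 + α) (fun k => ‖c k‖ₑ) ≤ ENNReal.ofReal A) :
    l2n (fun k => ‖rhs α c k‖ₑ) ≤ ENNReal.ofReal (2 * (A + 256 * (A * A))) := by
  have hs : 1 + α ∈ Set.Icc (2 : ℝ) 3 := ⟨by linarith [hα.1], by linarith [hα.2]⟩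
  calc l2n (fun k => ‖rhs α c k‖ₑ)
      ≤ 2 * (hsn (1 + α) (fun k => ‖c k‖ₑ) +
          hsn (1 + α) (econv (fun l => ‖c l‖ₑ) (fun l => ‖c l‖ₑ))) :=
        (l2n_mono fun k => enorm_rhs_le hα c k).trans (l2n_add_le _ _)
    _ ≤ 2 * (ENNReal.ofReal A + 256 * (ENNReal.ofReal A * ENNReal.ofReal A)) := by
        gcongr
        refine (hsn_econv_le hs _ _).trans ?_
        gcongr
    _ = _ := by
        rw [ENNReal.ofReal_mul (by norm_num), ENNReal.ofReal_add hA (by positivity),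
          ENNReal.ofReal_mul (by norm_num), ENNReal.ofReal_mul hA]
        norm_num

/-- Galerkin solutions stay bounded in `H^{1+α}` on a time interval that depends only on the size
of the data. -/
theorem exists_galerkin_bound {α : ℝ} (hα : α ∈ Set.Icc (1 : ℝ) 2) (R : ℝ) :
    ∃ T > 0, ∃ A ≥ 1, ∀ u₀ : L2, MemSobolev (1 + α) u₀ → sobolevNorm (1 + α) u₀ ≤ R →
      ∀ N w, IsGalerkinSolution α T u₀ N w → IsCoeffSol α T A N fun t => coeff (toC (w t)) := by
  -- The a priori bound requires `A ≥ 1`, and the sign of `R` is arbitrary.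
  set A : ℝ := |R| + 1 with hA
  have hA1 : 1 ≤ A := by linarith [abs_nonneg R]
  obtain ⟨T, hT, h⟩ := exists_apriori_bound hα hA1
  refine ⟨T, hT, 2 * A, by linarith, fun u₀ hm hn N w hw => ?_⟩
  have hn' : sobolevNorm (1 + α) u₀ ≤ A := by linarith [le_abs_self R]
  have hc := hw.isGalerkinCoeff
  have h0 : energy (1 + α) N (coeff (toC (w 0))) ≤ A ^ 2 := by
    calc energy (1 + α) N (coeff (toC (w 0))) = energy (1 + α) N (coeff (toC u₀)) :=
          Finset.sum_congr rfl fun k hk => by rw [hw.coeff_init hk]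
      _ ≤ ∑' k, (1 + normSq k) ^ (1 + α) * ‖coeff (toC u₀) k‖ ^ 2 :=
          hm.sum_le_tsum _ fun k _ => sobolev_term_nonneg _ _ _
      _ ≤ A ^ 2 := (Real.sqrt_le_left (by linarith)).1 hn'
  exact ⟨hc.real, fun t ht => hsn_enorm_le (by linarith) (hc.supp t ht) (h N _ hc h0 t ht), hc.ode⟩

theorem norm_le_of_hsn_le (hα : α ∈ Set.Icc (1 : ℝ) 2) {A : ℝ} (hA : 0 ≤ A) {u : L2}
    (h : hsn (1 + α) (fun k => ‖coeff (toC u) k‖ₑ) ≤ ENNReal.ofReal A) : ‖u‖ ≤ 2 * Real.pi * A :=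
  norm_le_of_l2n_le hA ((l2n_le_hsn (by linarith [hα.1]) _).trans h)

theorem norm_derivWithin_le (hα : α ∈ Set.Icc (1 : ℝ) 2) {A : ℝ} (hA : 0 ≤ A) {N : ℕ}
    {w : ℝ → L2} (hT : 0 < T) (hw : IsGalerkinSolution α T u₀ N w) {t : ℝ} (ht : t ∈ Set.Icc 0 T)
    (h : hsn (1 + α) (fun k => ‖coeff (toC (w t)) k‖ₑ) ≤ ENNReal.ofReal A) :
    ‖derivWithin w (Set.Icc 0 T) t‖ ≤ 2 * Real.pi * (2 * (A + 256 * (A * A))) := by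
  refine norm_le_of_l2n_le (by positivity) (le_trans (l2n_mono fun k => ?_) (l2n_rhs_le hα hA h))
  by_cases hk : k ∈ box N
  · rw [hw.coeff_derivWithin ht hk]
  -- The scheme says nothing about modes outside the box; they vanish at all times, hence so do
  -- their derivatives.
  · have h1 : HasDerivWithinAt (fun τ => coeff (toC (w τ)) k)
        (coeff (toC (derivWithin w (Set.Icc 0 T) t)) k) (Set.Icc 0 T) t :=
      (coeffCLM k).hasFDerivAt.comp_hasDerivWithinAt t (hw.diff t ht).hasDerivWithinAt
    have h2 : HasDerivWithinAt (fun τ => coeff (toC (w τ)) k) 0 (Set.Icc 0 T) t :=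
      (hasDerivWithinAt_const t _ (0 : ℂ)).congr (fun τ hτ => hw.coeff_eq_zero hτ hk)
        (hw.coeff_eq_zero ht hk)
    rw [(uniqueDiffOn_Icc hT t ht).eq_deriv _ h1 h2]
    simp

end Bounds

/-! ### Continuity of single modes and closedness of Sobolev balls. -/

section Continuity

/-- Cauchy–Schwarz for `(u + v)(u - v)`. Hence `L²` convergence suffices to pass to the limit in
every mode of the nonlinearity. -/
theorem norm_conv_coeff_sub_le (u v : L2) (k : Fin 2 → ℤ) :
    ‖conv (coeff (toC u)) (coeff (toC u)) k - conv (coeff (toC v)) (coeff (toC v)) k‖ ≤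
      ‖u + v‖ * ‖u - v‖ := by
  rw [conv_sub_conv (l2n_coeff_ne_top u) (l2n_coeff_ne_top v)]
  have e1 : (fun l => coeff (toC u) l + coeff (toC v) l) = coeff (toC (u + v)) := by
    ext l; simp only [← coeffCLM_apply, map_add]
  have e2 : (fun l => coeff (toC u) l - coeff (toC v) l) = coeff (toC (u - v)) := by
    ext l; simp only [← coeffCLM_apply, map_sub]
  rw [e1, e2]
  have h : ‖conv (coeff (toC (u + v))) (coeff (toC (u - v))) k‖ₑ ≤
      ENNReal.ofReal (‖u + v‖ * ‖u - v‖) := by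
    refine (enorm_conv_le _ _ k).trans ((tsum_mul_le_l2n_mul_l2n _ _).trans ?_)
    rw [ENNReal.ofReal_mul (norm_nonneg _)]
    refine mul_le_mul' (l2n_coeff_le _) (le_trans (le_of_eq ?_) (l2n_coeff_le (u - v)))
    exact l2n_comp_equiv (Equiv.subLeft k) fun k => ‖coeff (toC (u - v)) k‖ₑ
  rwa [← ofReal_norm, ENNReal.ofReal_le_ofReal_iff (by positivity)] at h

theorem continuous_coeff (k : Fin 2 → ℤ) : Continuous fun u : L2 => coeff (toC u) k :=
  (coeffCLM k).continuous

theorem continuous_conv_coeff (k : Fin 2 → ℤ) :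
    Continuous fun u : L2 => conv (coeff (toC u)) (coeff (toC u)) k := by
  refine continuous_iff_continuousAt.2 fun v => ?_
  rw [ContinuousAt, tendsto_iff_norm_sub_tendsto_zero]
  refine squeeze_zero (fun _ => norm_nonneg _) (fun u => norm_conv_coeff_sub_le u v k) ?_
  have : Continuous fun u : L2 => ‖u + v‖ * ‖u - v‖ := by fun_prop
  simpa using this.tendsto v

theorem continuous_rhs_coeff (α : ℝ) (k : Fin 2 → ℤ) :
    Continuous fun u : L2 => rhs α (coeff (toC u)) k :=
  (continuous_const.mul (continuous_coeff k)).sub (continuous_const.mul (continuous_conv_coeff k))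

/-- The Sobolev norm is a supremum of finite sums that are continuous on `L²`, hence lower
semicontinuous. -/
theorem isClosed_hsn_le (s : ℝ) (B : ℝ≥0∞) :
    IsClosed {u : L2 | hsn s (fun k => ‖coeff (toC u) k‖ₑ) ≤ B} := by
  have e : {u : L2 | hsn s (fun k => ‖coeff (toC u) k‖ₑ) ≤ B} =
      ⋂ F : Finset (Fin 2 → ℤ), {u : L2 | ∑ k ∈ F, (wt s k * ‖coeff (toC u) k‖ₑ) ^ 2 ≤ B ^ 2} := by
    ext u
    simp only [Set.mem_ofPred_eq, Set.mem_iInter]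
    rw [← iSup_le_iff, ← ENNReal.tsum_eq_iSup_sum, ← l2n_sq]
    exact ⟨fun h => pow_le_pow_left' h 2, le_of_sq_le_sq⟩
  rw [e]
  refine isClosed_iInter fun F => isClosed_le ?_ continuous_const
  refine continuous_finsetSum _ fun k _ => ?_
  refine (ENNReal.continuous_pow 2).comp ?_
  exact (ENNReal.continuous_const_mul (wt_ne_top s k)).comp (continuous_coeff k).enorm

end Continuity

end FZK
end

/-! ### Mild solutions as limits of Galerkin solutions. -/

noncomputable section
namespace FZK
open scoped ENNReal NNReal

/-- A continuous curve in `L²`, bounded in `H^{1+α}`, whose Fourier coefficients solve the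
integrated equation on `[0, T]`. -/
structure IsMildSolution (α T A : ℝ) (u₀ : L2) (u : ℝ → L2) : Prop where
  cont : Continuous u
  init : u 0 = u₀
  bound : ∀ t, hsn (1 + α) (fun k => ‖coeff (toC (u t)) k‖ₑ) ≤ ENNReal.ofReal A
  eq : ∀ t ∈ Set.Icc 0 T, ∀ k,
    coeff (toC (u t)) k = coeff (toC u₀) k + ∫ s in (0 : ℝ)..t, rhs α (coeff (toC (u s))) k

section Mild

variable {α T A : ℝ} {u₀ : L2} {u : ℝ → L2}

theorem IsMildSolution.hasDeriv (h : IsMildSolution α T A u₀ u) {t : ℝ} (ht : t ∈ Set.Icc 0 T)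
    (k : Fin 2 → ℤ) : HasDerivWithinAt (fun τ => coeff (toC (u τ)) k)
      (rhs α (coeff (toC (u t))) k) (Set.Icc 0 T) t := by
  have hc : Continuous fun s => rhs α (coeff (toC (u s))) k :=
    (continuous_rhs_coeff α k).comp h.cont
  have h1 : HasDerivAt (fun τ => coeff (toC u₀) k + ∫ s in (0 : ℝ)..τ, rhs α (coeff (toC (u s))) k)
      (rhs α (coeff (toC (u t))) k) t := (hc.integral_hasStrictDerivAt 0 t).hasDerivAt.const_add _
  exact h1.hasDerivWithinAt.congr (fun τ hτ => h.eq τ hτ k) (h.eq t ht k)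

theorem IsMildSolution.isCoeffSol (h : IsMildSolution α T A u₀ u) (J : ℕ) :
    IsCoeffSol α T A J fun t => coeff (toC (u t)) where
  real _ _ _ := coeff_toC_neg _ _
  bound _ _ := h.bound _
  ode _ ht k _ := h.hasDeriv ht k

theorem norm_sub_le_of_tsum_le {ε : ℝ} {v w : L2}
    (h : ∑' k, ‖coeff (toC v) k - coeff (toC w) k‖ₑ ^ 2 ≤ ENNReal.ofReal (ε ^ 2)) (hε : 0 ≤ ε) :
    ‖v - w‖ ≤ 2 * Real.pi * ε := by
  refine norm_le_of_l2n_le hε (le_of_sq_le_sq ?_)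
  rw [l2n_sq, ← ENNReal.ofReal_pow hε]
  simpa only [coeff_toC_sub] using h

/-- Rate of convergence in the stability estimate. -/
theorem exists_stability_norm (hα : α ∈ Set.Icc (1 : ℝ) 2) (T : ℝ) (hA : 1 ≤ A) :
    ∃ δ : ℕ → ℝ, Tendsto δ atTop (𝓝 0) ∧ ∀ J ≥ 1, ∀ v w : ℝ → L2,
      IsCoeffSol α T A J (fun t => coeff (toC (v t))) →
      IsCoeffSol α T A J (fun t => coeff (toC (w t))) →
      (∀ k ∈ box J, coeff (toC (v 0)) k = coeff (toC (w 0)) k) →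
      ∀ t ∈ Set.Icc 0 T, ‖v t - w t‖ ≤ δ J := by
  obtain ⟨C, hC, h⟩ := exists_stability hα T hA
  refine ⟨fun J => 2 * Real.pi * Real.sqrt (C / Real.sqrt J), ?_, fun J hJ v w hv hw h0 t ht => ?_⟩
  · have h1 : Tendsto (fun J : ℕ => C / Real.sqrt (J : ℝ)) atTop (𝓝 0) :=
      (Real.tendsto_sqrt_atTop.comp tendsto_natCast_atTop_atTop).const_div_atTop C
    simpa using (h1.sqrt).const_mul (2 * Real.pi)
  · refine norm_sub_le_of_tsum_le ?_ (Real.sqrt_nonneg _)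
    rw [Real.sq_sqrt (by positivity)]
    exact h J hJ _ _ hv hw h0 t ht

theorem norm_rhs_le (hα : α ∈ Set.Icc (1 : ℝ) 2) (hA : 0 ≤ A) {c : (Fin 2 → ℤ) → ℂ}
    (hc : hsn (1 + α) (fun k => ‖c k‖ₑ) ≤ ENNReal.ofReal A) (k : Fin 2 → ℤ) :
    ‖rhs α c k‖ ≤ 2 * (A + 256 * (A * A)) := by
  have h := (le_l2n (fun k => ‖rhs α c k‖ₑ) k).trans (l2n_rhs_le hα hA hc)
  rwa [← ofReal_norm, ENNReal.ofReal_le_ofReal_iff (by positivity)] at h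

theorem integral_eq_sub_of_hasDerivWithinAt_Icc {f f' : ℝ → ℂ}
    (hd : ∀ t ∈ Set.Icc 0 T, HasDerivWithinAt f (f' t) (Set.Icc 0 T) t)
    (hc : ContinuousOn f' (Set.Icc 0 T)) {t : ℝ} (ht : t ∈ Set.Icc 0 T) :
    ∫ s in (0 : ℝ)..t, f' s = f t - f 0 := by
  have hsub : Set.Icc 0 t ⊆ Set.Icc 0 T := Set.Icc_subset_Icc_right ht.2
  refine intervalIntegral.integral_eq_sub_of_hasDerivAt_of_le ht.1
    (fun s hs => (hd s (hsub hs)).continuousWithinAt.mono hsub)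
    (fun s hs => (hd s (hsub ⟨hs.1.le, hs.2.le⟩)).hasDerivAt
      (Icc_mem_nhds hs.1 (hs.2.trans_le ht.2))) ?_
  exact (hc.mono hsub).intervalIntegrable_of_Icc ht.1

theorem eventually_mem_box (k : Fin 2 → ℤ) : ∀ᶠ N in atTop, k ∈ box N := by
  filter_upwards [eventually_ge_atTop (⌊nrm k⌋₊)] with N hN
  exact mem_box.2 fun j => (mem_box.1 (mem_box_floor k le_rfl) j).trans (by exact_mod_cast hN)

/-- The Galerkin solutions converge to a mild solution. -/
theorem exists_isMildSolution (hα : α ∈ Set.Icc (1 : ℝ) 2) (hT : 0 < T) (hA : 1 ≤ A)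
    (hu₀ : ∀ N w, IsGalerkinSolution α T u₀ N w → IsCoeffSol α T A N fun t => coeff (toC (w t))) :
    ∃ u, IsMildSolution α T A u₀ u ∧
      ∀ w : ℕ → ℝ → L2, (∀ N, IsGalerkinSolution α T u₀ N (w N)) →
        TendstoUniformlyOn w u atTop (Set.Icc 0 T) := by
  obtain ⟨δ, hδ, hst⟩ := exists_stability_norm hα T hA
  choose w hw using exists_isGalerkinSolution α hT u₀
  have h0 : (0 : ℝ) ∈ Set.Icc 0 T := ⟨le_rfl, hT.le⟩
  -- Both solutions satisfy the untruncated equation on `box J` and share the projected data there,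
  -- so stability applies at level `J`.
  have hdist : ∀ J ≥ 1, ∀ M ≥ J, ∀ t ∈ Set.Icc 0 T, ‖w J t - w M t‖ ≤ δ J := by
    intro J hJ M hM
    refine hst J hJ _ _ (hu₀ J _ (hw J)) ((hu₀ M _ (hw M)).mono le_rfl hM) fun k hk => ?_
    rw [(hw J).coeff_init hk, (hw M).coeff_init
      (mem_box.2 fun j => (mem_box.1 hk j).trans (by exact_mod_cast hM))]
  have hcau : ∀ t ∈ Set.Icc 0 T, CauchySeq fun N => w N t := by
    intro t ht
    refine Metric.cauchySeq_iff'.2 fun ε hε => ?_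
    obtain ⟨J, hJ⟩ := ((hδ.eventually (gt_mem_nhds hε)).and (eventually_ge_atTop 1)).exists
    exact ⟨J, fun M hM => by
      rw [dist_comm, dist_eq_norm]
      exact (hdist J hJ.2 M hM t ht).trans_lt hJ.1⟩
  choose! v hv using fun t ht => cauchySeq_tendsto_of_complete (hcau t ht)
  have hunif : TendstoUniformlyOn w v atTop (Set.Icc 0 T) := by
    rw [Metric.tendstoUniformlyOn_iff]
    intro ε hε
    filter_upwards [hδ.eventually (gt_mem_nhds (half_pos hε)), eventually_ge_atTop 1]
      with J hJ hJ1 t ht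
    rw [dist_comm, dist_eq_norm]
    refine lt_of_le_of_lt (le_of_tendsto ((tendsto_const_nhds.sub (hv t ht)).norm) ?_)
      (hJ.trans (half_lt_self hε))
    filter_upwards [eventually_ge_atTop J] with M hM
    exact hdist J hJ1 M hM t ht
  have hvc : ContinuousOn v (Set.Icc 0 T) :=
    hunif.continuousOn (Frequently.of_forall fun N => (hw N).diff.continuousOn)
  -- Constant extension outside `[0, T]` gives a curve that is continuous and bounded for all times.
  let u : ℝ → L2 := fun t => v (Set.projIcc 0 T hT.le t)
  have huv : ∀ t ∈ Set.Icc 0 T, u t = v t := fun t ht => by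
    simp only [u, Set.projIcc_of_mem hT.le ht]
  have huc : Continuous u :=
    (continuousOn_iff_continuous_domRestrict.1 hvc).comp continuous_projIcc
  have hvb : ∀ t ∈ Set.Icc 0 T,
      hsn (1 + α) (fun k => ‖coeff (toC (v t)) k‖ₑ) ≤ ENNReal.ofReal A := fun t ht =>
    (isClosed_hsn_le (1 + α) (ENNReal.ofReal A)).mem_of_tendsto (hv t ht)
      (Eventually.of_forall fun N => (hu₀ N _ (hw N)).bound t ht)
  have hv0 : v 0 = u₀ := by
    refine eq_of_coeff_eq fun k => ?_
    refine tendsto_nhds_unique (((continuous_coeff k).tendsto _).comp (hv 0 h0)) ?_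
    refine tendsto_const_nhds.congr' ?_
    filter_upwards [eventually_mem_box k] with N hN
    exact ((hw N).coeff_init hN).symm
  have hmild : IsMildSolution α T A u₀ u := by
    refine ⟨huc, (huv 0 h0).trans hv0, fun t => hvb _ (Set.projIcc 0 T hT.le t).2, fun t ht k => ?_⟩
    have hsub : Set.uIcc 0 t ⊆ Set.Icc 0 T := by
      rw [Set.uIcc_of_le ht.1]; exact Set.Icc_subset_Icc_right ht.2
    have hcont : ∀ N, ContinuousOn (fun s => rhs α (coeff (toC (w N s))) k) (Set.Icc 0 T) :=
      fun N => (continuous_rhs_coeff α k).comp_continuousOn (hw N).diff.continuousOn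
    have hlim : Tendsto (fun N => ∫ s in (0 : ℝ)..t, rhs α (coeff (toC (w N s))) k) atTop
        (𝓝 (∫ s in (0 : ℝ)..t, rhs α (coeff (toC (u s))) k)) := by
      refine intervalIntegral.tendsto_integral_filter_of_dominated_convergence
        (fun _ => 2 * (A + 256 * (A * A))) (Eventually.of_forall fun N => ?_)
        (Eventually.of_forall fun N => ae_of_all _ fun s hs => ?_) (by simp)
        (ae_of_all _ fun s hs => ?_)
      · exact (((hcont N).mono hsub).mono Set.uIoc_subset_uIcc).aestronglyMeasurable
          measurableSet_uIoc
      · exact norm_rhs_le hα (by linarith)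
          ((hu₀ N _ (hw N)).bound s (hsub (Set.uIoc_subset_uIcc hs))) k
      · have hs' := hsub (Set.uIoc_subset_uIcc hs)
        rw [huv s hs']
        exact ((continuous_rhs_coeff α k).tendsto _).comp (hv s hs')
    rw [huv t ht]
    refine tendsto_nhds_unique (((continuous_coeff k).tendsto _).comp (hv t ht))
      ((tendsto_const_nhds.add hlim).congr' ?_)
    filter_upwards [eventually_mem_box k] with N hN
    rw [Function.comp, integral_eq_sub_of_hasDerivWithinAt_Icc
      (fun s hs => (hw N).isGalerkinCoeff.ode s hs k hN) (hcont N) ht, (hw N).coeff_init hN]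
    ring
  -- An arbitrary family of Galerkin solutions is compared directly with the limit, so uniqueness
  -- for the scheme is not needed.
  refine ⟨u, hmild, fun w' hw' => ?_⟩
  rw [Metric.tendstoUniformlyOn_iff]
  intro ε hε
  filter_upwards [hδ.eventually (gt_mem_nhds hε), eventually_ge_atTop 1] with J hJ hJ1 t ht
  rw [dist_eq_norm]
  refine lt_of_le_of_lt (hst J hJ1 _ _ (hmild.isCoeffSol J) (hu₀ J _ (hw' J)) (fun k hk => ?_) t ht)
    hJ
  rw [hmild.init, (hw' J).coeff_init hk]

end Mild

end FZK
end

/-! ### The time derivative and the equation almost everywhere. -/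

noncomputable section
namespace FZK
open scoped ENNReal NNReal

attribute [local instance] isFiniteMeasure_cell

section TimeDerivative

variable {α T A : ℝ} {u₀ : L2} {u : ℝ → L2}

theorem summable_norm_sq_of_l2n {c : (Fin 2 → ℤ) → ℂ} (h : l2n (fun k => ‖c k‖ₑ) ≠ ∞) :
    Summable fun k => ‖c k‖ ^ 2 := by
  have h1 : ∑' k, ‖c k‖ₑ ^ 2 ≠ ∞ := by
    rw [← l2n_sq (fun k => ‖c k‖ₑ)]
    exact ENNReal.pow_ne_top h
  simpa using ENNReal.summable_toReal h1

theorem box_mono : Monotone box := fun _ _ h _ hk =>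
  mem_box.2 fun j => (mem_box.1 hk j).trans (by exact_mod_cast h)

theorem tendsto_box : Tendsto box atTop atTop :=
  tendsto_atTop_finset_of_monotone box_mono fun k => (eventually_mem_box k).exists

/-- Partial Fourier sums converge in `L²`. -/
theorem tendsto_of_coeff {v : L2} {p : ℕ → L2}
    (h1 : ∀ N, ∀ k ∈ box N, coeff (toC (p N)) k = coeff (toC v) k)
    (h2 : ∀ N, ∀ k ∉ box N, coeff (toC (p N)) k = 0) : Tendsto p atTop (𝓝 v) := by
  have hpi := Real.pi_pos
  have hs := (hasSum_norm_coeff_sq v)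
  have key : ∀ N, ‖p N - v‖ ^ 2 = (2 * Real.pi) ^ 2 * (((2 * Real.pi) ^ 2)⁻¹ * ‖v‖ ^ 2 -
      ∑ k ∈ box N, ‖coeff (toC v) k‖ ^ 2) := by
    intro N
    have h3 := (hasSum_norm_coeff_sq (p N - v))
    have h4 : HasSum (fun k => ‖coeff (toC v) k‖ ^ 2 - (if k ∈ box N then
        ‖coeff (toC v) k‖ ^ 2 else 0)) (((2 * Real.pi) ^ 2)⁻¹ * ‖v‖ ^ 2 -
      ∑ k ∈ box N, ‖coeff (toC v) k‖ ^ 2) := by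
      refine hs.sub ?_
      have h6 : HasSum (fun k => if k ∈ box N then ‖coeff (toC v) k‖ ^ 2 else 0)
          (∑ k ∈ box N, if k ∈ box N then ‖coeff (toC v) k‖ ^ 2 else 0) :=
        hasSum_sum_of_ne_finset_zero fun k hk => if_neg hk
      rwa [Finset.sum_congr rfl fun k hk => if_pos hk] at h6
    have h5 : (fun k => ‖coeff (toC (p N - v)) k‖ ^ 2) = fun k => ‖coeff (toC v) k‖ ^ 2 -
        (if k ∈ box N then ‖coeff (toC v) k‖ ^ 2 else 0) := by
      ext k
      rw [coeff_toC_sub]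
      by_cases hk : k ∈ box N
      · rw [h1 N k hk, if_pos hk]; simp
      · rw [h2 N k hk, if_neg hk]; simp
    rw [h5] at h3
    rw [h4.unique h3, ← mul_assoc, mul_inv_cancel₀ (by positivity), one_mul]
  have hlim : Tendsto (fun N => ‖p N - v‖ ^ 2) atTop (𝓝 0) := by
    simp_rw [key]
    have h7 : Tendsto (fun N => ∑ k ∈ box N, ‖coeff (toC v) k‖ ^ 2) atTop
        (𝓝 (((2 * Real.pi) ^ 2)⁻¹ * ‖v‖ ^ 2)) :=
      (show Tendsto (fun s => ∑ k ∈ s, ‖coeff (toC v) k‖ ^ 2) atTop _ by simpa [HasSum] using hs).comp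
        tendsto_box
    have h8 := (h7.const_sub (((2 * Real.pi) ^ 2)⁻¹ * ‖v‖ ^ 2)).const_mul ((2 * Real.pi) ^ 2)
    rwa [sub_self, mul_zero] at h8
  rw [tendsto_iff_norm_sub_tendsto_zero]
  simpa using hlim.sqrt

theorem IsMildSolution.exists_rhs (hα : α ∈ Set.Icc (1 : ℝ) 2) (hA : 0 ≤ A)
    (h : IsMildSolution α T A u₀ u) :
    ∃ g : ℝ → L2, StronglyMeasurable g ∧ (∀ t, ‖g t‖ ≤ 2 * Real.pi * (2 * (A + 256 * (A * A)))) ∧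
      ∀ t k, coeff (toC (g t)) k = rhs α (coeff (toC (u t))) k := by
  have hb : ∀ t, l2n (fun k => ‖rhs α (coeff (toC (u t))) k‖ₑ) ≤
      ENNReal.ofReal (2 * (A + 256 * (A * A))) := fun t => l2n_rhs_le hα hA (h.bound t)
  choose g hg using fun t => exists_coeff_toC_eq
    (summable_norm_sq_of_l2n (ne_top_of_le_ne_top ENNReal.ofReal_ne_top (hb t)))
    (rhs_neg (coeff_toC_neg (u t)))
  refine ⟨g, ?_, fun t => norm_le_of_l2n_le (by positivity) ?_, hg⟩
  -- The construction supplies continuity in time only mode by mode. Strong measurability follows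
  -- since `g` is a pointwise `L²` limit of its partial Fourier sums, which are continuous.
  · choose S hS using exists_synthesis
    let y : ∀ N, ℝ → (box N → ℂ) := fun N t k => rhs α (coeff (toC (u t))) k
    have hy : ∀ N, Continuous (y N) := fun N =>
      continuous_pi fun k => (continuous_rhs_coeff α k).comp h.cont
    refine stronglyMeasurable_of_tendsto atTop (f := fun N t => S N (y N t))
      (fun N => ((S N).continuous.comp (hy N)).stronglyMeasurable) (tendsto_pi_nhds.2 fun t => ?_)
    refine tendsto_of_coeff (fun N k hk => ?_) fun N k hk => ?_
    · rw [hS, extend_of_mem _ hk, extend_of_mem _ (neg_mem_box.2 hk), hg]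
      simp only [y]
      rw [rhs_neg (coeff_toC_neg (u t)), Complex.conj_conj]; ring
    · rw [hS, extend_of_notMem _ hk, extend_of_notMem _ (mt neg_mem_box.1 hk)]; simp
  · simpa only [hg] using hb t

theorem isTimeDerivative_of_coeff (h : IsMildSolution α T A u₀ u) {g : ℝ → L2} {B : ℝ}
    (hm : StronglyMeasurable g) (hb : ∀ t, ‖g t‖ ≤ B)
    (hg : ∀ t k, coeff (toC (g t)) k = rhs α (coeff (toC (u t))) k) : IsTimeDerivative T u g where
  bounded := memLp_top_of_bound hm.aestronglyMeasurable B (ae_of_all _ hb)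
  integral_eq t ht := by
    refine eq_of_coeff_eq fun k => ?_
    have hi : IntervalIntegrable g volume 0 t :=
      (intervalIntegrable_const (c := B)).mono_fun' hm.aestronglyMeasurable
        (ae_of_all _ fun s => hb s)
    rw [h.eq t ht k, ← coeffCLM_apply k (u 0 + _), map_add,
      ← (coeffCLM k).intervalIntegral_comp_comm hi, coeffCLM_apply, h.init]
    simp only [coeffCLM_apply, hg]

end TimeDerivative

section Equation

variable {α A : ℝ} {v : L2}

theorem summable_norm_of_hsn {s : ℝ} (hs : 2 ≤ s) {c : (Fin 2 → ℤ) → ℂ}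
    (h : hsn s (fun k => ‖c k‖ₑ) ≤ ENNReal.ofReal A) : Summable fun k => ‖c k‖ := by
  have h1 : ∑' k, ‖c k‖ₑ ≠ ∞ := ne_top_of_le_ne_top
    (ENNReal.mul_ne_top (by norm_num) (ne_top_of_le_ne_top ENNReal.ofReal_ne_top h))
    (tsum_le_hsn hs _)
  simpa using ENNReal.summable_toReal h1

/-- The product rule in terms of Fourier coefficients. -/
theorem conv_deriv {c d : (Fin 2 → ℤ) → ℂ} (hc : l2n (fun k => ‖c k‖ₑ) ≠ ∞)
    (hd : l2n (fun k => ‖d k‖ₑ) ≠ ∞) (h : ∀ k, d k = Complex.I * (k 0 : ℂ) * c k)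
    (k : Fin 2 → ℤ) : conv c d k = Complex.I * (k 0 : ℂ) / 2 * conv c c k := by
  have e : conv c d k + conv d c k = Complex.I * (k 0 : ℂ) * conv c c k := by
    unfold conv
    rw [← (summable_conv hc hd k).tsum_add (summable_conv hd hc k), ← tsum_mul_left]
    congr 1; ext l
    rw [h, h]
    simp only [Pi.sub_apply]
    push_cast; ring
  rw [conv_comm d c] at e
  linear_combination (1 / 2) * e

/-- Absolute summability of the coefficients bounds `v` essentially, so multiplication by `v`
preserves `L²`. -/
theorem memLp_mul (hv : Summable fun k => ‖coeff (toC v) k‖) (p : L2) :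
    MemLp (fun x => toC v x * toC p x) 2 (volume.restrict Ω) := by
  refine ((memLp_toC p).const_mul ((∑' k, ‖coeff (toC v) k‖ : ℝ) : ℂ)).of_le
    ((memLp_toC v).1.mul (memLp_toC p).1) ?_
  filter_upwards [toC_ae_eq_series v hv] with x hx
  rw [norm_mul, norm_mul, Complex.norm_real, hx]
  gcongr
  exact (norm_series_le hv x).trans (le_abs_self _)

theorem exists_equation (hα : α ∈ Set.Icc (1 : ℝ) 2)
    (hv : hsn (1 + α) (fun k => ‖coeff (toC v) k‖ₑ) ≤ ENNReal.ofReal A) {g : L2}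
    (hg : ∀ k, coeff (toC g) k = rhs α (coeff (toC v)) k) :
    ∃ p q : L2,
      (∀ k, coeff (toC p) k = Complex.I * (k 0 : ℂ) * coeff (toC v) k) ∧
      (∀ k, coeff (toC q) k =
        Complex.I * (k 0 : ℂ) * ((absPow α k : ℝ) : ℂ) * coeff (toC v) k) ∧
      ∀ᵐ x ∂(volume.restrict Ω), g x - q x + v x * p x = 0 := by
  have hI : ‖Complex.I‖ₑ = 1 := by rw [← ofReal_norm]; simp
  have hfin := ne_top_of_le_ne_top ENNReal.ofReal_ne_top hv
  have hp : l2n (fun k => ‖Complex.I * (k 0 : ℂ) * coeff (toC v) k‖ₑ) ≠ ∞ := by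
    refine ne_top_of_le_ne_top hfin (l2n_mono fun k => ?_)
    rw [enorm_mul, enorm_mul, hI, one_mul]
    gcongr
    exact enorm_fst_le_wt hα k
  have hq : l2n (fun k => ‖Complex.I * (k 0 : ℂ) * ((absPow α k : ℝ) : ℂ) * coeff (toC v) k‖ₑ)
      ≠ ∞ := by
    refine ne_top_of_le_ne_top hfin (l2n_mono fun k => ?_)
    have := ofReal_abs_omega_le hα k
    rw [omega] at this
    push_cast at this
    rw [enorm_mul, mul_assoc, enorm_mul, hI, one_mul]
    gcongr
  obtain ⟨p, hpc⟩ := exists_coeff_toC_eq (summable_norm_sq_of_l2n hp) fun k => by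
    rw [coeff_toC_neg]; simp
  obtain ⟨q, hqc⟩ := exists_coeff_toC_eq (summable_norm_sq_of_l2n hq) fun k => by
    rw [coeff_toC_neg, absPow, normSq_neg, ← absPow]; simp
  refine ⟨p, q, hpc, hqc, ?_⟩
  have hsum := summable_norm_of_hsn (by linarith [hα.1]) hv
  have hvp := memLp_mul hsum p
  have key : (fun x => toC g x + toC v x * toC p x) =ᵐ[volume.restrict Ω] toC q := by
    refine ae_eq_of_coeff_eq ((memLp_toC g).add hvp) (memLp_toC q) fun k => ?_
    rw [coeff_add (memLp_toC g) hvp, coeff_mul (memLp_toC v) (memLp_toC p),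
      conv_deriv (l2n_coeff_ne_top v) (l2n_coeff_ne_top p) hpc, hg, hqc, rhs, omega]
    push_cast; ring
  filter_upwards [key] with x hx
  simp only [toC] at hx
  have hx' : g x + v x * p x = q x := by exact_mod_cast hx
  linarith

end Equation

end FZK
end

/-! ### Smooth periodic functions and the decay of their coefficients. -/

noncomputable section
namespace FZK
open scoped ENNReal NNReal ContDiff

attribute [local instance] isFiniteMeasure_cell

section Continuous

theorem exists_bound_cell {f : Plane → ℂ} (hf : Continuous f) : ∃ K, ∀ x ∈ Ω, ‖f x‖ ≤ K := by
  have h : IsCompact Ω := by unfold Ω; exact isCompact_Icc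
  exact h.exists_bound_of_continuousOn hf.continuousOn

theorem measurableSet_cell : MeasurableSet Ω := by unfold Ω; exact measurableSet_Icc

theorem memLp_of_continuous {f : Plane → ℂ} (hf : Continuous f) :
    MemLp f 2 (volume.restrict Ω) := by
  obtain ⟨K, hK⟩ := exists_bound_cell hf
  exact MemLp.of_bound hf.aestronglyMeasurable K (ae_restrict_of_forall_mem measurableSet_cell hK)

theorem hasSum_norm_coeff_sq_of_continuous {f : Plane → ℂ} (hf : Continuous f) :
    HasSum (fun k => ‖coeff f k‖ ^ 2) (((2 * Real.pi) ^ 2)⁻¹ * ∫ x in Ω, ‖f x‖ ^ 2) := by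
  have h := hasSum_coeff_mul_conj (memLp_of_continuous hf) (memLp_of_continuous hf)
  rw [← Complex.hasSum_ofReal]
  convert h using 1
  · ext k
    rw [Complex.mul_conj, Complex.normSq_eq_norm_sq]
  · push_cast
    congr 1
    rw [ip]
    refine integral_complex_ofReal.symm.trans ?_
    congr 1; ext x
    rw [Complex.mul_conj, Complex.normSq_eq_norm_sq]

theorem sum_norm_coeff_sq_le {f : Plane → ℂ} (hf : Continuous f) {K : ℝ}
    (hK : ∀ x ∈ Ω, ‖f x‖ ≤ K) (s : Finset (Fin 2 → ℤ)) :
    ∑ k ∈ s, ‖coeff f k‖ ^ 2 ≤ (volume.restrict Ω).real Set.univ * K ^ 2 := by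
  have hpi := Real.pi_gt_three
  refine (sum_le_hasSum s (fun k _ => sq_nonneg _) (hasSum_norm_coeff_sq_of_continuous hf)).trans ?_
  have h0 : 0 ≤ ∫ x in Ω, ‖f x‖ ^ 2 := integral_nonneg fun x => sq_nonneg _
  refine (mul_le_of_le_one_left h0 (inv_le_one_of_one_le₀ (by nlinarith))).trans ?_
  have h1 : ∫ x in Ω, ‖f x‖ ^ 2 ≤ ∫ x in Ω, K ^ 2 := by
    refine setIntegral_mono_on ?_ (integrable_const _) measurableSet_cell fun x hx =>
      pow_le_pow_left₀ (norm_nonneg _) (hK x hx) 2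
    exact (memLp_of_continuous hf).integrable_norm_pow'
  refine h1.trans (le_of_eq ?_)
  rw [integral_const, smul_eq_mul]

theorem exists_norm_coeff_le {f : Plane → ℂ} (hf : Continuous f) : ∃ K, ∀ k, ‖coeff f k‖ ≤ K := by
  have h := hasSum_norm_coeff_sq_of_continuous hf
  refine ⟨Real.sqrt _, fun k => Real.le_sqrt_of_sq_le (le_hasSum h k fun j _ => sq_nonneg _)⟩

end Continuous

section Periodic

/-- Smooth functions on the torus. -/
structure SmoothPeriodic (f : Plane → ℂ) : Prop where
  smooth : ContDiff ℝ ∞ f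
  periodic : ∀ (x : Plane) (j : Fin 2), f (x + Pi.single j (2 * Real.pi)) = f x

/-- The partial derivative in the `j`-th direction. -/
def pd (j : Fin 2) (f : Plane → ℂ) (x : Plane) : ℂ := fderiv ℝ f x (Pi.single j 1)

variable {f g : Plane → ℂ}

theorem SmoothPeriodic.pd (hf : SmoothPeriodic f) (j : Fin 2) : SmoothPeriodic (pd j f) where
  smooth := (hf.smooth.fderiv_right (m := ∞) (by simp)).clm_apply contDiff_const
  periodic x i := by
    have h : (fun y => f (y + Pi.single i (2 * Real.pi))) = f := funext fun y => hf.periodic y i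
    rw [FZK.pd, FZK.pd, ← fderiv_comp_add_right, h]

theorem SmoothPeriodic.mul (hf : SmoothPeriodic f) (hg : SmoothPeriodic g) :
    SmoothPeriodic fun x => f x * g x where
  smooth := hf.smooth.mul hg.smooth
  periodic x j := by rw [hf.periodic, hg.periodic]

theorem smoothPeriodic_expMode (k : Fin 2 → ℤ) : SmoothPeriodic (expMode k) where
  smooth := by
    unfold expMode
    refine (contDiff_const.mul ((contDiff_const.mul ?_).add (contDiff_const.mul ?_))).cexp
    · exact Complex.ofRealCLM.contDiff.comp (contDiff_apply ℝ ℝ (0 : Fin 2))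
    · exact Complex.ofRealCLM.contDiff.comp (contDiff_apply ℝ ℝ (1 : Fin 2))
  periodic x j := by
    unfold expMode
    rw [Complex.exp_eq_exp_iff_exists_int]
    refine ⟨k j, ?_⟩
    fin_cases j <;> simp <;> ring

/-- The integral of a derivative over the torus vanishes. -/
theorem integral_pd_eq_zero (hf : SmoothPeriodic f) (j : Fin 2) : ∫ x in Ω, pd j f x = 0 := by
  have hpi := Real.pi_pos
  have hd : ∀ x, HasFDerivAt f (fderiv ℝ f x) x := fun x =>
    (hf.smooth.differentiable (by simp) x).hasFDerivAt
  -- The divergence theorem for the field whose only nonzero component is `f` in direction `j`; its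
  -- ambient dimension is `n + 1`, so `n = 1`.
  have h := integral_divergence_of_hasFDerivAt_off_countable' (n := 1) (fun _ => -Real.pi)
    (fun _ => Real.pi) (fun _ => by linarith) (fun i x => if i = j then f x else 0)
    (fun i x => if i = j then fderiv ℝ f x else 0) ∅ Set.countable_empty
    (fun i => by
      by_cases hi : i = j
      · simp only [if_pos hi]; exact hf.smooth.continuous.continuousOn
      · simp only [if_neg hi]; exact continuousOn_const)
    (fun x _ i => by
      by_cases hi : i = j
      · simp only [if_pos hi]; exact hd x
      · simp only [if_neg hi]; exact hasFDerivAt_const _ _)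
    (by
      refine Continuous.integrableOn_Icc ?_
      refine continuous_finsetSum _ fun i _ => ?_
      by_cases hi : i = j
      · simp only [if_pos hi]; exact (hf.pd i).smooth.continuous
      · simp only [if_neg hi, zero_apply]; exact continuous_const)
  have e : ∀ x, ∑ i, (if i = j then fderiv ℝ f x else 0) (Pi.single i 1) = pd j f x := by
    intro x
    rw [Finset.sum_eq_single j (fun i _ hi => by rw [if_neg hi]; rfl) (by simp), if_pos rfl]
    rfl
  simp only [e] at h
  rw [Ω, h]
  refine Finset.sum_eq_zero fun i _ => ?_
  by_cases hi : i = j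
  · simp only [if_pos hi]
    rw [sub_eq_zero]
    congr 1; ext x
    -- Opposite faces of the cell differ by a period, so their integrals cancel.
    rw [← hf.periodic (i.insertNth (-Real.pi) x) i]
    congr 1; ext m
    rcases Fin.eq_self_or_eq_succAbove i m with rfl | ⟨l, rfl⟩
    · simp; ring
    · simp
  · simp [if_neg hi]

theorem pd_expMode (j : Fin 2) (k : Fin 2 → ℤ) (x : Plane) :
    pd j (expMode k) x = Complex.I * (k j : ℂ) * expMode k x := by
  have h : ∀ i : Fin 2, HasFDerivAt (fun x : Plane => ((x i : ℝ) : ℂ))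
      (Complex.ofRealCLM.comp (ContinuousLinearMap.proj (R := ℝ) (φ := fun _ : Fin 2 => ℝ) i)) x :=
    fun i => (Complex.ofRealCLM.comp
      (ContinuousLinearMap.proj (R := ℝ) (φ := fun _ : Fin 2 => ℝ) i)).hasFDerivAt
  have h1 : HasFDerivAt (expMode k) _ x :=
    ((((h 0).const_mul (k 0 : ℂ)).add ((h 1).const_mul (k 1 : ℂ))).const_mul Complex.I).cexp
  rw [pd, h1.fderiv]
  fin_cases j <;> simp [expMode] <;> ring

theorem pd_mul (hf : SmoothPeriodic f) (hg : SmoothPeriodic g) (j : Fin 2) (x : Plane) :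
    pd j (fun x => f x * g x) x = pd j f x * g x + f x * pd j g x := by
  have h1 := (hf.smooth.differentiable (by simp) x).hasFDerivAt
  have h2 := (hg.smooth.differentiable (by simp) x).hasFDerivAt
  have h3 : HasFDerivAt (fun x => f x * g x) _ x := h1.mul h2
  rw [pd, h3.fderiv]
  simp [pd]; ring

/-- Fourier coefficients of derivatives of smooth periodic functions. -/
theorem coeff_pd (hf : SmoothPeriodic f) (j : Fin 2) (k : Fin 2 → ℤ) :
    coeff (pd j f) k = Complex.I * (k j : ℂ) * coeff f k := by
  have h := integral_pd_eq_zero (hf.mul (smoothPeriodic_expMode (-k))) j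
  have e : ∀ x, pd j (fun x => f x * expMode (-k) x) x =
      pd j f x * (starRingEnd ℂ) (expMode k x) +
        (-(Complex.I * (k j : ℂ)) * f x) * (starRingEnd ℂ) (expMode k x) := by
    intro x
    rw [pd_mul hf (smoothPeriodic_expMode _), pd_expMode, conj_expMode]
    simp; ring
  simp only [e] at h
  rw [integral_add (integrable_mul_conj (memLp_of_continuous (hf.pd j).smooth.continuous)
    (memLp_expMode k)) (integrable_mul_conj ((memLp_of_continuous hf.smooth.continuous).const_mul _)
    (memLp_expMode k))] at h
  have h2 : coeff (pd j f) k + coeff (fun x => -(Complex.I * (k j : ℂ)) * f x) k = 0 := by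
    rw [coeff, coeff, ip, ip, ← mul_add, h, mul_zero]
  rw [coeff_const_mul] at h2
  linear_combination h2

theorem SmoothPeriodic.exists_pow_mul_coeff_le (hf : SmoothPeriodic f) (j : Fin 2) (n : ℕ) :
    ∃ K, ∀ k : Fin 2 → ℤ, |(k j : ℝ)| ^ n * ‖coeff f k‖ ≤ K := by
  induction n generalizing f with
  | zero => simpa using exists_norm_coeff_le hf.smooth.continuous
  | succ n ih =>
    obtain ⟨K, hK⟩ := ih (hf.pd j)
    refine ⟨K, fun k => ?_⟩
    refine le_trans (le_of_eq ?_) (hK k)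
    rw [coeff_pd hf, norm_mul, norm_mul, Complex.norm_I, Complex.norm_intCast]; ring

theorem summable_jb_inv_four : Summable fun k => (jb k ^ 4)⁻¹ := by
  have h : ∑' k, ENNReal.ofReal ((jb k ^ 4)⁻¹) ≠ ⊤ := by
    refine ne_top_of_le_ne_top (by norm_num) (le_trans (le_of_eq ?_) (tsum_wt_inv_sq_le le_rfl))
    congr 1; ext k
    have := jb_pos k
    rw [wt, ← ENNReal.ofReal_inv_of_pos (by positivity), ← ENNReal.ofReal_pow (by positivity)]
    congr 1
    rw [show (2 : ℝ) = ((2 : ℕ) : ℝ) by norm_num, Real.rpow_natCast]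
    field_simp
  have h1 := ENNReal.summable_toReal h
  have h2 : ∀ k, (ENNReal.ofReal ((jb k ^ 4)⁻¹)).toReal = (jb k ^ 4)⁻¹ := fun k =>
    ENNReal.toReal_ofReal (by have := jb_pos k; positivity)
  simpa only [h2] using h1

/-- Rapid decay of the Fourier coefficients of smooth periodic functions. -/
theorem SmoothPeriodic.summable_jb_pow_mul (hf : SmoothPeriodic f) :
    Summable fun k => jb k ^ 4 * ‖coeff f k‖ := by
  -- Eight powers: four for the weight in the claim and four for the summable majorant `⟨k⟩⁻⁴`.
  obtain ⟨K0, h0⟩ := hf.exists_pow_mul_coeff_le 0 8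
  obtain ⟨K1, h1⟩ := hf.exists_pow_mul_coeff_le 1 8
  obtain ⟨K2, h2⟩ := hf.exists_pow_mul_coeff_le 0 0
  refine Summable.of_nonneg_of_le (fun k => by have := jb_pos k; positivity) (fun k => ?_)
    (summable_jb_inv_four.mul_left (27 * (K0 + K1 + K2)))
  have hj := jb_pos k
  rw [← div_eq_mul_inv, le_div_iff₀ (by positivity)]
  have h3 : jb k ^ 8 ≤ 27 * (|(k 0 : ℝ)| ^ 8 + |(k 1 : ℝ)| ^ 8 + 1) := by
    have e : jb k ^ 8 = (1 + (|(k 0 : ℝ)| ^ 2 + |(k 1 : ℝ)| ^ 2)) ^ 4 := by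
      rw [sq_abs, sq_abs, show (8 : ℕ) = 2 * 4 by norm_num, pow_mul, jb_sq]; rfl
    rw [e, show |(k 0 : ℝ)| ^ 8 = (|(k 0 : ℝ)| ^ 2) ^ 4 by ring,
      show |(k 1 : ℝ)| ^ 8 = (|(k 1 : ℝ)| ^ 2) ^ 4 by ring]
    generalize |(k 0 : ℝ)| ^ 2 = a
    generalize |(k 1 : ℝ)| ^ 2 = b
    have hsq : (1 + (a + b)) ^ 2 ≤ 3 * (1 + a ^ 2 + b ^ 2) := by
      nlinarith [sq_nonneg (a - b), sq_nonneg (a - 1), sq_nonneg (b - 1)]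
    have hsq2 : (1 + a ^ 2 + b ^ 2) ^ 2 ≤ 3 * (1 + a ^ 4 + b ^ 4) := by
      nlinarith [sq_nonneg (a ^ 2 - b ^ 2), sq_nonneg (a ^ 2 - 1), sq_nonneg (b ^ 2 - 1)]
    calc (1 + (a + b)) ^ 4 = ((1 + (a + b)) ^ 2) ^ 2 := by ring
      _ ≤ (3 * (1 + a ^ 2 + b ^ 2)) ^ 2 := pow_le_pow_left₀ (sq_nonneg _) hsq 2
      _ = 9 * (1 + a ^ 2 + b ^ 2) ^ 2 := by ring
      _ ≤ _ := by linarith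
  calc jb k ^ 4 * ‖coeff f k‖ * jb k ^ 4 = jb k ^ 8 * ‖coeff f k‖ := by ring
    _ ≤ 27 * (|(k 0 : ℝ)| ^ 8 + |(k 1 : ℝ)| ^ 8 + 1) * ‖coeff f k‖ := by gcongr
    _ = 27 * (|(k 0 : ℝ)| ^ 8 * ‖coeff f k‖ + |(k 1 : ℝ)| ^ 8 * ‖coeff f k‖ +
        |(k 0 : ℝ)| ^ 0 * ‖coeff f k‖) := by ring
    _ ≤ _ := by
        have := h0 k; have := h1 k; have := h2 k
        linarith

end Periodic

end FZK
end

/-! ### Mild solutions satisfy the weak formulation. -/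

noncomputable section
namespace FZK
open scoped ENNReal NNReal ContDiff

attribute [local instance] isFiniteMeasure_cell

section WeakForm

variable {α T A : ℝ} {u₀ : L2} {u : ℝ → L2} {φ : ℝ → Plane → ℂ}

theorem pderiv_eq_pd (f : Plane → ℂ) : pderiv f = pd 0 f := rfl

/-- The multiplier costs at most `⟨k⟩³` since `α ≤ 2`, and smoothness provides four powers. -/
theorem summable_fracLap_coeff (hα : α ∈ Set.Icc (1 : ℝ) 2) {f : Plane → ℂ}
    (hf : SmoothPeriodic f) :
    Summable fun k => ‖((absPow α k : ℝ) : ℂ) * coeff (pderiv f) k‖ := by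
  refine Summable.of_nonneg_of_le (fun k => norm_nonneg _) (fun k => ?_) hf.summable_jb_pow_mul
  rw [pderiv_eq_pd, coeff_pd hf, norm_mul, norm_mul, norm_mul, Complex.norm_I, one_mul,
    Complex.norm_intCast, Complex.norm_real, Real.norm_eq_abs, abs_of_nonneg (absPow_nonneg _ _),
    ← mul_assoc]
  refine mul_le_mul_of_nonneg_right ?_ (norm_nonneg _)
  have hj := one_le_jb k
  have h1 : absPow α k ≤ jb k ^ 2 := by
    rw [← Real.rpow_natCast]
    refine (Real.rpow_le_rpow (Real.sqrt_nonneg _) (nrm_le_jb k) (by linarith [hα.1])).trans ?_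
    exact Real.rpow_le_rpow_of_exponent_le hj (by exact_mod_cast hα.2)
  have h2 : |(k 0 : ℝ)| ≤ jb k := (abs_fst_le k).trans (nrm_le_jb k)
  calc absPow α k * |(k 0 : ℝ)| ≤ jb k ^ 2 * jb k :=
        mul_le_mul h1 h2 (abs_nonneg _) (by positivity)
    _ = jb k ^ 3 := by ring
    _ ≤ jb k ^ 4 := pow_le_pow_right₀ hj (by norm_num)

theorem coeff_fracLap_pderiv (hα : α ∈ Set.Icc (1 : ℝ) 2) {f : Plane → ℂ}
    (hf : SmoothPeriodic f) (k : Fin 2 → ℤ) :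
    coeff (fracLap α (pderiv f)) k =
      ((absPow α k : ℝ) : ℂ) * (Complex.I * (k 0 : ℂ) * coeff f k) := by
  rw [fracLap_eq_series, coeff_series (summable_fracLap_coeff hα hf), pderiv_eq_pd, coeff_pd hf]

/-- The integrand of the weak formulation in terms of Fourier coefficients. -/
theorem hasSum_weak (hα : α ∈ Set.Icc (1 : ℝ) 2) {v : L2}
    (hv : Summable fun k => ‖coeff (toC v) k‖) {f f' : Plane → ℂ} (hf : SmoothPeriodic f)
    (hf' : Continuous f') :
    HasSum (fun k => coeff (toC v) k * (starRingEnd ℂ) (coeff f' k) +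
        rhs α (coeff (toC v)) k * (starRingEnd ℂ) (coeff f k))
      (((2 * (Real.pi : ℂ)) ^ 2)⁻¹ * (ip (toC v) f' - ip (toC v) (fracLap α (pderiv f))
        + (1 / 2) * ip (fun x => toC v x ^ 2) (pderiv f))) := by
  have hsq : MemLp (fun x => toC v x ^ 2) 2 (volume.restrict Ω) := by
    simpa only [sq] using memLp_mul hv v
  have h1 := hasSum_coeff_mul_conj (memLp_toC v) (memLp_of_continuous hf')
  have h2 := hasSum_coeff_mul_conj (memLp_toC v)
    (show MemLp (fracLap α (pderiv f)) 2 _ from memLp_series (summable_fracLap_coeff hα hf))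
  have h3 := hasSum_coeff_mul_conj hsq (g := pderiv f)
    (memLp_of_continuous (hf.pd 0).smooth.continuous)
  have h := (h1.sub h2).add (h3.mul_left (1 / 2))
  rw [mul_add, mul_sub, mul_left_comm _ (1 / 2 : ℂ)]
  refine Eq.subst (motive := fun F => HasSum F _) (funext fun k => ?_) h
  rw [coeff_sq, coeff_fracLap_pderiv hα hf, pderiv_eq_pd, coeff_pd hf, rhs, omega]
  simp only [map_mul, Complex.conj_I, Complex.conj_ofReal, map_intCast]
  push_cast; ring

theorem IsTestFunction.smoothPeriodic (h : IsTestFunction T φ) (t : ℝ) :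
    SmoothPeriodic (φ t) where
  smooth := h.smooth.comp (contDiff_const.prodMk contDiff_id)
  periodic := h.periodic t

theorem IsTestFunction.continuous (h : IsTestFunction T φ) :
    Continuous fun p : ℝ × Plane => φ p.1 p.2 := h.smooth.continuous

theorem IsTestFunction.hasDerivAt (h : IsTestFunction T φ) (t : ℝ) (x : Plane) :
    HasDerivAt (fun s => φ s x) (fderiv ℝ (fun p : ℝ × Plane => φ p.1 p.2) (t, x) (1, 0)) t := by
  have h1 := (h.smooth.differentiable (by simp) (t, x)).hasFDerivAt
  have h2 : HasDerivAt (fun s : ℝ => (s, x)) ((1 : ℝ), (0 : Plane)) t :=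
    (hasDerivAt_id t).prodMk (hasDerivAt_const t x)
  exact h1.comp_hasDerivAt t h2

theorem IsTestFunction.continuous_deriv (h : IsTestFunction T φ) :
    Continuous fun p : ℝ × Plane => deriv (fun s => φ s p.2) p.1 := by
  simp only [(h.hasDerivAt _ _).deriv]
  exact ((h.smooth.fderiv_right (m := ∞) (by simp)).clm_apply contDiff_const).continuous

theorem exists_bound_strip {F : ℝ × Plane → ℂ} (hF : Continuous F) (a b : ℝ) :
    ∃ K, ∀ t ∈ Set.Icc a b, ∀ x ∈ Ω, ‖F (t, x)‖ ≤ K := by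
  have h : IsCompact (Set.Icc a b ×ˢ Ω) := isCompact_Icc.prod (by unfold Ω; exact isCompact_Icc)
  obtain ⟨K, hK⟩ := h.exists_bound_of_continuousOn hF.continuousOn
  exact ⟨K, fun t ht x hx => hK _ ⟨ht, hx⟩⟩

theorem continuous_coeff_param {F : ℝ × Plane → ℂ} (hF : Continuous F) (k : Fin 2 → ℤ) :
    Continuous fun t => coeff (fun x => F (t, x)) k := by
  unfold coeff ip
  refine continuous_const.mul (continuous_parametric_integral_of_continuous
    (f := fun t x => F (t, x) * (starRingEnd ℂ) (expMode k x)) ?_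
    (by unfold Ω; exact isCompact_Icc))
  exact hF.mul (Complex.continuous_conj.comp ((continuous_expMode k).comp continuous_snd))

theorem IsTestFunction.hasDerivAt_coeff (h : IsTestFunction T φ) (k : Fin 2 → ℤ) (t : ℝ) :
    HasDerivAt (fun s => coeff (φ s) k) (coeff (fun x => deriv (fun s => φ s x) t) k) t := by
  obtain ⟨K, hK⟩ := exists_bound_strip h.continuous_deriv (t - 1) (t + 1)
  have hc : ∀ s, Continuous (φ s) := fun s => (h.smoothPeriodic s).smooth.continuous
  have hd : Continuous fun x => deriv (fun s => φ s x) t :=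
    h.continuous_deriv.comp (continuous_const.prodMk continuous_id)
  have he := Complex.continuous_conj.comp (continuous_expMode k)
  have key := (hasDerivAt_integral_of_dominated_loc_of_deriv_le (μ := volume.restrict Ω)
    (F := fun s x => φ s x * (starRingEnd ℂ) (expMode k x))
    (F' := fun s x => deriv (fun s => φ s x) s * (starRingEnd ℂ) (expMode k x))
    (x₀ := t) (s := Set.Icc (t - 1) (t + 1)) (bound := fun _ => K)
    (Icc_mem_nhds (by linarith) (by linarith))
    (Eventually.of_forall fun s => ((hc s).mul he).aestronglyMeasurable)
    (integrable_mul_conj (memLp_of_continuous (hc t)) (memLp_expMode k))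
    (hd.mul he).aestronglyMeasurable
    (ae_restrict_of_forall_mem measurableSet_cell fun x hx s hs => by
      rw [norm_mul, RCLike.norm_conj, norm_expMode, mul_one]; exact hK s hs x hx)
    (integrable_const _)
    (ae_of_all _ fun x s _ => by
      have := h.hasDerivAt s x
      rw [this.deriv]
      exact this.mul_const _)).2
  exact key.const_mul _

/-- By Parseval the weak integrand is a sum over modes of exact time derivatives. Each integrates to
its boundary value, and dominated convergence sums over the modes. -/
theorem IsMildSolution.isWeakSolution (hα : α ∈ Set.Icc (1 : ℝ) 2) (hT : 0 < T) (hA : 0 ≤ A)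
    (h : IsMildSolution α T A u₀ u) : IsWeakSolution α T u₀ u where
  bounded := memLp_top_of_bound h.cont.aestronglyMeasurable (2 * Real.pi * A)
    (ae_of_all _ fun t => norm_le_of_hsn_le hα hA (h.bound t))
  weak φ hφ := by
    have hpi : (Real.pi : ℂ) ≠ 0 := by exact_mod_cast Real.pi_ne_zero
    obtain ⟨g, hgm, hgb, hg⟩ := h.exists_rhs hα hA
    set B : ℝ := 2 * Real.pi * (2 * (A + 256 * (A * A))) with hB
    have hub : ∀ t, ‖u t‖ ≤ 2 * Real.pi * A := fun t => norm_le_of_hsn_le hα hA (h.bound t)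
    obtain ⟨K, hK⟩ := exists_bound_strip hφ.continuous 0 T
    obtain ⟨K', hK'⟩ := exists_bound_strip hφ.continuous_deriv 0 T
    set Φ : (Fin 2 → ℤ) → ℝ → ℂ := fun k t =>
      coeff (toC (u t)) k * (starRingEnd ℂ) (coeff (fun x => deriv (fun s => φ s x) t) k) +
        rhs α (coeff (toC (u t))) k * (starRingEnd ℂ) (coeff (φ t) k) with hΦ
    have hdt : ∀ t, Continuous fun x => deriv (fun s => φ s x) t := fun t =>
      hφ.continuous_deriv.comp (continuous_const.prodMk continuous_id)
    have hsum : ∀ t, HasSum (fun k => Φ k t) _ := fun t =>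
      hasSum_weak hα (summable_norm_of_hsn (by linarith [hα.1]) (h.bound t))
        (hφ.smoothPeriodic t) (hdt t)
    have hΦc : ∀ k, Continuous (Φ k) := by
      intro k
      refine (((continuous_coeff k).comp h.cont).mul (Complex.continuous_conj.comp ?_)).add
        (((continuous_rhs_coeff α k).comp h.cont).mul (Complex.continuous_conj.comp ?_))
      · exact continuous_coeff_param hφ.continuous_deriv k
      · exact continuous_coeff_param hφ.continuous k
    -- `Φ k` is the derivative of `coeff (toC (u t)) k` times the conjugate of `coeff (φ t) k`, and
    -- the test function vanishes at `T`.
    have hint : ∀ k, ∫ t in (0 : ℝ)..T, Φ k t =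
        -(coeff (toC u₀) k * (starRingEnd ℂ) (coeff (φ 0) k)) := by
      intro k
      obtain ⟨T', hT', hz⟩ := hφ.support
      have hd : ∀ t ∈ Set.Icc 0 T, HasDerivWithinAt
          (fun t => coeff (toC (u t)) k * (starRingEnd ℂ) (coeff (φ t) k)) (Φ k t)
          (Set.Icc 0 T) t := by
        intro t ht
        have h1 := (h.hasDeriv ht k).mul (Complex.conjCLE.hasFDerivAt.comp_hasDerivWithinAt t
          (hφ.hasDerivAt_coeff k t).hasDerivWithinAt)
        refine h1.congr_deriv ?_
        simp only [hΦ]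
        rw [add_comm]; rfl
      rw [integral_eq_sub_of_hasDerivWithinAt_Icc hd (hΦc k).continuousOn ⟨hT.le, le_rfl⟩]
      have hzT : coeff (φ T) k = 0 := by
        have : φ T = fun _ => 0 := funext fun x => hz T hT'.le x
        simp [coeff, ip, this]
      rw [hzT, h.init]; simp
    -- A majorant uniform in `N`: products are bounded by sums of squares, then Bessel's inequality
    -- applies to each of the four families.
    have hbound : ∀ N, ∀ t ∈ Set.Icc 0 T, ‖∑ k ∈ box N, Φ k t‖ ≤
        (2 * Real.pi * A) ^ 2 + (volume.restrict Ω).real Set.univ * K' ^ 2 +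
          (B ^ 2 + (volume.restrict Ω).real Set.univ * K ^ 2) := by
      intro N t ht
      have hL2 : ∀ v : L2, ∑ k ∈ box N, ‖coeff (toC v) k‖ ^ 2 ≤ ‖v‖ ^ 2 := fun v => by
        refine (sum_le_hasSum _ (fun k _ => sq_nonneg _) (hasSum_norm_coeff_sq v)).trans ?_
        refine mul_le_of_le_one_left (sq_nonneg _) (inv_le_one_of_one_le₀ ?_)
        nlinarith [Real.pi_gt_three]
      have h1 := (hL2 (u t)).trans (pow_le_pow_left₀ (norm_nonneg _) (hub t) 2)
      have h2 := (hL2 (g t)).trans (pow_le_pow_left₀ (norm_nonneg _) (hgb t) 2)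
      have h3 := sum_norm_coeff_sq_le (hdt t) (hK' t ht) (box N)
      have h4 := sum_norm_coeff_sq_le (hφ.smoothPeriodic t).smooth.continuous (hK t ht) (box N)
      simp only [hg] at h2
      refine le_trans (norm_sum_le_of_le _ (n := fun k =>
        (‖coeff (toC (u t)) k‖ ^ 2 + ‖coeff (fun x => deriv (fun s => φ s x) t) k‖ ^ 2) +
        (‖rhs α (coeff (toC (u t))) k‖ ^ 2 + ‖coeff (φ t) k‖ ^ 2)) fun k _ => ?_) ?_
      · refine (norm_add_le _ _).trans (add_le_add ?_ ?_)
        · rw [norm_mul, RCLike.norm_conj]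
          nlinarith [sq_nonneg (‖coeff (toC (u t)) k‖ - ‖coeff (fun x => deriv (fun s => φ s x) t) k‖),
            sq_nonneg (‖coeff (toC (u t)) k‖), sq_nonneg ‖coeff (fun x => deriv (fun s => φ s x) t) k‖]
        · rw [norm_mul, RCLike.norm_conj]
          nlinarith [sq_nonneg (‖rhs α (coeff (toC (u t))) k‖ - ‖coeff (φ t) k‖),
            sq_nonneg ‖rhs α (coeff (toC (u t))) k‖, sq_nonneg ‖coeff (φ t) k‖]
      · simp only [Finset.sum_add_distrib]
        exact add_le_add (add_le_add h1 h3) (add_le_add h2 h4)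
    have hlim : Tendsto (fun N => ∫ t in (0 : ℝ)..T, ∑ k ∈ box N, Φ k t) atTop
        (𝓝 (∫ t in (0 : ℝ)..T, ((2 * (Real.pi : ℂ)) ^ 2)⁻¹ *
          (ip (toC (u t)) (fun x => deriv (fun s => φ s x) t)
          - ip (toC (u t)) (fracLap α (pderiv (φ t)))
          + (1 / 2) * ip (fun x => toC (u t) x ^ 2) (pderiv (φ t))))) := by
      refine intervalIntegral.tendsto_integral_filter_of_dominated_convergence
        (fun _ => (2 * Real.pi * A) ^ 2 + (volume.restrict Ω).real Set.univ * K' ^ 2 +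
          (B ^ 2 + (volume.restrict Ω).real Set.univ * K ^ 2))
        (Eventually.of_forall fun N => ?_) (Eventually.of_forall fun N => ae_of_all _ fun t ht => ?_)
        (by simp) (ae_of_all _ fun t _ => ?_)
      · exact (continuous_finsetSum _ fun k _ => hΦc k).aestronglyMeasurable
      · rw [Set.uIoc_of_le hT.le] at ht
        exact hbound N t ⟨ht.1.le, ht.2⟩
      · have := hsum t
        exact (show Tendsto (fun s => ∑ k ∈ s, Φ k t) atTop _ by simpa [HasSum] using this).comp
          tendsto_box
    have hlim2 : Tendsto (fun N => ∫ t in (0 : ℝ)..T, ∑ k ∈ box N, Φ k t) atTop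
        (𝓝 (-(((2 * (Real.pi : ℂ)) ^ 2)⁻¹ * ip (toC u₀) (φ 0)))) := by
      have e : ∀ N, ∫ t in (0 : ℝ)..T, ∑ k ∈ box N, Φ k t =
          -∑ k ∈ box N, coeff (toC u₀) k * (starRingEnd ℂ) (coeff (φ 0) k) := by
        intro N
        rw [intervalIntegral.integral_finsetSum fun k _ => (hΦc k).intervalIntegrable _ _,
          ← Finset.sum_neg_distrib]
        exact Finset.sum_congr rfl fun k _ => hint k
      simp_rw [e]
      have h5 := hasSum_coeff_mul_conj (memLp_toC u₀)
        (memLp_of_continuous (hφ.smoothPeriodic 0).smooth.continuous)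
      refine Tendsto.neg ?_
      exact (show Tendsto (fun s => ∑ k ∈ s, coeff (toC u₀) k * (starRingEnd ℂ) (coeff (φ 0) k))
        atTop _ by simpa [HasSum] using h5).comp tendsto_box
    have h6 := tendsto_nhds_unique hlim hlim2
    rw [intervalIntegral.integral_const_mul, ← mul_neg] at h6
    have h7 := mul_left_cancel₀ (inv_ne_zero (pow_ne_zero 2 (mul_ne_zero two_ne_zero hpi))) h6
    rw [h7]; ring

end WeakForm

end FZK
end

/-! ### Uniqueness of strong solutions. -/

noncomputable section
namespace FZK
open scoped ENNReal NNReal ContDiff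

section Uniqueness

variable {α T A : ℝ} {u₀ : L2} {u v : ℝ → L2}

/-- An open subset of `(0, T)` of measure zero is empty; closedness then adds the endpoints. -/
theorem Icc_subset_of_ae_mem {S : Set ℝ} (hT : 0 < T) (hS : IsClosed S)
    (h : ∀ᵐ t, t ∈ Set.Ioo 0 T → t ∈ S) : Set.Icc 0 T ⊆ S := by
  have h1 : Set.Ioo 0 T ∩ Sᶜ = ∅ := by
    refine (isOpen_Ioo.inter hS.isOpen_compl).eq_empty_of_measure_zero (μ := volume) ?_
    refine measure_mono_null (fun t ht => ?_) h
    exact fun hn => ht.2 (hn ht.1)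
  rw [← closure_Ioo hT.ne]
  refine closure_minimal (fun t ht => ?_) hS
  by_contra hn
  exact (h1 ▸ ⟨ht, hn⟩ : t ∈ (∅ : Set ℝ))

/-- The primitive of a compactly supported smooth function, normalized to vanish at `T`. -/
def primitive (T : ℝ) (ψ : ℝ → ℝ) (t : ℝ) : ℝ := ∫ s in T..t, ψ s

theorem hasDerivAt_primitive {ψ : ℝ → ℝ} (hψ : Continuous ψ) (t : ℝ) :
    HasDerivAt (primitive T ψ) (ψ t) t := (hψ.integral_hasStrictDerivAt T t).hasDerivAt

theorem contDiff_primitive {ψ : ℝ → ℝ} (hψ : ContDiff ℝ ∞ ψ) : ContDiff ℝ ∞ (primitive T ψ) := by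
  refine contDiff_infty_iff_deriv.2 ⟨fun t => (hasDerivAt_primitive hψ.continuous t).differentiableAt,
    ?_⟩
  have e : deriv (primitive T ψ) = ψ := funext fun t => (hasDerivAt_primitive hψ.continuous t).deriv
  rwa [e]

/-- The primitive vanishes near `T` but not necessarily at 0, which is how the test function sees
the initial data. -/
theorem isTestFunction_primitive {ψ : ℝ → ℝ} (hψ : ContDiff ℝ ∞ ψ) (hc : HasCompactSupport ψ)
    (hs : tsupport ψ ⊆ Set.Ioo 0 T) (k : Fin 2 → ℤ) :
    IsTestFunction T fun t x => ((primitive T ψ t : ℝ) : ℂ) * expMode k x where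
  smooth := (Complex.ofRealCLM.contDiff.comp ((contDiff_primitive hψ).comp contDiff_fst)).mul
    ((smoothPeriodic_expMode k).smooth.comp contDiff_snd)
  periodic t x j := by rw [(smoothPeriodic_expMode k).periodic]
  support := by
    obtain ⟨T', hT', hb⟩ : ∃ T' < T, ∀ s, T' ≤ s → ψ s = 0 := by
      rcases (tsupport ψ).eq_empty_or_nonempty with he | hne
      · refine ⟨T - 1, by linarith, fun s _ => ?_⟩
        rw [tsupport_eq_empty_iff] at he
        rw [he]; rfl
      · obtain ⟨m, hm, hmax⟩ := hc.isCompact.exists_isGreatest hne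
        have hmT := (hs hm).2
        refine ⟨(m + T) / 2, by linarith, fun s hs => ?_⟩
        by_contra hne
        have := hmax (subset_tsupport ψ (Function.mem_support.2 hne))
        linarith
    refine ⟨T', hT', fun t ht x => ?_⟩
    have h0 : primitive T ψ t = 0 := by
      rw [primitive, intervalIntegral.integral_congr (g := fun _ => (0 : ℝ)) fun s hs => ?_]
      · simp
      · refine hb s ?_
        rw [Set.uIcc, Set.mem_Icc] at hs
        exact (le_min hT'.le ht).trans hs.1
    rw [h0]; simp

theorem coeff_const_mul_expMode (z : ℂ) (k l : Fin 2 → ℤ) :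
    coeff (fun x => z * expMode k x) l = if l = k then z else 0 := by
  rw [coeff_const_mul, coeff_expMode]; simp

theorem smoothPeriodic_const_mul_expMode (z : ℂ) (k : Fin 2 → ℤ) :
    SmoothPeriodic fun x => z * expMode k x where
  smooth := contDiff_const.mul (smoothPeriodic_expMode k).smooth
  periodic x j := by rw [(smoothPeriodic_expMode k).periodic]

/-- The integrand of the weak formulation for a test function `η(t) e^{i k·x}`. -/
theorem weak_integrand_expMode (hα : α ∈ Set.Icc (1 : ℝ) 2) {v : L2}
    (hv : Summable fun k => ‖coeff (toC v) k‖) (η ψ : ℝ) (k : Fin 2 → ℤ) :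
    ip (toC v) (fun x => (ψ : ℂ) * expMode k x)
      - ip (toC v) (fracLap α (pderiv fun x => (η : ℂ) * expMode k x))
      + (1 / 2) * ip (fun x => toC v x ^ 2) (pderiv fun x => (η : ℂ) * expMode k x) =
    (2 * (Real.pi : ℂ)) ^ 2 * (coeff (toC v) k * ψ + rhs α (coeff (toC v)) k * η) := by
  have hpi : (Real.pi : ℂ) ≠ 0 := by exact_mod_cast Real.pi_ne_zero
  have h := hasSum_weak hα hv (smoothPeriodic_const_mul_expMode (η : ℂ) k)
    (smoothPeriodic_const_mul_expMode (ψ : ℂ) k).smooth.continuous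
  simp only [coeff_const_mul_expMode] at h
  have h2 := h.unique (hasSum_single k fun l hl => by simp [if_neg hl])
  rw [if_pos rfl, if_pos rfl, Complex.conj_ofReal, Complex.conj_ofReal,
    inv_mul_eq_iff_eq_mul₀ (pow_ne_zero 2 (mul_ne_zero two_ne_zero hpi))] at h2
  exact h2

/-- Weak solutions that are continuous in `L²` and bounded in `H^{1+α}` are mild solutions. -/
theorem mild_of_weak (hα : α ∈ Set.Icc (1 : ℝ) 2) (hT : 0 < T) (hw : IsWeakSolution α T u₀ v)
    (hc : Continuous u) (h0 : u 0 = u₀) (huv : ∀ t ∈ Set.Icc 0 T, v t = u t)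
    (hb : ∀ t, hsn (1 + α) (fun k => ‖coeff (toC (u t)) k‖ₑ) ≤ ENNReal.ofReal A) :
    IsMildSolution α T A u₀ u := by
  refine ⟨hc, h0, hb, fun t ht k => ?_⟩
  have hpi : (Real.pi : ℂ) ≠ 0 := by exact_mod_cast Real.pi_ne_zero
  set a : ℝ → ℂ := fun t => coeff (toC (u t)) k with ha
  set r : ℝ → ℂ := fun t => rhs α (coeff (toC (u t))) k with hr
  have hac : Continuous a := (continuous_coeff k).comp hc
  have hrc : Continuous r := (continuous_rhs_coeff α k).comp hc
  set c : ℂ := coeff (toC u₀) k with hcdef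
  have hG : ∀ t, HasDerivAt (fun t => c + ∫ s in (0 : ℝ)..t, r s) (r t) t := fun t =>
    (hrc.integral_hasStrictDerivAt 0 t).hasDerivAt.const_add _
  have hGc : Continuous fun t => c + ∫ s in (0 : ℝ)..t, r s :=
    continuous_iff_continuousAt.2 fun t => (hG t).continuousAt
  -- The defect in the integrated equation for mode `k`, to be shown zero.
  set b : ℝ → ℂ := fun t => a t - (c + ∫ s in (0 : ℝ)..t, r s) with hbdef
  have hbc : Continuous b := hac.sub hGc
  -- Fundamental lemma of the calculus of variations: for each bump `ψ` the weak form is tested with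
  -- the primitive of `ψ` times `e^{i k·x}`.
  have key : ∀ᵐ t, t ∈ Set.Ioo 0 T → b t = 0 := by
    refine isOpen_Ioo.ae_eq_zero_of_integral_contDiff_smul_eq_zero
      (hbc.locallyIntegrable.locallyIntegrableOn _) fun ψ hψ hψc hψs => ?_
    have hψcont : Continuous fun t => (ψ t : ℂ) := Complex.continuous_ofReal.comp hψ.continuous
    have hηcont : Continuous fun t => (primitive T ψ t : ℂ) :=
      Complex.continuous_ofReal.comp (contDiff_primitive hψ).continuous
    have hweak := hw.weak _ (isTestFunction_primitive hψ hψc hψs k)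
    have e1 : ∀ t x, deriv (fun s => (primitive T ψ s : ℂ) * expMode k x) t =
        (ψ t : ℂ) * expMode k x := fun t x =>
      (((hasDerivAt_primitive hψ.continuous t).ofReal_comp).mul_const _).deriv
    have e2 : ∫ t in (0 : ℝ)..T,
        (ip (toC (v t)) (fun x => deriv (fun s => (primitive T ψ s : ℂ) * expMode k x) t)
          - ip (toC (v t)) (fracLap α (pderiv fun x => (primitive T ψ t : ℂ) * expMode k x))
          + (1 / 2) * ip (fun x => toC (v t) x ^ 2)
            (pderiv fun x => (primitive T ψ t : ℂ) * expMode k x)) =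
        (2 * (Real.pi : ℂ)) ^ 2 * ∫ t in (0 : ℝ)..T, (a t * ψ t + r t * primitive T ψ t) := by
      rw [← intervalIntegral.integral_const_mul]
      refine intervalIntegral.integral_congr fun t ht => ?_
      rw [Set.uIcc_of_le hT.le] at ht
      simp only [e1, huv t ht]
      exact weak_integrand_expMode hα (summable_norm_of_hsn (by linarith [hα.1]) (hb t)) _ _ _
    have e3 : ip (toC u₀) (fun x => (primitive T ψ 0 : ℂ) * expMode k x) =
        (2 * (Real.pi : ℂ)) ^ 2 * (c * primitive T ψ 0) := by
      have : ip (toC u₀) (fun x => (primitive T ψ 0 : ℂ) * expMode k x) =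
          primitive T ψ 0 * ip (toC u₀) (expMode k) := by
        rw [ip, ip, ← integral_const_mul]
        congr 1; ext x
        rw [map_mul, Complex.conj_ofReal]; ring
      rw [this, ip_expMode]; ring
    rw [e2, e3, ← mul_add] at hweak
    have hweak' := (mul_eq_zero.1 hweak).resolve_left
      (pow_ne_zero 2 (mul_ne_zero two_ne_zero hpi))
    -- The integrated right-hand side satisfies the same identity as `a`, by integration by parts;
    -- subtracting leaves the integral of `ψ b`.
    have hparts : ∫ t in (0 : ℝ)..T, (r t * primitive T ψ t +
        (c + ∫ s in (0 : ℝ)..t, r s) * ψ t) = -(c * primitive T ψ 0) := by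
      rw [intervalIntegral.integral_eq_sub_of_hasDerivAt
        (f := fun t => (c + ∫ s in (0 : ℝ)..t, r s) * (primitive T ψ t : ℂ))
        (fun t _ => (hG t).mul (hasDerivAt_primitive hψ.continuous t).ofReal_comp)
        (((hrc.mul hηcont).add (hGc.mul hψcont)).intervalIntegrable _ _)]
      simp [primitive]
    have hsupp : Function.support (fun t => ψ t • b t) ⊆ Set.Ioc 0 T := fun t ht => by
      have h1 : ψ t ≠ 0 := fun h => ht (by simp [h])
      have h2 := hψs (subset_tsupport ψ h1)
      exact ⟨h2.1, h2.2.le⟩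
    rw [← intervalIntegral.integral_eq_integral_of_support_subset hsupp]
    have e4 : (fun t => ψ t • b t) = fun t => (a t * ψ t + r t * primitive T ψ t) -
        (r t * primitive T ψ t + (c + ∫ s in (0 : ℝ)..t, r s) * ψ t) := by
      ext t
      simp only [hbdef, Complex.real_smul]; ring
    have e5 : Continuous fun t => a t * ψ t + r t * primitive T ψ t :=
      (hac.mul hψcont).add (hrc.mul hηcont)
    have e6 : Continuous fun t => r t * primitive T ψ t + (c + ∫ s in (0 : ℝ)..t, r s) * ψ t :=
      (hrc.mul hηcont).add (hGc.mul hψcont)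
    rw [e4, intervalIntegral.integral_sub (e5.intervalIntegrable _ _)
      (e6.intervalIntegrable _ _), hparts]
    linear_combination hweak'
  have h1 := Icc_subset_of_ae_mem hT (isClosed_eq hbc continuous_const) key ht
  exact sub_eq_zero.1 h1

theorem IsTimeDerivative.continuousOn {g : ℝ → L2} (hT : 0 < T) (h : IsTimeDerivative T u g) :
    ContinuousOn u (Set.Icc 0 T) := by
  have hi : IntegrableOn g (Set.uIcc 0 T) := by
    rw [Set.uIcc_of_le hT.le]
    exact h.bounded.integrable le_top
  have h1 := intervalIntegral.continuousOn_primitive_interval hi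
  rw [Set.uIcc_of_le hT.le] at h1
  exact (continuousOn_const.add h1).congr h.integral_eq

/-- The time derivative makes `v` continuous, so the Sobolev bound, given only for almost every
time, extends to all times by closedness of Sobolev balls. -/
theorem IsStrongSolution.exists_mild (hα : α ∈ Set.Icc (1 : ℝ) 2) (hT : 0 < T)
    (h : IsStrongSolution α T u₀ v) :
    ∃ A u, IsMildSolution α T A u₀ u ∧ ∀ t ∈ Set.Icc 0 T, v t = u t := by
  obtain ⟨g, hg⟩ := h.timeDeriv
  obtain ⟨M, hM⟩ := h.sobolev
  have hvc := hg.continuousOn hT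
  let u : ℝ → L2 := fun t => v (Set.projIcc 0 T hT.le t)
  have huv : ∀ t ∈ Set.Icc 0 T, v t = u t := fun t ht => by
    simp only [u, Set.projIcc_of_mem hT.le ht]
  have huc : Continuous u :=
    (continuousOn_iff_continuous_domRestrict.1 hvc).comp continuous_projIcc
  have hb : Set.Icc 0 T ⊆
      {t | hsn (1 + α) (fun k => ‖coeff (toC (u t)) k‖ₑ) ≤ ENNReal.ofReal |M|} := by
    refine Icc_subset_of_ae_mem hT ((isClosed_hsn_le (1 + α) (ENNReal.ofReal |M|)).preimage huc) ?_
    filter_upwards [(ae_restrict_iff' measurableSet_Icc).1 hM] with t ht hto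
    have htc : t ∈ Set.Icc 0 T := ⟨hto.1.le, hto.2.le⟩
    have h1 := ht htc
    rw [huv t htc] at h1
    exact (sobolev_iff (abs_nonneg M) _).1 ⟨h1.1, h1.2.trans (le_abs_self M)⟩
  refine ⟨|M|, u, mild_of_weak hα hT h.weak huc ?_ huv fun t => ?_, huv⟩
  · rw [← huv 0 ⟨le_rfl, hT.le⟩, h.init]
  · have h1 := hb (Set.projIcc 0 T hT.le t).2
    simpa only [u, Set.mem_ofPred_eq, Set.projIcc_val] using h1

/-- With identical data the stability estimate holds at every level `J` with a bound that tends to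
0. -/
theorem IsMildSolution.eqOn {A₁ A₂ : ℝ} (hα : α ∈ Set.Icc (1 : ℝ) 2)
    (hu : IsMildSolution α T A₁ u₀ u) (hv : IsMildSolution α T A₂ u₀ v) {t : ℝ}
    (ht : t ∈ Set.Icc 0 T) : u t = v t := by
  obtain ⟨δ, hδ, hst⟩ := exists_stability_norm hα T (A := max 1 (max A₁ A₂)) (le_max_left _ _)
  have h1 : ∀ᶠ J in atTop, ‖u t - v t‖ ≤ δ J := by
    filter_upwards [eventually_ge_atTop 1] with J hJ
    refine hst J hJ u v ((hu.isCoeffSol J).mono ?_ le_rfl) ((hv.isCoeffSol J).mono ?_ le_rfl)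
      (fun k _ => by rw [hu.init, hv.init]) t ht
    · exact (le_max_left _ _).trans (le_max_right _ _)
    · exact (le_max_right _ _).trans (le_max_right _ _)
  exact sub_eq_zero.1 (norm_le_zero_iff.1 (ge_of_tendsto hδ h1))

end Uniqueness

/-! ### Mild solutions are strong solutions, and the final assembly. -/

section Strong

variable {α T A : ℝ} {u₀ : L2} {u : ℝ → L2}

theorem IsMildSolution.isStrongSolution (hα : α ∈ Set.Icc (1 : ℝ) 2) (hT : 0 < T) (hA : 0 ≤ A)
    (h : IsMildSolution α T A u₀ u) : IsStrongSolution α T u₀ u where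
  weak := h.isWeakSolution hα hT hA
  init := h.init
  sobolev := ⟨A, ae_of_all _ fun t => (sobolev_iff hA _).2 (h.bound t)⟩
  timeDeriv := by
    obtain ⟨g, hgm, hgb, hg⟩ := h.exists_rhs hα hA
    exact ⟨g, isTimeDerivative_of_coeff h hgm hgb hg⟩

theorem IsMildSolution.satisfiesEquation (hα : α ∈ Set.Icc (1 : ℝ) 2) (hA : 0 ≤ A)
    (h : IsMildSolution α T A u₀ u) : SatisfiesEquation α T u := by
  obtain ⟨g, hgm, hgb, hg⟩ := h.exists_rhs hα hA
  exact ⟨g, isTimeDerivative_of_coeff h hgm hgb hg,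
    ae_of_all _ fun t => exists_equation hα (h.bound t) (hg t)⟩

end Strong

end FZK
end

theorem lemma3p3 (α : ℝ) (hα : α ∈ Set.Icc (1 : ℝ) 2) (R : ℝ) :
    ∃ T : ℝ, 0 < T ∧ ∃ C : ℝ, ∀ u₀ : FZK.L2,
      FZK.MemSobolev (1 + α) u₀ → FZK.sobolevNorm (1 + α) u₀ ≤ R →
      (∀ N : ℕ, ∃ w : ℝ → FZK.L2, FZK.IsGalerkinSolution α T u₀ N w) ∧
      (∀ (N : ℕ) (w : ℝ → FZK.L2), FZK.IsGalerkinSolution α T u₀ N w →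
        ∀ t ∈ Set.Icc 0 T,
          ‖w t‖ ≤ C ∧
          ‖derivWithin w (Set.Icc 0 T) t‖ ≤ C ∧
          FZK.MemSobolev (1 + α) (w t) ∧ FZK.sobolevNorm (1 + α) (w t) ≤ C) ∧
      ∃ u : ℝ → FZK.L2,
        FZK.IsStrongSolution α T u₀ u ∧
        FZK.SatisfiesEquation α T u ∧
        ContinuousOn u (Set.Icc 0 T) ∧
        (∀ v : ℝ → FZK.L2, FZK.IsStrongSolution α T u₀ v →
          ∀ t ∈ Set.Icc 0 T, v t = u t) ∧
        (∀ w : ℕ → ℝ → FZK.L2, (∀ N, FZK.IsGalerkinSolution α T u₀ N (w N)) →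
          TendstoUniformlyOn w u atTop (Set.Icc 0 T)) := by
  obtain ⟨T, hT, A, hA, h⟩ := FZK.exists_galerkin_bound hα R
  have hA0 : 0 ≤ A := zero_le_one.trans hA
  have hpi := Real.pi_gt_three
  have hc : 0 ≤ 2 * Real.pi * (2 * (A + 256 * (A * A))) := by positivity
  have hc' : 0 ≤ 2 * Real.pi * A := by positivity
  -- One constant dominating the Sobolev bound, the `L²` bound and the bound for the time
  -- derivative.
  refine ⟨T, hT, A + 2 * Real.pi * A + 2 * Real.pi * (2 * (A + 256 * (A * A))),
    fun u₀ hm hn => ?_⟩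
  have hw := h u₀ hm hn
  obtain ⟨u, hu, hconv⟩ := FZK.exists_isMildSolution hα hT hA hw
  refine ⟨FZK.exists_isGalerkinSolution α hT u₀, fun N w hwN t ht => ?_, u,
    hu.isStrongSolution hα hT hA0, hu.satisfiesEquation hα hA0, hu.cont.continuousOn,
    fun v hv t ht => ?_, hconv⟩
  · have hb := (hw N w hwN).bound t ht
    have h1 := FZK.norm_le_of_hsn_le hα hA0 hb
    have h2 := FZK.norm_derivWithin_le hα hA0 hT hwN ht hb
    have h3 := (FZK.sobolev_iff hA0 (w t)).2 hb
    exact ⟨by linarith, by linarith, h3.1, by linarith [h3.2]⟩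
  · obtain ⟨B, u', hu', hvu⟩ := hv.exists_mild hα hT
    rw [hvu t ht]
    exact hu'.eqOn hα hu ht
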